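/- **Signature and ground terms.** Let $\Sigma$ be a finite set of function symbols and $C_0$ a finite set of constants. A subset $\Sigma_A\subseteq\Sigma$ consists of associative symbols, which are variadic of arity at least $2$; every other symbol has a fixed positive arity. Let $f\in\Sigma_A$, a unary $i\in\Sigma\setminus\Sigma_A$ and $1\in C_0$ be the interpreted symbols. The group axioms $G$ consist of the set $A$ of associativity axioms of all symbols of $\Sigma_A$, together with $f(x,1)\approx x$, $f(1,x)\approx x$, $f(x,i(x))\approx 1$ and $f(i(x),x)\approx 1$. Let a total precedence on $C_0$ with least element $1$ be given, and let $W=\{c_0,c_1,\dots\}$ be new constants. Let $E$ be a finite set of ground equations (unordered pairs) between terms over $\Sigma$ and $C_0$ in which no associative symbol other than $f$ occurs, and let $\approx^G_E$ be the smallest congruence on the ground terms over $\Sigma$ and $C_0$ that contains $E$ and all ground instances of $G$. For a set $R$ of rules, $s\to_{R/A}t$ means $s\approx_A s'\to_R t'\approx_A t$ for some $s',t'$. Let $R(G)$ be the rules $i(1)\to1$, $f(x,1)\to x$, $f(1,x)\to x$, $i(i(x))\to x$, $f(x,i(x))\to1$, $f(i(x),x)\to1$, $i(f(x,y))\to f(i(y),i(x))$.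 A *flat equation* has the form $c\approx d$, $g(c_1,\dots,c_n)\approx c$, or $g(c_1,\dots,c_m)\approx g(d_1,\dots,d_n)$ with $g\in\Sigma_A$, with constants as arguments. **The set $S(E)$.** *Phase I.* Flatten all terms of $E$ with respect to associativity, replace them by their $R(G)/A$-normal forms, and delete trivial equations. Then repeat, until all equations are flat, the following on an equation that is not flat: replace an occurrence, strictly inside a side, of a term $u=g(d_1,\dots,d_k)$ with constant arguments $d_j$ by a constant $c\in W$ and add $u\approx c$; or, if both sides are flat terms, replace one side $u$ or both sides in this way. Here $c$ is new, or was introduced earlier and $u\approx c$ is already present. Let $E'$ be the result and $C'$ the set $C_0$ together with the introduced constants. *Phase II.* For each $c\in C'\setminus\{1\}$ such that $E'$ (as obtained by Phase I) contains no equation $i(c)\approx d$ and no equation $i(d)\approx c$ with $d\in C'$, add $i(c)\approx c'$ to $E'$ with a new constant $c'\in W$ (distinct for distinct $c$). Let $E''$ be the resulting set of equations, and let $C$ be $C'$ together with these constants. Then $S(E)$ is the union of $E''$, of $\{i(1)\approx1\}$, of the equations $i(d)\approx c$, $f(c,d)\approx1$, $f(d,c)\approx1$ for all $i(c)\approx d$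 in $E''$, and of $U(C)=\{f(c,1)\approx c,\ f(1,c)\approx c: c\in C\}$. **The monoid presentation.** $R(E)$ is the set of equations of $S(E)\setminus U(C)$ in which $f$ occurs, and $C(R)$ is the set of constants other than $1$ that occur in $R(E)$. The monoid presentation $\langle C(R)\mid R(E)\rangle$ reads $f(c_1,\dots,c_n)$ as the word $c_1\cdots c_n$ and $1$ as the empty word. **Completion.** Order constants by: elements of $W$ are greater than those of $C_0$; $c_m\succ c_n$ if $m<n$; the precedence on $C_0$. Put $t\succ c$ for $t$ a non-constant flat term and $c$ a constant, and $g(u)\succ g(v)$ for $g\in\Sigma_A$ and strings $u,v$ of constants of length at least $2$ with $u$ greater than $v$ length-lexicographically. For $g\in\Sigma_A$ write $\bar g(u)=g(u)$ if $|u|\ge2$ and $\bar g(c)=c$; if a term $t=\bar g(v)$ stands inside a string it means $v$. The inference rules on sets of flat equations are, with $g\in\Sigma_A$ in the first two: * DEDUCE: from $g(u_1u_2)\approx s$ and $g(u_2u_3)\approx t$ add $g(u_1t)\approx g(su_3)$, if $u_1,u_2,u_3$ are nonempty, $g(u_1u_2)\succ s$ and $g(u_2u_3)\succ t$. * SIMPLIFY: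 replace $g(u_1u_2u_3)\approx s$ by $\bar g(u_1tu_3)\approx s$ using $g(u_2)\approx t$, if $g(u_2)\succ t$, and $s\succ t$ in case $u_1u_3$ is empty. * COLLAPSE: replace $s[u]\approx t$ by $s[d]\approx t$ (one occurrence) using $u\approx d$, if $s[u]\succ t$, $u\succ d$, $d$ is a constant, $u$ is not headed by a symbol of $\Sigma_A$, and $t\succ d$ in case $s[u]=u$. * COMPOSE: replace $t\approx c$ by $t\approx d$ using $c\approx d$, if $c,d$ are constants and $t\succ c\succ d$. * DELETE: remove $s\approx s$. A *derivation* from $S(E)$ is a sequence $S_0=S(E),S_1,\dots$ in which each $S_{j+1}$ arises from $S_j$ by one inference or equals $S_j$ (so that finite derivations are included by repeating the last state). It is *fair* if every inference that is enabled at all stages from some $k$ on is applied at some stage $j$, with $j\ge k$ unless the inference is a DEDUCE. Put $S_\infty(E)=\bigcup_k\bigcap_{j\ge k}S_j$, and let $S_\infty^\succ(E)$ be the rewrite system obtained by orienting its equations by $\succ$. **Proposition 3.21.** Suppose that the monoid presented by $\langle C(R)\mid R(E)\rangle$, for a set $S(E)$ obtained by Phases I and II, is a finite group. Then: 1. For every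 fair derivation from $S(E)$, the set $S_\infty(E)$ is finite. 2. The completion terminates, in the sense that, for every fair derivation, there is an $n$ such that for all $j\ge n$ we have $S_\infty(E)\subseteq S_j$ and the two sides of every equation of $S_j$ rewrite by $S_\infty^\succ(E)/A$ to terms that are equal modulo associativity. 3. The word problem for $E$ modulo $G$ is decidable: there is an algorithm that decides for ground terms $s,t$ over $\Sigma$ and $C_0$ whether $s\approx^G_E t$. -/

import Mathlib

/-! Ground completion modulo the group axioms: signatures, ground terms, the flattening phases,
the string-based completion procedure, and the word problem. -/

/-- A signature with function symbols `F` and constant symbols `K`: a set of associative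
(variadic, at least binary) symbols, fixed positive arities for the other symbols, and the
interpreted symbols `f`, `i`, `1` of the group axioms. -/
structure GroupSignature (F K : Type*) where
  assoc : Set F
  arity : F → ℕ
  f : F
  i : F
  one : K
  arity_pos : ∀ g, 1 ≤ arity g
  f_assoc : f ∈ assoc
  i_not_assoc : i ∉ assoc
  arity_i : arity i = 1

namespace GroupSignature

/-- `g` may be applied to `n` arguments. -/
def IsArity {F K : Type*} (sig : GroupSignature F K) (g : F) (n : ℕ) : Prop :=
  (g ∈ sig.assoc → 2 ≤ n) ∧ (g ∉ sig.assoc → n = sig.arity g)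

theorem isArity_i {F K : Type*} (sig : GroupSignature F K) : sig.IsArity sig.i 1 :=
  ⟨fun h => absurd h sig.i_not_assoc, fun _ => sig.arity_i.symm⟩

theorem isArity_f {F K : Type*} (sig : GroupSignature F K) {n : ℕ} (hn : 2 ≤ n) :
    sig.IsArity sig.f n :=
  ⟨fun _ => hn, fun h => absurd sig.f_assoc h⟩

/-- Ground terms over the function symbols of `sig` and constants from `V`. -/
inductive Term {F K : Type*} (sig : GroupSignature F K) (V : Type*) where
  | const (c : V) : Term sig V
  | app (g : F) (n : ℕ) (h : sig.IsArity g n) (args : Fin n → Term sig V) : Term sig V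

namespace Term

/-- `g(l₁, …, lₙ)` for a list `l` of arguments. -/
def appList {F K V : Type*} {sig : GroupSignature F K} (g : F) (l : List (Term sig V))
    (h : sig.IsArity g l.length) : Term sig V :=
  app g l.length h l.get

/-- Renaming of constants. -/
def map {F K V V' : Type*} {sig : GroupSignature F K} (φ : V → V') : Term sig V → Term sig V'
  | const c => const (φ c)
  | app g n h args => app g n h fun k => (args k).map φ

/-- The term is headed by `g`. -/
def HasHead {F K V : Type*} {sig : GroupSignature F K} (g : F) : Term sig V → Prop
  | const _ => False
  | app g' _ _ _ => g' = g

/-- The function symbol `g` occurs in the term. -/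
def Occurs {F K V : Type*} {sig : GroupSignature F K} (g : F) : Term sig V → Prop
  | const _ => False
  | app g' _ _ args => g' = g ∨ ∃ k, (args k).Occurs g

/-- Associatively flat terms: no associative symbol occurs directly below itself. -/
def IsAFlat {F K V : Type*} {sig : GroupSignature F K} : Term sig V → Prop
  | const _ => True
  | app g _ _ args =>
      (∀ k, (args k).IsAFlat) ∧ (g ∈ sig.assoc → ∀ k, ¬ (args k).HasHead g)

/-- Prefix notation of a ground term: every function symbol is written together with the number
of its arguments. -/
def code {F K V : Type*} {sig : GroupSignature F K} : Term sig V → List ((F × ℕ) ⊕ V)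
  | const c => [Sum.inr c]
  | app g n _ args => Sum.inl (g, n) :: (List.ofFn fun k => (args k).code).flatten

end Term

/-- One rewrite step: one occurrence of a left-hand side of `R` is replaced by the corresponding
right-hand side. -/
inductive Rewrite {F K V : Type*} {sig : GroupSignature F K}
    (R : Term sig V → Term sig V → Prop) : Term sig V → Term sig V → Prop
  | root {s t : Term sig V} : R s t → Rewrite R s t
  | arg (g : F) (n : ℕ) (h : sig.IsArity g n) (args : Fin n → Term sig V) (k : Fin n)
      {t : Term sig V} : Rewrite R (args k) t →
      Rewrite R (.app g n h args) (.app g n h (Function.update args k t))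

/-- The smallest congruence on ground terms that contains `R`. -/
inductive CongruenceClosure {F K V : Type*} {sig : GroupSignature F K}
    (R : Term sig V → Term sig V → Prop) : Term sig V → Term sig V → Prop
  | base {s t : Term sig V} : R s t → CongruenceClosure R s t
  | refl (s : Term sig V) : CongruenceClosure R s s
  | symm {s t : Term sig V} : CongruenceClosure R s t → CongruenceClosure R t s
  | trans {s t u : Term sig V} :
      CongruenceClosure R s t → CongruenceClosure R t u → CongruenceClosure R s u
  | congr (g : F) (n : ℕ) (h : sig.IsArity g n) {a b : Fin n → Term sig V} :
      (∀ k, CongruenceClosure R (a k) (b k)) →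
      CongruenceClosure R (.app g n h a) (.app g n h b)

/-- Ground instances of the associativity axioms
`g(x₁,…,xₘ, g(y₁,…,yⱼ), z₁,…,zₙ) ≈ g(x₁,…,xₘ, y₁,…,yⱼ, z₁,…,zₙ)`, `g` associative. -/
inductive AssocInstance {F K V : Type*} (sig : GroupSignature F K) :
    Term sig V → Term sig V → Prop
  | mk (g : F) (hg : g ∈ sig.assoc) (x y z : List (Term sig V))
      (hy : sig.IsArity g y.length)
      (h : sig.IsArity g (x ++ Term.appList g y hy :: z).length)
      (h' : sig.IsArity g (x ++ (y ++ z)).length) :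
      AssocInstance sig (Term.appList g (x ++ Term.appList g y hy :: z) h)
        (Term.appList g (x ++ (y ++ z)) h')

/-- Equality of ground terms modulo associativity. -/
def AssocEq {F K V : Type*} (sig : GroupSignature F K) : Term sig V → Term sig V → Prop :=
  CongruenceClosure (AssocInstance sig)

/-- The rewrite relation `R/A`. -/
def RewriteMod {F K V : Type*} {sig : GroupSignature F K}
    (R : Term sig V → Term sig V → Prop) (s t : Term sig V) : Prop :=
  ∃ s' t', AssocEq sig s s' ∧ Rewrite R s' t' ∧ AssocEq sig t' t

/-- `s` and `t` rewrite by `R/A` to terms that are equal modulo associativity. -/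
def JoinableMod {F K V : Type*} {sig : GroupSignature F K}
    (R : Term sig V → Term sig V → Prop) (s t : Term sig V) : Prop :=
  ∃ u v, Relation.ReflTransGen (RewriteMod R) s u ∧ Relation.ReflTransGen (RewriteMod R) t v ∧
    AssocEq sig u v

/-- The term `f(s, t)`. -/
def mul {F K V : Type*} (sig : GroupSignature F K) (s t : Term sig V) : Term sig V :=
  .app sig.f 2 (sig.isArity_f le_rfl) ![s, t]

/-- The term `i(s)`. -/
def inv {F K V : Type*} (sig : GroupSignature F K) (s : Term sig V) : Term sig V :=
  .app sig.i 1 sig.isArity_i ![s]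

/-- The term `1`. -/
def unit {F K : Type*} (sig : GroupSignature F K) : Term sig K := .const sig.one

/-- Ground instances of the group axioms (with associativity of all associative symbols). -/
inductive GroupAxiom {F K : Type*} (sig : GroupSignature F K) : Term sig K → Term sig K → Prop
  | assoc {s t : Term sig K} : AssocInstance sig s t → GroupAxiom sig s t
  | mul_one (x : Term sig K) : GroupAxiom sig (sig.mul x sig.unit) x
  | one_mul (x : Term sig K) : GroupAxiom sig (sig.mul sig.unit x) x
  | mul_inv (x : Term sig K) : GroupAxiom sig (sig.mul x (sig.inv x)) sig.unit
  | inv_mul (x : Term sig K) : GroupAxiom sig (sig.mul (sig.inv x) x) sig.unit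

/-- Equality of ground terms modulo the ground equations `E` and the group axioms. -/
def EqMod {F K : Type*} (sig : GroupSignature F K) (E : Set (Sym2 (Term sig K))) :
    Term sig K → Term sig K → Prop :=
  CongruenceClosure fun s t => s(s, t) ∈ E ∨ GroupAxiom sig s t

/-- There is an algorithm that decides, given two ground terms in prefix notation, whether they
are equal modulo `E` and the group axioms. The numberings of the finitely many symbols are
arbitrary. -/
def WordProblemDecidable {F K : Type*} (sig : GroupSignature F K)
    (E : Set (Sym2 (Term sig K))) : Prop :=
  ∀ (_ : Primcodable F) (_ : Primcodable K),
    ComputablePred fun p : List ((F × ℕ) ⊕ K) × List ((F × ℕ) ⊕ K) =>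
      ∃ s t : Term sig K, s.code = p.1 ∧ t.code = p.2 ∧ EqMod sig E s t

/-- Ground instances of the rules of the convergent rewrite system `R(G)` for groups. -/
inductive GroupRule {F K : Type*} (sig : GroupSignature F K) : Term sig K → Term sig K → Prop
  | inv_one : GroupRule sig (sig.inv sig.unit) sig.unit
  | mul_one (x : Term sig K) : GroupRule sig (sig.mul x sig.unit) x
  | one_mul (x : Term sig K) : GroupRule sig (sig.mul sig.unit x) x
  | inv_inv (x : Term sig K) : GroupRule sig (sig.inv (sig.inv x)) x
  | mul_inv (x : Term sig K) : GroupRule sig (sig.mul x (sig.inv x)) sig.unit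
  | inv_mul (x : Term sig K) : GroupRule sig (sig.mul (sig.inv x) x) sig.unit
  | inv_of_mul (x y : Term sig K) :
      GroupRule sig (sig.inv (sig.mul x y)) (sig.mul (sig.inv y) (sig.inv x))

/-! ### Flat terms and flat equations -/

/-- Constants: the given ones, `Sum.inl a`, and the new ones `c₀, c₁, …`, `Sum.inr n`. -/
abbrev Cst (K : Type*) := K ⊕ ℕ

/-- Flat terms: a constant, or a function symbol applied to a string of constants. -/
inductive FlatTerm {F K : Type*} (sig : GroupSignature F K) where
  | const (c : Cst K) : FlatTerm sig
  | app (g : F) (w : List (Cst K)) (h : sig.IsArity g w.length) : FlatTerm sig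

namespace FlatTerm

/-- A flat term as a ground term. -/
def toTerm {F K : Type*} {sig : GroupSignature F K} : FlatTerm sig → Term sig (Cst K)
  | const c => .const c
  | app g w h => .app g w.length h fun k => .const (w.get k)

/-- The string of the constants that occur in a flat term. -/
def word {F K : Type*} {sig : GroupSignature F K} : FlatTerm sig → List (Cst K)
  | const c => [c]
  | app _ w _ => w

/-- The flat term is headed by a symbol that belongs to `P`. -/
def HeadIn {F K : Type*} {sig : GroupSignature F K} (P : Set F) : FlatTerm sig → Prop
  | const _ => False
  | app g _ _ => g ∈ P

end FlatTerm

/-- The flat term `i(c)`. -/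
def flatInv {F K : Type*} (sig : GroupSignature F K) (c : Cst K) : FlatTerm sig :=
  .app sig.i [c] sig.isArity_i

/-- The flat term `f(c, d)`. -/
def flatMul {F K : Type*} (sig : GroupSignature F K) (c d : Cst K) : FlatTerm sig :=
  .app sig.f [c, d] (sig.isArity_f le_rfl)

/-- The flat term `1`. -/
def flatOne {F K : Type*} (sig : GroupSignature F K) : FlatTerm sig := .const (Sum.inl sig.one)

/-- Flat equations: constant equations `c ≈ d`, `D`-flat equations `g(c₁,…,cₙ) ≈ c`, and `A`-flat
equations `g(c₁,…,cₘ) ≈ g(d₁,…,dₙ)` with `g` associative. -/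
inductive IsFlatEqn {F K : Type*} (sig : GroupSignature F K) : Sym2 (FlatTerm sig) → Prop
  | constant (c d : Cst K) : IsFlatEqn sig s(.const c, .const d)
  | dflat (g : F) (w : List (Cst K)) (h : sig.IsArity g w.length) (c : Cst K) :
      IsFlatEqn sig s(.app g w h, .const c)
  | aflat (g : F) (hg : g ∈ sig.assoc) (w w' : List (Cst K)) (h : sig.IsArity g w.length)
      (h' : sig.IsArity g w'.length) : IsFlatEqn sig s(.app g w h, .app g w' h')

/-- An equation between ground terms that is a flat equation. -/
def IsFlat {F K : Type*} (sig : GroupSignature F K) (e : Sym2 (Term sig (Cst K))) : Prop :=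
  ∃ e' : Sym2 (FlatTerm sig), IsFlatEqn sig e' ∧ e'.map FlatTerm.toTerm = e

/-! ### Phase I -/

/-- Step 1: the associatively flattened equations. -/
def flattenedEqns {F K : Type*} (sig : GroupSignature F K) (E : Set (Sym2 (Term sig K))) :
    Set (Sym2 (Term sig K)) :=
  {e | ∃ s t s' t', s(s, t) ∈ E ∧ AssocEq sig s s' ∧ s'.IsAFlat ∧ AssocEq sig t t' ∧ t'.IsAFlat ∧
    e = s(s', t')}

/-- `t` is the associatively flat normal form of `s` with respect to `R(G)/A`. -/
def IsGroupNormalForm {F K : Type*} (sig : GroupSignature F K) (s t : Term sig K) : Prop :=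
  Relation.ReflTransGen (RewriteMod (GroupRule sig)) s t ∧ t.IsAFlat ∧
    ∀ t', ¬ RewriteMod (GroupRule sig) t t'

/-- Step 2: both sides are normalized by `R(G)/A`, and trivial equations are removed. -/
def normalizedEqns {F K : Type*} (sig : GroupSignature F K) (E : Set (Sym2 (Term sig K))) :
    Set (Sym2 (Term sig K)) :=
  {e | ∃ s t s' t', s(s, t) ∈ E ∧ IsGroupNormalForm sig s s' ∧ IsGroupNormalForm sig t t' ∧
    s' ≠ t' ∧ e = s(s', t')}

/-- `cₙ` may be used as a name for the flat term `u`: it is a new constant, or it is a constant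
that was introduced earlier and `u ≈ cₙ` is among the equations `T`. -/
def IsName {F K : Type*} (sig : GroupSignature F K) (D : Finset ℕ)
    (T : Set (Sym2 (Term sig (Cst K)))) (u : FlatTerm sig) (n : ℕ) : Prop :=
  n ∉ D ∨ s(u.toTerm, .const (Sum.inr n)) ∈ T

/-- Step 3, one step. A state consists of the set of the new constants introduced so far and of
the current equations. An equation that is not flat is transformed: `inner` replaces an
occurrence, strictly inside one side, of a term `g(c₁,…,cₖ)` by a constant that names this term;
if both sides are flat terms, then one side (`oneSide`) or both sides (`bothSides`) are replaced
by constants that name them. -/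
inductive FlattenStep {F K : Type*} (sig : GroupSignature F K) :
    Finset ℕ × Set (Sym2 (Term sig (Cst K))) → Finset ℕ × Set (Sym2 (Term sig (Cst K))) → Prop
  | inner (D : Finset ℕ) (T : Set (Sym2 (Term sig (Cst K)))) (s s' t : Term sig (Cst K))
      (g : F) (w : List (Cst K)) (h : sig.IsArity g w.length) (n : ℕ)
      (hmem : s(s, t) ∈ T) (hflat : ¬ IsFlat sig s(s, t))
      (hproper : s ≠ (FlatTerm.app g w h).toTerm)
      (hname : IsName sig D T (.app g w h) n)
      (hs : Rewrite (fun a b => a = (FlatTerm.app g w h).toTerm ∧ b = .const (Sum.inr n)) s s') :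
      FlattenStep sig (D, T)
        (insert n D, (T \ {s(s, t)}) ∪
          {s(s', t), s((FlatTerm.app g w h).toTerm, .const (Sum.inr n))})
  | oneSide (D : Finset ℕ) (T : Set (Sym2 (Term sig (Cst K)))) (u v : FlatTerm sig) (n : ℕ)
      (hmem : s(u.toTerm, v.toTerm) ∈ T) (hflat : ¬ IsFlat sig s(u.toTerm, v.toTerm))
      (hname : IsName sig D T u n) :
      FlattenStep sig (D, T)
        (insert n D, (T \ {s(u.toTerm, v.toTerm)}) ∪
          {s(v.toTerm, .const (Sum.inr n)), s(u.toTerm, .const (Sum.inr n))})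
  | bothSides (D : Finset ℕ) (T : Set (Sym2 (Term sig (Cst K)))) (u v : FlatTerm sig) (m n : ℕ)
      (hmem : s(u.toTerm, v.toTerm) ∈ T) (hflat : ¬ IsFlat sig s(u.toTerm, v.toTerm))
      (hu : IsName sig D T u m) (hv : IsName sig (insert m D) T v n) :
      FlattenStep sig (D, T)
        (insert n (insert m D), (T \ {s(u.toTerm, v.toTerm)}) ∪
          {s(u.toTerm, .const (Sum.inr m)), s(v.toTerm, .const (Sum.inr n)),
            s(.const (Sum.inr m), .const (Sum.inr n))})

/-- `E'` is an output of Phase I on `E`, with the new constants `cₙ`, `n ∈ D`. -/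
def IsPhaseOne {F K : Type*} (sig : GroupSignature F K) (E : Set (Sym2 (Term sig K)))
    (D : Finset ℕ) (E' : Set (Sym2 (FlatTerm sig))) : Prop :=
  ∃ T : Set (Sym2 (Term sig (Cst K))),
    Relation.ReflTransGen (FlattenStep sig)
      (∅, Sym2.map (Term.map Sum.inl) '' normalizedEqns sig (flattenedEqns sig E)) (D, T) ∧
    (∀ e ∈ T, IsFlat sig e) ∧ E' = {e | e.map FlatTerm.toTerm ∈ T}

/-! ### Phase II -/

/-- The set of constants consisting of all given constants and of the new constants `cₙ`,
`n ∈ D`. -/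
def constants (K : Type*) (D : Finset ℕ) : Set (Cst K) :=
  Set.range Sum.inl ∪ Sum.inr '' (D : Set ℕ)

/-- `c` is a constant other than `1` for which no inverse is given by `E'`. -/
def NeedsInverse {F K : Type*} (sig : GroupSignature F K) (D : Finset ℕ)
    (E' : Set (Sym2 (FlatTerm sig))) (c : Cst K) : Prop :=
  c ∈ constants K D ∧ c ≠ Sum.inl sig.one ∧
    (∀ d ∈ constants K D, s(sig.flatInv c, .const d) ∉ E') ∧
    (∀ d ∈ constants K D, s(sig.flatInv d, .const c) ∉ E')

/-- The set `I(E')`. -/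
def inverseEqns {F K : Type*} (sig : GroupSignature F K) (E' : Set (Sym2 (FlatTerm sig))) :
    Set (Sym2 (FlatTerm sig)) :=
  {s(sig.flatInv (Sum.inl sig.one), sig.flatOne)} ∪
  {e | ∃ c d : Cst K, s(sig.flatInv c, .const d) ∈ E' ∧
    (e = s(sig.flatInv d, .const c) ∨ e = s(sig.flatMul c d, sig.flatOne) ∨
      e = s(sig.flatMul d c, sig.flatOne))}

/-- The set `U(C)` of the equations `f(c, 1) ≈ c` and `f(1, c) ≈ c`, `c ∈ C`. -/
def unitEqns {F K : Type*} (sig : GroupSignature F K) (C : Set (Cst K)) :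
    Set (Sym2 (FlatTerm sig)) :=
  {e | ∃ c ∈ C, e = s(sig.flatMul c (Sum.inl sig.one), .const c) ∨
    e = s(sig.flatMul (Sum.inl sig.one) c, .const c)}

/-- `S` is an output of Phase II on `E'` and the new constants `cₙ`, `n ∈ D`; the resulting set of
constants is `C`. The function `ν` chooses the new constants for the missing inverses. -/
def IsPhaseTwo {F K : Type*} (sig : GroupSignature F K) (D : Finset ℕ)
    (E' : Set (Sym2 (FlatTerm sig))) (C : Set (Cst K)) (S : Set (Sym2 (FlatTerm sig))) : Prop :=
  ∃ (ν : Cst K → ℕ) (E'' : Set (Sym2 (FlatTerm sig))),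
    Set.InjOn ν {c | NeedsInverse sig D E' c} ∧
    (∀ c, NeedsInverse sig D E' c → ν c ∉ D) ∧
    E'' = E' ∪ {e | ∃ c, NeedsInverse sig D E' c ∧
      e = s(sig.flatInv c, .const (Sum.inr (ν c)))} ∧
    C = constants K D ∪ {d | ∃ c, NeedsInverse sig D E' c ∧ d = Sum.inr (ν c)} ∧
    S = E'' ∪ inverseEqns sig E'' ∪ unitEqns sig C

/-- `S` is a set `S(E)` and `C` is its set of constants: an output of Phases I and II on `E`. -/
def IsInitialSystem {F K : Type*} (sig : GroupSignature F K) (E : Set (Sym2 (Term sig K)))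
    (C : Set (Cst K)) (S : Set (Sym2 (FlatTerm sig))) : Prop :=
  ∃ (D : Finset ℕ) (E' : Set (Sym2 (FlatTerm sig))),
    IsPhaseOne sig E D E' ∧ IsPhaseTwo sig D E' C S

/-! ### The monoid presentation -/

/-- The set `R(E)`: the equations of `S` outside `U(C)` in which `f` occurs. -/
def relationEqns {F K : Type*} (sig : GroupSignature F K) (C : Set (Cst K))
    (S : Set (Sym2 (FlatTerm sig))) : Set (Sym2 (FlatTerm sig)) :=
  {e | e ∈ S \ unitEqns sig C ∧ ∃ t ∈ e, t.HeadIn {sig.f}}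

/-- The set `C(R)`: the constants other than `1` that occur in `R(E)`. -/
def generators {F K : Type*} (sig : GroupSignature F K) (C : Set (Cst K))
    (S : Set (Sym2 (FlatTerm sig))) : Set (Cst K) :=
  {c | c ≠ Sum.inl sig.one ∧ ∃ e ∈ relationEqns sig C S, ∃ t ∈ e, c ∈ t.word}

open Classical in
/-- The word over `C(R)` of a flat term; the constant `1` stands for the empty word. -/
noncomputable def monoidWord {F K : Type*} (sig : GroupSignature F K) (C : Set (Cst K))
    (S : Set (Sym2 (FlatTerm sig))) (t : FlatTerm sig) : FreeMonoid (generators sig C S) :=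
  FreeMonoid.ofList <| t.word.filterMap fun c =>
    if h : c ∈ generators sig C S then some ⟨c, h⟩ else none

/-- The monoid given by the monoid presentation `⟨C(R) | R(E)⟩`. -/
abbrev PresentationMonoid {F K : Type*} (sig : GroupSignature F K) (C : Set (Cst K))
    (S : Set (Sym2 (FlatTerm sig))) :=
  PresentedMonoid fun x y : FreeMonoid (generators sig C S) =>
    ∃ l r, s(l, r) ∈ relationEqns sig C S ∧ x = monoidWord sig C S l ∧ y = monoidWord sig C S r

/-! ### The ordering -/

/-- `Smaller c d` means `d ≻ c`, for constants: given constants are compared by the given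
precedence, new constants are greater than given ones, and `cₘ ≻ cₙ` if `m < n`. -/
def Smaller {K : Type*} [LinearOrder K] : Cst K → Cst K → Prop
  | Sum.inl a, Sum.inl b => a < b
  | Sum.inl _, Sum.inr _ => True
  | Sum.inr _, Sum.inl _ => False
  | Sum.inr m, Sum.inr n => n < m

/-- The ordering `s ≻ t` on flat terms; strings are compared length-lexicographically. -/
inductive Greater {F K : Type*} [LinearOrder K] (sig : GroupSignature F K) :
    FlatTerm sig → FlatTerm sig → Prop
  | constant {c d : Cst K} : Smaller d c → Greater sig (.const c) (.const d)
  | appConst (g : F) (w : List (Cst K)) (h : sig.IsArity g w.length) (c : Cst K) :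
      Greater sig (.app g w h) (.const c)
  | string {g : F} (hg : g ∈ sig.assoc) {v w : List (Cst K)} (hv : sig.IsArity g v.length)
      (hw : sig.IsArity g w.length) : List.Shortlex Smaller w v →
      Greater sig (.app g v hv) (.app g w hw)

/-! ### Phase III: completion -/

/-- `Represents g w t`: `t` is the flat term `ḡ(w)`, that is `g(w)` if `|w| ≥ 2` and the constant
`w` if `|w| = 1` (used for associative `g`). -/
inductive Represents {F K : Type*} {sig : GroupSignature F K} (g : F) :
    List (Cst K) → FlatTerm sig → Prop
  | constant (c : Cst K) : Represents g [c] (.const c)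
  | app (w : List (Cst K)) (h : sig.IsArity g w.length) : Represents g w (.app g w h)

/-- `ReplaceOne u d s s'`: `s = s[u]` and `s' = s[d]`, where one occurrence of the flat term `u` is
replaced by the constant `d`. -/
inductive ReplaceOne {F K : Type*} {sig : GroupSignature F K} (u : FlatTerm sig) (d : Cst K) :
    FlatTerm sig → FlatTerm sig → Prop
  | root : ReplaceOne u d u (.const d)
  | arg (g : F) (v w : List (Cst K)) (c : Cst K) (hc : u = .const c)
      (h : sig.IsArity g (v ++ c :: w).length) (h' : sig.IsArity g (v ++ d :: w).length) :
      ReplaceOne u d (.app g (v ++ c :: w) h) (.app g (v ++ d :: w) h')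

/-- `Inference sig del keep add`: an instance of an inference rule whose premises are the
equations in `del` and `keep`, and which deletes `del` and adds `add`. -/
inductive Inference {F K : Type*} [LinearOrder K] (sig : GroupSignature F K) :
    Set (Sym2 (FlatTerm sig)) → Set (Sym2 (FlatTerm sig)) → Set (Sym2 (FlatTerm sig)) → Prop
  | deduce (g : F) (hg : g ∈ sig.assoc) (u₁ u₂ u₃ v w : List (Cst K))
      (l₁ l₂ s t x y : FlatTerm sig) (hu₁ : u₁ ≠ []) (hu₂ : u₂ ≠ []) (hu₃ : u₃ ≠ [])
      (hl₁ : Represents g (u₁ ++ u₂) l₁) (hl₂ : Represents g (u₂ ++ u₃) l₂)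
      (hs : Represents g v s) (ht : Represents g w t)
      (hls : Greater sig l₁ s) (hlt : Greater sig l₂ t)
      (hx : Represents g (u₁ ++ w) x) (hy : Represents g (v ++ u₃) y) :
      Inference sig ∅ {s(l₁, s), s(l₂, t)} {s(x, y)}
  | simplify (g : F) (hg : g ∈ sig.assoc) (u₁ u₂ u₃ w : List (Cst K))
      (l₁ l₂ s t x : FlatTerm sig) (hu₂ : 2 ≤ u₂.length)
      (hl₁ : Represents g (u₁ ++ u₂ ++ u₃) l₁) (hl₂ : Represents g u₂ l₂)
      (ht : Represents g w t) (hlt : Greater sig l₂ t)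
      (hst : u₁ ++ u₃ = [] → Greater sig s t)
      (hx : Represents g (u₁ ++ w ++ u₃) x) :
      Inference sig {s(l₁, s)} {s(l₂, t)} {s(x, s)}
  | collapse (s t u s' : FlatTerm sig) (d : Cst K) (hst : Greater sig s t)
      (hud : Greater sig u (.const d)) (hu : ¬ u.HeadIn sig.assoc) (hs : ReplaceOne u d s s')
      (htd : s = u → Greater sig t (.const d)) :
      Inference sig {s(s, t)} {s(u, .const d)} {s(s', t)}
  | compose (t : FlatTerm sig) (c d : Cst K) (htc : Greater sig t (.const c))
      (hcd : Smaller d c) :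
      Inference sig {s(t, .const c)} {s(.const c, .const d)} {s(t, .const d)}
  | delete (s : FlatTerm sig) : Inference sig {s(s, s)} ∅ ∅

/-- A derivation that starts with `S₀`. A finite derivation is continued by repeating its last
state. -/
def IsDerivation {F K : Type*} [LinearOrder K] (sig : GroupSignature F K)
    (S₀ : Set (Sym2 (FlatTerm sig))) (S : ℕ → Set (Sym2 (FlatTerm sig))) : Prop :=
  S 0 = S₀ ∧ ∀ j, S (j + 1) = S j ∨
    ∃ del keep add, Inference sig del keep add ∧ del ⊆ S j ∧ keep ⊆ S j ∧
      S (j + 1) = (S j \ del) ∪ add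

/-- Fairness: an inference that is enabled at all stages from `k` on is applied at some stage; an
inference that deletes an equation is applied at some stage from `k` on. (For an inference that
only adds an equation, an earlier application suffices, so that finite derivations can be
fair.) -/
def IsFair {F K : Type*} [LinearOrder K] (sig : GroupSignature F K)
    (S : ℕ → Set (Sym2 (FlatTerm sig))) : Prop :=
  ∀ del keep add, Inference sig del keep add →
    ∀ k, (∀ j ≥ k, del ⊆ S j ∧ keep ⊆ S j) →
      ∃ j, (del.Nonempty → k ≤ j) ∧ del ⊆ S j ∧ keep ⊆ S j ∧ S (j + 1) = (S j \ del) ∪ add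

/-- The set of persisting equations `⋃ₖ ⋂_{j ≥ k} Sⱼ`. -/
def persisting {F K : Type*} {sig : GroupSignature F K} (S : ℕ → Set (Sym2 (FlatTerm sig))) :
    Set (Sym2 (FlatTerm sig)) :=
  {e | ∃ k, ∀ j ≥ k, e ∈ S j}

/-- The rewrite system obtained by orienting the equations of `S` by `≻`. -/
def orient {F K : Type*} [LinearOrder K] {sig : GroupSignature F K}
    (S : Set (Sym2 (FlatTerm sig))) (a b : Term sig (Cst K)) : Prop :=
  ∃ l r : FlatTerm sig, s(l, r) ∈ S ∧ Greater sig l r ∧ a = l.toTerm ∧ b = r.toTerm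

end GroupSignature

/-! Completion is string rewriting in disguise. A flat term `f(w)` is coded by the string `w`, and
`g(w)` with `g` non-associative by the letter `g` followed by the constants of `w`, each with a
separator behind it. No associative symbol other than `f` occurs, so on the relevant terms this code
is injective, rules become string rules, and the separators exclude all unwanted overlaps. Let N be
the rules of all equations of a fair derivation and P the persisting ones. Give a step from `x` by
`l → r` the cost `(x, l, r)`. Every rule of N that does not persist can be replaced by a path of
cheaper steps, so by well-founded induction every N-step becomes a path of P-steps from no larger
strings (`connected_below`). Fairness puts the critical pairs of P into N and leaves P interreduced.
Hence every peak of P is connected below its top, P is confluent, and strings connected by N are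
joinable by P (`joinable_of_connected`). The equations occurring in the derivation are therefore
joinable modulo associativity.

Finiteness: the strings over `C`, modulo the equations of the derivation, form a quotient of the
presented monoid (`finite_stringCon`). A class contains at most one P-irreducible string, so
irreducible strings have bounded length. A left-hand side of P that is a string becomes irreducible
when its first letter is removed, so it is bounded too; the remaining left-hand sides are bounded by
the arities. Finitely many persisting equations are all present from some stage on.

Word problem: let Q be the group of all ground terms modulo `E` and G. The image of the presented
monoid in Q is a finite subgroup containing the values of all constants in `C`. A second model is
built on a free product of copies of this subgroup times ℤ: uninterpreted symbols produce new free
generators labelled by their arguments, except where a finite table forces a value in the subgroup.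
The model satisfies the group axioms and `E` (`Model.exists_flatSat`) and maps to Q compatibly with
all operations (`Model.hom_op`). So two terms are equal modulo `E` and G exactly if their values in
the model agree, and reduced words of these values are primitive recursive in the prefix notation
(`Model.primrec_run`). -/

set_option autoImplicit false

/-! ### Abstract confluence and completion of string rewriting systems -/

namespace StringCompletion

open Relation

/-! ### Confluence from connectedness below peaks. -/

section Confluence

variable {α : Type*}

/-- `a` and `b` have a common `R`-reduct. -/
def Joinable (R : α → α → Prop) (a b : α) : Prop :=
  ∃ c, ReflTransGen R a c ∧ ReflTransGen R b c

/-- Every two reducts of `z` are joinable. -/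
def ConfluentAt (R : α → α → Prop) (z : α) : Prop :=
  ∀ a b, ReflTransGen R z a → ReflTransGen R z b → Joinable R a b

/-- Joinability propagates along the path: a forward step leaves a confluent point, at which the
reduct found so far and the new endpoint are joined; a backward step only lengthens a reduction. -/
theorem joinable_of_path {R : α → α → Prop} {D : α → Prop} (hD : ∀ z, D z → ConfluentAt R z)
    {a b : α} (h : ReflTransGen (fun x y => (R x y ∧ D x) ∨ (R y x ∧ D y)) a b) :
    Joinable R a b := by
  induction h with
  | refl => exact ⟨a, .refl, .refl⟩
  | @tail y y' _ hs ih =>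
    obtain ⟨c, hac, hyc⟩ := ih
    rcases hs with ⟨hs, hy⟩ | ⟨hs, _⟩
    · obtain ⟨d, hcd, hyd⟩ := hD y hy c y' hyc (.single hs)
      exact ⟨d, hac.trans hcd, hyd⟩
    · exact ⟨c, hac, .head hs hyc⟩

/-- A terminating relation all of whose peaks are connected below their top is confluent. -/
theorem confluentAt_of_connected_below {R lt : α → α → Prop} (wf : WellFounded lt)
    (hlt : ∀ a b, R a b → lt b a)
    (hpeak : ∀ z a b, R z a → R z b →
      ReflTransGen (fun x y => (R x y ∧ lt x z) ∨ (R y x ∧ lt y z)) a b) (z : α) :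
    ConfluentAt R z := by
  induction z using wf.induction with
  | _ z ih =>
    intro a' b' ha hb
    rcases ReflTransGen.cases_head ha with rfl | ⟨a, hza, haa⟩
    · exact ⟨b', hb, .refl⟩
    rcases ReflTransGen.cases_head hb with rfl | ⟨b, hzb, hbb⟩
    · exact ⟨a', .refl, ha⟩
    -- All sources on the path from `a` to `b` lie below `z` and are confluent by induction.
    -- Confluence at `a` and then at `b` extends this to the given reducts.
    obtain ⟨c, hac, hbc⟩ := joinable_of_path (D := fun x => lt x z) ih (hpeak z a b hza hzb)
    obtain ⟨d, had, hcd⟩ := ih a (hlt _ _ hza) a' c haa hac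
    obtain ⟨e, hbe, hde⟩ := ih b (hlt _ _ hzb) b' d hbb (hbc.trans hcd)
    exact ⟨e, had.trans hde, hbe⟩

end Confluence

/-! ### Proof reduction for string rewriting: from all rules to the persisting ones. -/

section Strings

variable {Γ : Type*}

/-- One rewrite step with a string rewriting system. -/
def Step (N : List Γ → List Γ → Prop) (a b : List Γ) : Prop :=
  ∃ p q l r, N l r ∧ a = p ++ l ++ q ∧ b = p ++ r ++ q

/-- Lexicographic comparison of the costs of rewrite steps. -/
def CostLt (lt : List Γ → List Γ → Prop) :
    List Γ × List Γ × List Γ → List Γ × List Γ × List Γ → Prop :=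
  Prod.Lex lt (Prod.Lex lt lt)

/-- A rewrite step, in either direction, whose cost is less than `κ`. -/
def CostStep (lt N : List Γ → List Γ → Prop) (κ : List Γ × List Γ × List Γ)
    (a b : List Γ) : Prop :=
  ∃ p q l r, N l r ∧ CostLt lt (p ++ l ++ q, l, r) κ ∧
    ((a = p ++ l ++ q ∧ b = p ++ r ++ q) ∨ (b = p ++ l ++ q ∧ a = p ++ r ++ q))

/-- A rewrite step, in either direction, from a string in `D`. -/
def StepIn (N : List Γ → List Γ → Prop) (D : List Γ → Prop) (a b : List Γ) : Prop :=
  (Step N a b ∧ D a) ∨ (Step N b a ∧ D b)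

theorem StepIn.symm {N : List Γ → List Γ → Prop} {D : List Γ → Prop} {a b : List Γ}
    (h : StepIn N D a b) : StepIn N D b a := Or.symm h

theorem stepIn_path_symm {N : List Γ → List Γ → Prop} {D : List Γ → Prop} {a b : List Γ}
    (h : ReflTransGen (StepIn N D) a b) : ReflTransGen (StepIn N D) b a := by
  induction h with
  | refl => exact .refl
  | tail _ hs ih => exact .head hs.symm ih

/-- A well-founded order on strings that is compatible with contexts. -/
structure IsReductionOrder (lt : List Γ → List Γ → Prop) : Prop where
  wf : WellFounded lt
  trans : ∀ {a b c}, lt a b → lt b c → lt a c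
  context : ∀ (p q : List Γ) {a b}, lt a b → lt (p ++ a ++ q) (p ++ b ++ q)

/-- `P` is the limit of a completion process in which all the rules of `N` occur. -/
structure IsCompletion (lt N P : List Γ → List Γ → Prop) : Prop where
  le : ∀ {l r}, P l r → N l r
  decreasing : ∀ {l r}, N l r → lt r l
  redundant : ∀ {l r}, N l r → ¬ P l r → ReflTransGen (CostStep lt N (l, l, r)) l r
  overlap : ∀ {u₁ u₂ u₃ r₁ r₂}, u₁ ≠ [] → u₂ ≠ [] → u₃ ≠ [] → P (u₁ ++ u₂) r₁ →
    P (u₂ ++ u₃) r₂ → u₁ ++ r₂ = r₁ ++ u₃ ∨ N (u₁ ++ r₂) (r₁ ++ u₃) ∨ N (r₁ ++ u₃) (u₁ ++ r₂)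
  factor : ∀ {u₁ l u₃ r₁ r₂}, P (u₁ ++ l ++ u₃) r₁ → P l r₂ → u₁ = [] ∧ u₃ = [] ∧ r₁ = r₂

variable {lt N P : List Γ → List Γ → Prop}

theorem Step.context {a b : List Γ} (h : Step N a b) (p q : List Γ) :
    Step N (p ++ a ++ q) (p ++ b ++ q) := by
  obtain ⟨p', q', l, r, hN, rfl, rfl⟩ := h
  exact ⟨p ++ p', q' ++ q, l, r, hN, by simp, by simp⟩

theorem step_lt (ho : IsReductionOrder lt) (hlt : ∀ l r, N l r → lt r l) {a b : List Γ}
    (h : Step N a b) : lt b a := by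
  obtain ⟨p, q, l, r, hN, rfl, rfl⟩ := h
  exact ho.context p q (hlt _ _ hN)

/-- Induction on the cost of the step: a rule outside `P` is replaced by the cheaper path that
`redundant` provides, and the induction hypothesis applies to each of its steps. The first component
of the cost is the source of the step and never grows, so all sources stay in the downward closed
set `D`. -/
theorem connected_below (ho : IsReductionOrder lt) (hc : IsCompletion lt N P)
    {D : List Γ → Prop}
    (hD : ∀ a b, lt b a → D a → D b) (κ : List Γ × List Γ × List Γ) :
    ∀ p q l r : List Γ, N l r → (p ++ l ++ q, l, r) = κ →
      D (p ++ l ++ q) → ReflTransGen (StepIn P D) (p ++ l ++ q) (p ++ r ++ q) := by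
  have wf : WellFounded (CostLt lt) := ho.wf.prod_lex (ho.wf.prod_lex ho.wf)
  induction κ using wf.induction with
  | _ κ ih =>
    rintro p q l r hN rfl hW
    by_cases hP : P l r
    · exact .single (.inl ⟨⟨p, q, l, r, hP, rfl, rfl⟩, hW⟩)
    have key : ∀ a b, CostStep lt N (l, l, r) a b →
        ReflTransGen (StepIn P D) (p ++ a ++ q) (p ++ b ++ q) := by
      rintro a b ⟨p', q', l', r', hN', hcost, hab⟩
      -- Either the source gets smaller, which the context preserves, or it stays the same and the
      -- rule itself, untouched by the context, gets smaller.
      have hcost' : CostLt lt ((p ++ p') ++ l' ++ (q' ++ q), l', r') (p ++ l ++ q, l, r) := by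
        unfold CostLt at hcost ⊢
        rw [Prod.lex_def] at hcost ⊢
        rcases hcost with h | ⟨h, h'⟩
        · left
          simpa using ho.context p q h
        · right
          refine ⟨?_, h'⟩
          dsimp only at h ⊢
          rw [← h]
          simp
      have hW' : D ((p ++ p') ++ l' ++ (q' ++ q)) := by
        unfold CostLt at hcost'
        rw [Prod.lex_def] at hcost'
        rcases hcost' with h | ⟨h, -⟩
        · exact hD _ _ h hW
        · dsimp only at h
          rwa [h]
      have hpath := ih _ hcost' (p ++ p') (q' ++ q) l' r' hN' rfl hW'
      rcases hab with ⟨rfl, rfl⟩ | ⟨rfl, rfl⟩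
      · simpa using hpath
      · simpa using stepIn_path_symm hpath
    have lift : ∀ b, ReflTransGen (CostStep lt N (l, l, r)) l b →
        ReflTransGen (StepIn P D) (p ++ l ++ q) (p ++ b ++ q) := by
      intro b h
      induction h with
      | refl => exact .refl
      | tail _ hs ih' => exact ih'.trans (key _ _ hs)
    exact lift r (hc.redundant hN hP)

/-- The second redex starts `a` letters after the first. Disjoint redexes commute, and inclusion is
trivial by `factor`. A proper overlap yields a critical pair, which is an `N`-rule with both sides
below the peak, so `connected_below` turns it into a `P`-path below the peak. -/
theorem peak_connected_aux (ho : IsReductionOrder lt) (hc : IsCompletion lt N P)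
    {p a l₁ r₁ q₁ l₂ r₂ q₂ : List Γ} (h₁ : P l₁ r₁) (h₂ : P l₂ r₂)
    (h : l₁ ++ q₁ = a ++ (l₂ ++ q₂)) :
    ReflTransGen (StepIn P (lt · (p ++ l₁ ++ q₁))) (p ++ r₁ ++ q₁) (p ++ a ++ r₂ ++ q₂) := by
  have hlt₁ := hc.decreasing (hc.le h₁)
  have hlt₂ := hc.decreasing (hc.le h₂)
  have disjoint : ∀ b, a = l₁ ++ b → q₁ = b ++ (l₂ ++ q₂) →
      ReflTransGen (StepIn P (lt · (p ++ l₁ ++ q₁))) (p ++ r₁ ++ q₁) (p ++ a ++ r₂ ++ q₂) := by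
    rintro b rfl rfl
    refine .trans (b := p ++ r₁ ++ b ++ r₂ ++ q₂) (.single (.inl ⟨?_, ?_⟩))
      (.single (.inr ⟨?_, ?_⟩))
    · exact ⟨p ++ r₁ ++ b, q₂, l₂, r₂, h₂, by simp, by simp⟩
    · exact ho.context p _ hlt₁
    · exact ⟨p, b ++ r₂ ++ q₂, l₁, r₁, h₁, by simp, by simp⟩
    · simpa using ho.context (p ++ l₁ ++ b) q₂ hlt₂
  have factor : ∀ c, l₁ = a ++ l₂ ++ c → q₂ = c ++ q₁ →
      ReflTransGen (StepIn P (lt · (p ++ l₁ ++ q₁))) (p ++ r₁ ++ q₁) (p ++ a ++ r₂ ++ q₂) := by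
    rintro c rfl rfl
    obtain ⟨rfl, rfl, rfl⟩ := hc.factor h₁ h₂
    simpa using ReflTransGen.refl
  rcases List.append_eq_append_iff.1 h with ⟨b, hb, hq⟩ | ⟨b, hb, hq⟩
  · exact disjoint b hb hq
  rcases List.append_eq_append_iff.1 hq with ⟨c, hl, hq'⟩ | ⟨c, hl, hq'⟩
  · exact factor c (by rw [hb, hl, List.append_assoc]) hq'
  -- Here `l₁ = a ++ b` and `l₂ = b ++ c`. If `a` or `c` is empty, one left-hand side contains the
  -- other; if `b` is empty, the redexes are adjacent. Only the remaining case is a critical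
  -- overlap.
  by_cases ha0 : a = []
  · subst ha0
    simp only [List.nil_append] at hb
    subst hb hl hq'
    obtain ⟨-, rfl, rfl⟩ := hc.factor (u₁ := []) (by simpa using h₂) h₁
    simpa using ReflTransGen.refl
  by_cases hb0 : b = []
  · subst hb0
    exact disjoint [] (by rw [hb]; simp) hq.symm
  by_cases hc0 : c = []
  · subst hc0
    rw [List.append_nil] at hl
    exact factor [] (by rw [hb, hl]; simp) hq'.symm
  subst hb hl hq'
  have hx : lt (p ++ (a ++ r₂) ++ q₂) (p ++ (a ++ b) ++ (c ++ q₂)) := by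
    simpa using ho.context (p ++ a) q₂ hlt₂
  have hy : lt (p ++ (r₁ ++ c) ++ q₂) (p ++ (a ++ b) ++ (c ++ q₂)) := by
    simpa using ho.context p (c ++ q₂) hlt₁
  rcases hc.overlap ha0 hb0 hc0 h₁ h₂ with he | hN | hN
  · rw [List.append_assoc p a r₂, he]
    simpa using ReflTransGen.refl
  · have := stepIn_path_symm (connected_below ho hc (fun _ _ => ho.trans) _ p q₂ _ _ hN rfl hx)
    simpa using this
  · have := connected_below ho hc (fun _ _ => ho.trans) _ p q₂ _ _ hN rfl hy
    simpa using this

theorem peak_connected (ho : IsReductionOrder lt) (hc : IsCompletion lt N P) {z x y : List Γ}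
    (hx : Step P z x) (hy : Step P z y) : ReflTransGen (StepIn P (lt · z)) x y := by
  obtain ⟨p₁, q₁, l₁, r₁, h₁, rfl, rfl⟩ := hx
  obtain ⟨p₂, q₂, l₂, r₂, h₂, he, rfl⟩ := hy
  have he' : p₁ ++ (l₁ ++ q₁) = p₂ ++ (l₂ ++ q₂) := by simpa using he
  rcases List.append_eq_append_iff.1 he' with ⟨a, rfl, h⟩ | ⟨a, rfl, h⟩
  · exact peak_connected_aux ho hc h₁ h₂ h
  · rw [he]
    exact stepIn_path_symm (peak_connected_aux ho hc h₂ h₁ h)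

/-- The limit of a completion process is confluent. -/
theorem confluentAt (ho : IsReductionOrder lt) (hc : IsCompletion lt N P) (z : List Γ) :
    ConfluentAt (Step P) z :=
  confluentAt_of_connected_below ho.wf
    (fun _ _ h => step_lt ho (fun _ _ h => hc.decreasing (hc.le h)) h)
    (fun _ _ _ hx hy => peak_connected ho hc hx hy) z

/-- Strings that are connected by the rules of a completion process are joinable in its limit. -/
theorem joinable_of_connected (ho : IsReductionOrder lt) (hc : IsCompletion lt N P)
    {a b : List Γ} (h : ReflTransGen (fun x y => Step N x y ∨ Step N y x) a b) :
    Joinable (Step P) a b := by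
  have step : ∀ x y, Step N x y → Joinable (Step P) x y := by
    rintro x y ⟨p, q, l, r, hN, rfl, rfl⟩
    refine joinable_of_path (D := fun _ => True) (fun z _ => confluentAt ho hc z) ?_
    exact connected_below ho hc (D := fun _ => True) (fun _ _ _ h => h) _ p q l r hN rfl trivial
  induction h with
  | refl => exact ⟨a, .refl, .refl⟩
  | @tail y y' _ hs ih =>
    obtain ⟨c, hac, hyc⟩ := ih
    obtain ⟨d, hyd, hyd'⟩ : Joinable (Step P) y y' := by
      rcases hs with hs | hs
      · exact step _ _ hs
      · obtain ⟨d, h₁, h₂⟩ := step _ _ hs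
        exact ⟨d, h₂, h₁⟩
    obtain ⟨e, hce, hde⟩ := confluentAt ho hc y c d hyc hyd
    exact ⟨e, hac.trans hce, hyd'.trans hde⟩

end Strings

end StringCompletion

/-! ### Ground terms: evaluation, associative flattening, normal forms -/

namespace GroupSignature

variable {F K V V' A : Type*} {sig : GroupSignature F K}

theorem pos_of_isArity {g : F} {n : ℕ} (h : sig.IsArity g n) : 1 ≤ n := by
  by_cases hg : g ∈ sig.assoc
  · exact le_trans one_le_two (h.1 hg)
  · rw [h.2 hg]; exact sig.arity_pos g

theorem isArity_of_assoc {g : F} {n : ℕ} (hg : g ∈ sig.assoc) (hn : 2 ≤ n) : sig.IsArity g n :=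
  ⟨fun _ => hn, fun h => absurd hg h⟩

namespace Term

theorem app_eq_app {g : F} {n m : ℕ} {h : sig.IsArity g n} {h' : sig.IsArity g m}
    {a : Fin n → Term sig V} {b : Fin m → Term sig V} (hab : List.ofFn a = List.ofFn b) :
    app g n h a = app g m h' b := by
  have hnm : n = m := by simpa using congrArg List.length hab
  subst hnm
  rw [List.ofFn_injective hab]

theorem app_eq_appList {g : F} {n : ℕ} {h : sig.IsArity g n} {a : Fin n → Term sig V}
    {l : List (Term sig V)} (hl : List.ofFn a = l) {h' : sig.IsArity g l.length} :
    app g n h a = appList g l h' :=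
  app_eq_app (by rw [hl]; exact (List.ofFn_get l).symm)

theorem appList_congr {g : F} {l l' : List (Term sig V)} {h : sig.IsArity g l.length}
    {h' : sig.IsArity g l'.length} (e : l = l') : appList g l h = appList g l' h' := by
  subst e; rfl

/-- Terms are constants or lists of terms under a symbol. -/
theorem induction_list {motive : Term sig V → Prop} (const : ∀ c, motive (const c))
    (app : ∀ g l (h : sig.IsArity g l.length), (∀ t ∈ l, motive t) → motive (appList g l h))
    (t : Term sig V) : motive t := by
  induction t with
  | const c => exact const c
  | app g n h args ih =>
    have h' : sig.IsArity g (List.ofFn args).length := by simpa using h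
    rw [app_eq_appList (h' := h') rfl]
    refine app g _ h' fun t ht => ?_
    obtain ⟨k, rfl⟩ := (List.mem_ofFn' _ _).1 ht
    exact ih k

/-- The value of a term in an algebra. -/
def eval (op : F → List A → A) (φ : V → A) : Term sig V → A
  | const c => φ c
  | app g _ _ args => op g (List.ofFn fun k => (args k).eval op φ)

variable {op : F → List A → A} {φ : V → A}

@[simp] theorem eval_const (c : V) : (const c : Term sig V).eval op φ = φ c := rfl

theorem eval_app (g : F) (n : ℕ) (h : sig.IsArity g n) (args : Fin n → Term sig V) :
    (app g n h args).eval op φ = op g ((List.ofFn args).map (eval op φ)) := by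
  simp [eval, List.map_ofFn, Function.comp_def]

@[simp] theorem eval_appList (g : F) (l : List (Term sig V)) (h : sig.IsArity g l.length) :
    (appList g l h).eval op φ = op g (l.map (eval op φ)) := by
  rw [appList, eval_app]
  congr 2
  exact List.ofFn_get l

@[simp] theorem eval_mul (s t : Term sig V) :
    (sig.mul s t).eval op φ = op sig.f [s.eval op φ, t.eval op φ] := by
  simp [mul, eval_app]

@[simp] theorem eval_inv (s : Term sig V) :
    (sig.inv s).eval op φ = op sig.i [s.eval op φ] := by
  simp [inv, eval_app]

theorem eval_map (χ : V' → V) (t : Term sig V') :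
    (t.map χ).eval op φ = t.eval op (φ ∘ χ) := by
  induction t with
  | const c => rfl
  | app g n h args ih => simp [map, eval, ih]

theorem eval_congr {R : Term sig V → Term sig V → Prop}
    (hR : ∀ s t, R s t → s.eval op φ = t.eval op φ) {s t : Term sig V}
    (h : CongruenceClosure R s t) : s.eval op φ = t.eval op φ := by
  induction h with
  | base h => exact hR _ _ h
  | refl => rfl
  | symm _ ih => exact ih.symm
  | trans _ _ ih₁ ih₂ => exact ih₁.trans ih₂
  | congr g n h _ ih => simp only [eval, ih]

/-- The operations on `A` satisfy the associativity axioms of the associative symbols. -/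
def IsAssocOp (sig : GroupSignature F K) (op : F → List A → A) : Prop :=
  ∀ g ∈ sig.assoc, ∀ x y z : List A, 2 ≤ y.length → 2 ≤ (x ++ op g y :: z).length →
    op g (x ++ op g y :: z) = op g (x ++ (y ++ z))

theorem eval_eq_of_assocInstance (hop : IsAssocOp sig op) {s t : Term sig V}
    (h : AssocInstance sig s t) : s.eval op φ = t.eval op φ := by
  obtain ⟨g, hg, x, y, z, hy, h, h'⟩ := h
  have hy2 := hy.1 hg
  have h2 := h.1 hg
  simp only [List.length_append, List.length_cons] at h2
  have := hop g hg (x.map (eval op φ)) (y.map (eval op φ)) (z.map (eval op φ))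
    (by simpa using hy2) (by simpa using h2)
  simpa using this

theorem eval_eq_of_assocEq (hop : IsAssocOp sig op) {s t : Term sig V} (h : AssocEq sig s t) :
    s.eval op φ = t.eval op φ :=
  eval_congr (fun _ _ => eval_eq_of_assocInstance hop) h

theorem eval_eq_of_rewrite {R : Term sig V → Term sig V → Prop}
    (hR : ∀ s t, R s t → s.eval op φ = t.eval op φ) {s t : Term sig V}
    (h : Rewrite R s t) : s.eval op φ = t.eval op φ := by
  induction h with
  | root h => exact hR _ _ h
  | arg g n h args k _ ih =>
    simp only [eval]
    congr 2
    funext j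
    by_cases hj : j = k
    · subst hj; simp [ih]
    · simp [hj]

theorem eval_eq_of_rewriteMod (hop : IsAssocOp sig op) {R : Term sig V → Term sig V → Prop}
    (hR : ∀ s t, R s t → s.eval op φ = t.eval op φ) {s t : Term sig V}
    (h : RewriteMod R s t) : s.eval op φ = t.eval op φ := by
  obtain ⟨s', t', h₁, h₂, h₃⟩ := h
  exact (eval_eq_of_assocEq hop h₁).trans
    ((eval_eq_of_rewrite hR h₂).trans (eval_eq_of_assocEq hop h₃))

theorem ofFn_update {n : ℕ} (args : Fin n → A) (k : Fin n) (a : A) :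
    ∃ x y, List.ofFn args = x ++ args k :: y ∧ List.ofFn (Function.update args k a) = x ++ a :: y := by
  refine ⟨(List.ofFn args).take k, (List.ofFn args).drop (k + 1), ?_, ?_⟩
  · have hk : (k : ℕ) < (List.ofFn args).length := by simp
    conv_lhs => rw [← List.take_append_drop k (List.ofFn args), List.drop_eq_getElem_cons hk]
    simp
  · have h : List.ofFn (Function.update args k a) = (List.ofFn args).set k a := by
      apply List.ext_getElem
      · simp
      · intro i h₁ h₂
        simp only [List.getElem_ofFn, List.getElem_set]
        simp only [List.length_ofFn] at h₁
        by_cases hik : (k : ℕ) = i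
        · subst hik
          simp
        · have : (⟨i, h₁⟩ : Fin n) ≠ k := fun h => hik (by rw [← h])
          simp [this, hik]
    rw [h, List.set_eq_take_append_cons_drop]
    simp

theorem eval_lt_of_rewrite {op : F → List ℕ → ℕ} {φ : V → ℕ}
    (hop : ∀ g x y a b, a < b → op g (x ++ a :: y) < op g (x ++ b :: y))
    {R : Term sig V → Term sig V → Prop}
    (hR : ∀ s t, R s t → t.eval op φ < s.eval op φ) {s t : Term sig V}
    (h : Rewrite R s t) : t.eval op φ < s.eval op φ := by
  induction h with
  | root h => exact hR _ _ h
  | arg g n h args k _ ih =>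
    rename_i t' _
    obtain ⟨x, y, h₁, h₂⟩ := ofFn_update args k t'
    rw [eval_app, eval_app, h₁, h₂]
    simpa using hop g _ _ _ _ ih

/-- All symbols of the term satisfy `P` and all its constants satisfy `Q`. -/
def All (P : F → Prop) (Q : V → Prop) : Term sig V → Prop
  | const c => Q c
  | app g _ _ args => P g ∧ ∀ k, (args k).All P Q

variable {P : F → Prop} {Q : V → Prop}

/-- Read as evaluation in an algebra on `Prop`, the predicate inherits the invariance of evaluation
under renaming and under associativity. -/
theorem all_iff_eval (t : Term sig V) :
    t.All P Q ↔ t.eval (fun g l => P g ∧ ∀ x ∈ l, x) Q := by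
  induction t with
  | const c => rfl
  | app g n h args ih =>
    refine and_congr_right fun _ => ⟨fun h x hx => ?_, fun h k => ?_⟩
    · obtain ⟨k, rfl⟩ := (List.mem_ofFn' _ _).1 hx
      exact (ih k).1 (h k)
    · exact (ih k).2 (h _ ((List.mem_ofFn' _ _).2 ⟨k, rfl⟩))

@[simp] theorem all_const (c : V) : (const c : Term sig V).All P Q ↔ Q c := Iff.rfl

@[simp] theorem all_appList (g : F) (l : List (Term sig V)) (h : sig.IsArity g l.length) :
    (appList g l h).All P Q ↔ P g ∧ ∀ t ∈ l, t.All P Q := by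
  simp only [appList, All, List.forall_mem_iff_get]

@[simp] theorem all_mul (s t : Term sig V) :
    (sig.mul s t).All P Q ↔ P sig.f ∧ s.All P Q ∧ t.All P Q := by
  simp [mul, All, Fin.forall_fin_two]

@[simp] theorem all_inv (s : Term sig V) : (sig.inv s).All P Q ↔ P sig.i ∧ s.All P Q := by
  simp [inv, All]

theorem all_map (χ : V' → V) (t : Term sig V') :
    (t.map χ).All P Q ↔ t.All P (fun c => Q (χ c)) := by
  rw [all_iff_eval, all_iff_eval, eval_map]
  rfl

theorem all_iff_of_assocEq {s t : Term sig V} (h : AssocEq sig s t) :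
    s.All P Q ↔ t.All P Q := by
  rw [all_iff_eval, all_iff_eval]
  refine Eq.to_iff (eval_eq_of_assocEq ?_ h)
  intro g _ x y z _ _
  refine propext ⟨fun ⟨h₁, h₂⟩ => ⟨h₁, fun a ha => ?_⟩, fun ⟨h₁, h₂⟩ => ⟨h₁, fun a ha => ?_⟩⟩
  · rcases List.mem_append.1 ha with ha | ha
    · exact h₂ _ (List.mem_append_left _ ha)
    rcases List.mem_append.1 ha with ha | ha
    · exact (h₂ _ (List.mem_append_right _ List.mem_cons_self)).2 _ ha
    · exact h₂ _ (List.mem_append_right _ (List.mem_cons_of_mem _ ha))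
  · rcases List.mem_append.1 ha with ha | ha
    · exact h₂ _ (List.mem_append_left _ ha)
    rcases List.mem_cons.1 ha with rfl | ha
    · exact ⟨h₁, fun b hb => h₂ _ (List.mem_append_right _ (List.mem_append_left _ hb))⟩
    · exact h₂ _ (List.mem_append_right _ (List.mem_append_right _ ha))

theorem All.mono {P' : F → Prop} {Q' : V → Prop} (hP : ∀ g, P g → P' g) (hQ : ∀ c, Q c → Q' c)
    {t : Term sig V} (h : t.All P Q) : t.All P' Q' := by
  induction t with
  | const c => exact hQ _ h
  | app g n _ args ih => exact ⟨hP _ h.1, fun k => ih k (h.2 k)⟩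

theorem All.rewrite {R : Term sig V → Term sig V → Prop}
    (hR : ∀ s t, R s t → s.All P Q → t.All P Q) {s t : Term sig V}
    (h : Rewrite R s t) (hs : s.All P Q) : t.All P Q := by
  induction h with
  | root h => exact hR _ _ h hs
  | arg g n h args k _ ih =>
    refine ⟨hs.1, fun j => ?_⟩
    by_cases hj : j = k
    · subst hj; simpa using ih (hs.2 _)
    · simpa [hj] using hs.2 j

theorem All.of_rewrite {u v s t : Term sig V}
    (h : Rewrite (fun a b => a = u ∧ b = v) s t) (hs : s.All P Q) : u.All P Q := by
  induction h with
  | root h => rwa [← h.1]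
  | arg g n h args k _ ih => exact ih (hs.2 k)

theorem all_of_occurs (t : Term sig V) (h : ∀ g ∈ sig.assoc, t.Occurs g → g = sig.f) :
    t.All (fun g => g ∈ sig.assoc → g = sig.f) fun _ => True := by
  induction t with
  | const c => trivial
  | app g n _ args ih =>
    exact ⟨fun hg => h g hg (.inl rfl), fun k => ih k fun g hg hk => h g hg (.inr ⟨k, hk⟩)⟩

end Term

/-! ### Congruences and rewriting under lists of arguments -/

theorem CongruenceClosure.appList {R : Term sig V → Term sig V → Prop} (g : F)
    {l l' : List (Term sig V)} (h : sig.IsArity g l.length) (h' : sig.IsArity g l'.length)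
    (hl : List.Forall₂ (CongruenceClosure R) l l') :
    CongruenceClosure R (Term.appList g l h) (Term.appList g l' h') := by
  have hlen := hl.length_eq
  have : Term.appList g l' h' = Term.app g l.length h fun k => l'.get (k.cast hlen) := by
    refine (Term.app_eq_appList (l := l') ?_).symm
    apply List.ext_getElem <;> simp [hlen]
  rw [this]
  exact .congr g _ h fun k => by simpa using hl.get k.2 (hlen ▸ k.2)

theorem Rewrite.appList {R : Term sig V → Term sig V → Prop} (g : F)
    (x y : List (Term sig V)) {s t : Term sig V} (hst : Rewrite R s t)
    (h : sig.IsArity g (x ++ s :: y).length) (h' : sig.IsArity g (x ++ t :: y).length) :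
    Rewrite R (Term.appList g (x ++ s :: y) h) (Term.appList g (x ++ t :: y) h') := by
  have hk : x.length < (x ++ s :: y).length := by simp
  have hs : (x ++ s :: y).get ⟨x.length, hk⟩ = s := by simp
  have := Rewrite.arg g _ h (x ++ s :: y).get ⟨x.length, hk⟩ (t := t) (by rw [hs]; exact hst)
  have he : Term.app g _ h (Function.update (x ++ s :: y).get ⟨x.length, hk⟩ t) =
      Term.appList g (x ++ t :: y) h' := by
    refine Term.app_eq_appList (List.ext_getElem (by simp; omega) fun i h₁ h₂ => ?_)
    simp only [List.getElem_ofFn, Function.update_apply, Fin.mk.injEq, List.get_eq_getElem]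
    split_ifs with hi
    · subst hi; simp
    · simp only [List.getElem_append, List.getElem_cons]
      split_ifs <;> first | rfl | omega
  rwa [he] at this

theorem AssocEq.splice {g : F} (hg : g ∈ sig.assoc) (x y z : List (Term sig V))
    (hy : sig.IsArity g y.length) (h : sig.IsArity g (x ++ Term.appList g y hy :: z).length)
    (h' : sig.IsArity g (x ++ (y ++ z)).length) :
    AssocEq sig (Term.appList g (x ++ Term.appList g y hy :: z) h)
      (Term.appList g (x ++ (y ++ z)) h') :=
  .base (.mk g hg x y z hy h h')

namespace Term

theorem isAFlat_appList (g : F) (l : List (Term sig V)) (h : sig.IsArity g l.length) :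
    (appList g l h).IsAFlat ↔
      (∀ t ∈ l, t.IsAFlat) ∧ (g ∈ sig.assoc → ∀ t ∈ l, ¬ t.HasHead g) := by
  simp only [appList, IsAFlat, List.forall_mem_iff_get]

theorem exists_eq_appList_of_hasHead {g : F} {t : Term sig V} (h : t.HasHead g) :
    ∃ l, ∃ hl : sig.IsArity g l.length, t = appList g l hl := by
  cases t with
  | const c => exact h.elim
  | app g' n hn args =>
    obtain rfl : g' = g := h
    exact ⟨List.ofFn args, by simpa using hn, app_eq_appList rfl⟩

/-- The list `x` collects the arguments already treated. An argument headed by `g` is itself flat,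
so its own arguments are not headed by `g` and a single splice suffices. -/
theorem exists_flatten_args {g : F} (hg : g ∈ sig.assoc) (y : List (Term sig V)) :
    ∀ (x : List (Term sig V)) (h : sig.IsArity g (x ++ y).length),
      (∀ t ∈ x, t.IsAFlat ∧ ¬ t.HasHead g) → (∀ t ∈ y, t.IsAFlat) →
      ∃ z, ∃ hz : sig.IsArity g z.length, (∀ t ∈ z, t.IsAFlat ∧ ¬ t.HasHead g) ∧
        AssocEq sig (appList g (x ++ y) h) (appList g z hz) := by
  induction y with
  | nil =>
    intro x h hx _
    exact ⟨x, by simpa using h, hx, by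
      rw [appList_congr (List.append_nil x)]; exact .refl _⟩
  | cons t y ih =>
    intro x h hx hy
    by_cases ht : t.HasHead g
    · obtain ⟨l, hl, rfl⟩ := exists_eq_appList_of_hasHead ht
      have hfl := (isAFlat_appList g l hl).1 (hy _ (by simp))
      have h2 := hl.1 hg
      have h' : sig.IsArity g ((x ++ l) ++ y).length :=
        isArity_of_assoc hg (by simp only [List.length_append]; omega)
      obtain ⟨z, hz, hz', he⟩ := ih (x ++ l) h' (by
        intro t ht
        rcases List.mem_append.1 ht with ht | ht
        · exact hx t ht
        · exact ⟨hfl.1 t ht, hfl.2 hg t ht⟩) fun t ht => hy t (by simp [ht])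
      refine ⟨z, hz, hz', .trans (AssocEq.splice hg x l y hl h (by simpa using h')) ?_⟩
      rwa [appList_congr (List.append_assoc x l y).symm]
    · have h' : sig.IsArity g ((x ++ [t]) ++ y).length := by simpa using h
      obtain ⟨z, hz, hz', he⟩ := ih (x ++ [t]) h' (by
        intro s hs
        rcases List.mem_append.1 hs with hs | hs
        · exact hx s hs
        · rw [List.mem_singleton.1 hs]
          exact ⟨hy t (by simp), ht⟩) fun t ht => hy t (by simp [ht])
      refine ⟨z, hz, hz', ?_⟩
      rwa [appList_congr (show x ++ t :: y = (x ++ [t]) ++ y by simp)]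

theorem exists_isAFlat (t : Term sig V) : ∃ t' : Term sig V, AssocEq sig t t' ∧ t'.IsAFlat := by
  induction t using induction_list with
  | const c => exact ⟨_, .refl _, trivial⟩
  | app g l h ih =>
    have : ∃ l', List.Forall₂ (fun a b => AssocEq sig a b ∧ IsAFlat b) l l' := by
      clear h
      induction l with
      | nil => exact ⟨[], .nil⟩
      | cons a l ihl =>
        obtain ⟨l', hl'⟩ := ihl fun t ht => ih t (by simp [ht])
        obtain ⟨b, hb⟩ := ih a (by simp)
        exact ⟨b :: l', .cons hb hl'⟩
    obtain ⟨l', hl'⟩ := this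
    have hflat : ∀ t ∈ l', t.IsAFlat := by
      clear h ih
      induction hl' with
      | nil => simp
      | cons h _ ih' => exact List.forall_mem_cons.2 ⟨h.2, ih'⟩
    have h' : sig.IsArity g l'.length := hl'.length_eq ▸ h
    have he : AssocEq sig (appList g l h) (appList g l' h') :=
      CongruenceClosure.appList g h h' (hl'.imp fun _ _ h => h.1)
    by_cases hg : g ∈ sig.assoc
    · obtain ⟨z, hz, hz', he'⟩ := exists_flatten_args hg l' [] h' (by simp) hflat
      exact ⟨_, he.trans he', (isAFlat_appList g z hz).2
        ⟨fun t ht => (hz' t ht).1, fun _ t ht => (hz' t ht).2⟩⟩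
    · exact ⟨_, he, (isAFlat_appList g l' h').2 ⟨hflat, fun h => absurd h hg⟩⟩

end Term

end GroupSignature

/-! ### Models of the group axioms and the preprocessing phases -/

namespace GroupSignature

variable {F K V A : Type*} {sig : GroupSignature F K}

/-- An algebra over a group in which `f` and `i` are the group operations and the associative
symbols are associative. -/
structure IsGroupModel [Group A] (sig : GroupSignature F K) (op : F → List A → A) : Prop where
  op_f : ∀ l : List A, 2 ≤ l.length → op sig.f l = l.prod
  op_i : ∀ a : A, op sig.i [a] = a⁻¹
  assoc : Term.IsAssocOp sig op

/-- The equation `e` holds in the algebra. -/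
def Sat (op : F → List A → A) (φ : V → A) (e : Sym2 (Term sig V)) : Prop :=
  (e.map (Term.eval op φ)).IsDiag

@[simp] theorem sat_mk {op : F → List A → A} {φ : V → A} {s t : Term sig V} :
    Sat op φ s(s, t) ↔ s.eval op φ = t.eval op φ := by
  simp [Sat]

namespace IsGroupModel

variable [Group A] {op : F → List A → A} (h : IsGroupModel sig op)
include h

theorem eval_mul (φ : V → A) (s t : Term sig V) :
    (sig.mul s t).eval op φ = s.eval op φ * t.eval op φ := by
  simp [h.op_f]

theorem eval_inv (φ : V → A) (s : Term sig V) :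
    (sig.inv s).eval op φ = (s.eval op φ)⁻¹ := by
  simp [h.op_i]

theorem eval_eq_of_groupAxiom {φ : K → A} (hφ : φ sig.one = 1) {s t : Term sig K}
    (hst : GroupAxiom sig s t) : s.eval op φ = t.eval op φ := by
  cases hst with
  | assoc hst => exact Term.eval_eq_of_assocInstance h.assoc hst
  | mul_one | one_mul | mul_inv | inv_mul => simp [h.eval_mul, h.eval_inv, unit, hφ]

theorem eval_eq_of_groupRule {φ : K → A} (hφ : φ sig.one = 1) {s t : Term sig K}
    (hst : GroupRule sig s t) : s.eval op φ = t.eval op φ := by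
  cases hst <;> simp [h.eval_mul, h.eval_inv, unit, hφ]

theorem eval_eq_of_eqMod {φ : K → A} (hφ : φ sig.one = 1) {E : Set (Sym2 (Term sig K))}
    (hE : ∀ e ∈ E, Sat op φ e) {s t : Term sig K} (hst : EqMod sig E s t) :
    s.eval op φ = t.eval op φ := by
  refine Term.eval_congr ?_ hst
  rintro s t (hst | hst)
  · exact sat_mk.1 (hE _ hst)
  · exact h.eval_eq_of_groupAxiom hφ hst

theorem eval_eq_of_isGroupNormalForm {φ : K → A} (hφ : φ sig.one = 1) {s t : Term sig K}
    (hst : IsGroupNormalForm sig s t) : s.eval op φ = t.eval op φ := by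
  obtain ⟨hst, -⟩ := hst
  induction hst with
  | refl => rfl
  | tail _ hs ih =>
    exact ih.trans
      (Term.eval_eq_of_rewriteMod h.assoc (fun _ _ => h.eval_eq_of_groupRule hφ) hs)

end IsGroupModel

/-! #### Termination of `R(G)/A` -/

open Classical in
/-- The polynomial interpretation that shows termination of `R(G)/A`. -/
noncomputable def weightOp (sig : GroupSignature F K) (g : F) (l : List ℕ) : ℕ :=
  if g = sig.i then l.sum ^ 2 else if g ∈ sig.assoc then l.sum + (l.length - 1) else l.sum + 1

/-- The weight of a term. -/
noncomputable def weight (t : Term sig V) : ℕ := t.eval (weightOp sig) fun _ => 2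

/-- Splicing an inner term with `j` arguments adds `j - 1` to the argument count of the outer symbol
and loses the contribution `j - 1` of the inner one. The weight is thus defined modulo
associativity. -/
theorem isAssocOp_weightOp : Term.IsAssocOp sig (weightOp sig) := by
  intro g hg x y z hy hz
  have hgi : g ≠ sig.i := fun h => sig.i_not_assoc (h ▸ hg)
  simp only [weightOp, if_neg hgi, if_pos hg, List.sum_append, List.sum_cons, List.length_append,
    List.length_cons] at hz ⊢
  omega

theorem weightOp_lt (g : F) (x y : List ℕ) (a b : ℕ) (hab : a < b) :
    weightOp sig g (x ++ a :: y) < weightOp sig g (x ++ b :: y) := by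
  unfold weightOp
  have h : (x ++ a :: y).sum < (x ++ b :: y).sum := by
    simp only [List.sum_append, List.sum_cons]; omega
  have hl : (x ++ a :: y).length = (x ++ b :: y).length := by simp
  split_ifs
  · exact Nat.pow_lt_pow_left h (by norm_num)
  · omega
  · omega

theorem two_le_weight (t : Term sig V) : 2 ≤ weight t := by
  induction t using Term.induction_list with
  | const c => exact le_rfl
  | app g l h ih =>
    have hpos := pos_of_isArity h
    have hsum : 2 ≤ (l.map weight).sum := by
      cases l with
      | nil => simp at hpos
      | cons t l =>
        have := ih t (by simp)
        simp only [List.map_cons, List.sum_cons]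
        omega
    have : weight (Term.appList g l h) = weightOp sig g (l.map weight) := by
      simp only [weight, Term.eval_appList]; rfl
    rw [this, weightOp]
    split_ifs
    · nlinarith
    · omega
    · omega

/-- The decisive rule is the one for the inverse of a product: `(a + b + 1)² > a² + b² + 1`. The
lower bound `2` on weights handles the other rules whose decrease is not immediate. -/
theorem weight_lt_of_groupRule {s t : Term sig K} (h : GroupRule sig s t) :
    weight t < weight s := by
  have hf : sig.f ≠ sig.i := fun h => sig.i_not_assoc (h ▸ sig.f_assoc)
  have hmul : ∀ s t : Term sig K, weight (sig.mul s t) = weight s + weight t + 1 := by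
    intro s t
    simp [weight, weightOp, hf, sig.f_assoc]
  have hinv : ∀ s : Term sig K, weight (sig.inv s) = weight s ^ 2 := by
    intro s
    simp [weight, weightOp]
  have hone : weight sig.unit = 2 := rfl
  cases h with
  | inv_one => rw [hinv, hone]; norm_num
  | mul_one x => rw [hmul]; omega
  | one_mul x => rw [hmul]; omega
  | inv_inv =>
    have := two_le_weight t
    have h₂ : weight t < weight t ^ 2 := by nlinarith
    rw [hinv, hinv]
    nlinarith
  | mul_inv x =>
    have := two_le_weight x
    rw [hmul, hone]
    omega
  | inv_mul x =>
    have := two_le_weight x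
    rw [hmul, hone]
    omega
  | inv_of_mul x y =>
    have := two_le_weight x
    have := two_le_weight y
    rw [hmul, hinv, hinv, hinv, hmul]
    nlinarith

theorem weight_eq_of_assocEq {s t : Term sig V} (h : AssocEq sig s t) : weight s = weight t :=
  Term.eval_eq_of_assocEq isAssocOp_weightOp h

theorem weight_lt_of_rewriteMod {s t : Term sig K} (h : RewriteMod (GroupRule sig) s t) :
    weight t < weight s := by
  obtain ⟨s', t', h₁, h₂, h₃⟩ := h
  rw [weight_eq_of_assocEq h₁, ← weight_eq_of_assocEq h₃]
  exact Term.eval_lt_of_rewrite weightOp_lt (fun _ _ => weight_lt_of_groupRule) h₂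

/-- `normalizedEqns` sees an equation only through normal forms of its sides, so their existence
guarantees that no equation of `E` is lost. Each reduct can be flattened again within the same `R/A`
step. -/
theorem exists_isGroupNormalForm (s : Term sig K) (hs : s.IsAFlat) :
    ∃ t, IsGroupNormalForm sig s t := by
  induction hn : weight s using Nat.strong_induction_on generalizing s with
  | _ n ih =>
    subst hn
    by_cases h : ∃ t, RewriteMod (GroupRule sig) s t
    · obtain ⟨t, s', t', h₁, h₂, h₃⟩ := h
      obtain ⟨t₁, ht, htf⟩ := Term.exists_isAFlat t
      have hst : RewriteMod (GroupRule sig) s t₁ := ⟨s', t', h₁, h₂, h₃.trans ht⟩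
      obtain ⟨u, hu⟩ := ih _ (weight_lt_of_rewriteMod hst) t₁ htf rfl
      exact ⟨u, .head hst hu.1, hu.2⟩
    · exact ⟨s, .refl, hs, fun t ht => h ⟨t, ht⟩⟩

theorem sat_normalizedEqns [Group A] {op : F → List A → A} (h : IsGroupModel sig op) {φ : K → A}
    (hφ : φ sig.one = 1) {E : Set (Sym2 (Term sig K))} :
    (∀ e ∈ normalizedEqns sig (flattenedEqns sig E), Sat op φ e) ↔ ∀ e ∈ E, Sat op φ e := by
  constructor
  · intro hN e he
    induction e with
    | _ s t =>
    obtain ⟨s₁, hs₁, hs₁f⟩ := Term.exists_isAFlat s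
    obtain ⟨t₁, ht₁, ht₁f⟩ := Term.exists_isAFlat t
    obtain ⟨s₂, hs₂⟩ := exists_isGroupNormalForm s₁ hs₁f
    obtain ⟨t₂, ht₂⟩ := exists_isGroupNormalForm t₁ ht₁f
    rw [sat_mk, Term.eval_eq_of_assocEq h.assoc hs₁, Term.eval_eq_of_assocEq h.assoc ht₁,
      h.eval_eq_of_isGroupNormalForm hφ hs₂, h.eval_eq_of_isGroupNormalForm hφ ht₂]
    by_cases hne : s₂ = t₂
    · rw [hne]
    · exact sat_mk.1 (hN _ ⟨s₁, t₁, s₂, t₂, ⟨s, t, s₁, t₁, he, hs₁, hs₁f, ht₁, ht₁f, rfl⟩,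
        hs₂, ht₂, hne, rfl⟩)
  · rintro hE _ ⟨s₁, t₁, s₂, t₂, ⟨s, t, s₀, t₀, he, hs₀, -, ht₀, -, heq⟩, hs₂, ht₂, -, rfl⟩
    have hst := sat_mk.1 (hE _ he)
    rw [Term.eval_eq_of_assocEq h.assoc hs₀, Term.eval_eq_of_assocEq h.assoc ht₀] at hst
    rw [sat_mk, ← h.eval_eq_of_isGroupNormalForm hφ hs₂, ← h.eval_eq_of_isGroupNormalForm hφ ht₂]
    rcases Sym2.eq_iff.1 heq with ⟨rfl, rfl⟩ | ⟨rfl, rfl⟩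
    · exact hst
    · exact hst.symm

/-! #### Flat terms -/

/-- No associative symbol other than `f`. -/
def OnlyF (sig : GroupSignature F K) (g : F) : Prop := g ∈ sig.assoc → g = sig.f

namespace FlatTerm

/-- The constants of the flat term belong to `C` and it is not headed by an associative symbol
other than `f`. -/
def Admissible (C : Set (Cst K)) : FlatTerm sig → Prop
  | const c => c ∈ C
  | app g w _ => OnlyF sig g ∧ ∀ c ∈ w, c ∈ C

theorem toTerm_app (g : F) (w : List (Cst K)) (h : sig.IsArity g w.length)
    (h' : sig.IsArity g (w.map Term.const : List (Term sig (Cst K))).length) :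
    (app g w h).toTerm = Term.appList g (w.map Term.const) h' := by
  refine Term.app_eq_appList ?_
  apply List.ext_getElem <;> simp

@[simp] theorem toTerm_const (c : Cst K) : (const c : FlatTerm sig).toTerm = .const c := rfl

theorem eval_toTerm_app {op : F → List A → A} {φ : Cst K → A} (g : F) (w : List (Cst K))
    (h : sig.IsArity g w.length) : (app g w h).toTerm.eval op φ = op g (w.map φ) := by
  rw [toTerm_app (h' := by simpa using h)]
  simp [Function.comp_def]

theorem toTerm_injective : Function.Injective (toTerm : FlatTerm sig → Term sig (Cst K)) := by
  intro s t hst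
  cases s with
  | const c =>
    cases t with
    | const d => injection hst with h; rw [h]
    | app g w h => simp [toTerm] at hst
  | app g w h =>
    cases t with
    | const d => simp [toTerm] at hst
    | app g' w' h' =>
      have hl : w = w' := by
        -- Evaluation in the algebra of lists under concatenation reads off the string of constants,
        -- so that the dependently typed argument functions need not be compared.
        have := congrArg (Term.eval (A := List (Cst K)) (fun _ l => l.flatten) fun c => [c]) hst
        rw [eval_toTerm_app, eval_toTerm_app] at this
        simpa [← List.flatMap_def] using this
      subst hl
      injection hst with hg
      subst hg
      rfl

theorem all_toTerm {C : Set (Cst K)} {t : FlatTerm sig} :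
    t.toTerm.All (OnlyF sig) (· ∈ C) ↔ t.Admissible C := by
  cases t with
  | const c => rfl
  | app g w h =>
    rw [toTerm_app (h' := by simpa using h), Term.all_appList, List.forall_mem_map]
    rfl

theorem Admissible.mono {C C' : Set (Cst K)} (h : C ⊆ C') {t : FlatTerm sig}
    (ht : t.Admissible C) : t.Admissible C' := by
  cases t with
  | const c => exact h ht
  | app g w _ => exact ⟨ht.1, fun c hc => h (ht.2 c hc)⟩

end FlatTerm

/-- A flat equation with constants from `C`, without associative symbols other than `f`. -/
def ValidEqn (sig : GroupSignature F K) (C : Set (Cst K)) (e : Sym2 (FlatTerm sig)) : Prop :=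
  IsFlatEqn sig e ∧ ∀ t ∈ e, t.Admissible C

/-- The flat equation `e` holds in the algebra. -/
def FlatSat (op : F → List A → A) (φ : Cst K → A) (e : Sym2 (FlatTerm sig)) : Prop :=
  Sat op φ (e.map FlatTerm.toTerm)

@[simp] theorem flatSat_mk {op : F → List A → A} {φ : Cst K → A} {s t : FlatTerm sig} :
    FlatSat op φ s(s, t) ↔ s.toTerm.eval op φ = t.toTerm.eval op φ := by
  simp [FlatSat]

/-! #### Phase I -/

/-- All constants of the equations `T` belong to `constants K D`, and no associative symbol other
than `f` occurs. -/
def Good (D : Finset ℕ) (T : Set (Sym2 (Term sig (Cst K)))) : Prop :=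
  ∀ e ∈ T, ∀ t ∈ e, t.All (OnlyF sig) (· ∈ constants K D)

theorem constants_mono {D D' : Finset ℕ} (h : D ⊆ D') : constants K D ⊆ constants K D' :=
  Set.union_subset_union_right _ (Set.image_mono (by exact_mod_cast h))

theorem inr_mem_constants {D : Finset ℕ} {n : ℕ} :
    (Sum.inr n : Cst K) ∈ constants K D ↔ n ∈ D := by
  simp [constants]

theorem inl_mem_constants {D : Finset ℕ} {c : K} : (Sum.inl c : Cst K) ∈ constants K D := by
  simp [constants]

theorem Good.mono {D D' : Finset ℕ} (h : D ⊆ D') {T : Set (Sym2 (Term sig (Cst K)))}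
    (hT : Good D T) : Good D' T :=
  fun e he t ht => (hT e he t ht).mono (fun _ h => h) fun _ hc => constants_mono h hc

theorem good_step {D D' : Finset ℕ} {T T' : Set (Sym2 (Term sig (Cst K)))}
    (h : FlattenStep sig (D, T) (D', T')) (hT : Good D T) : D ⊆ D' ∧ Good D' T' := by
  cases h with
  | inner _ _ s s' t g w h n hmem hflat hproper hname hs =>
    have hD : D ⊆ insert n D := Finset.subset_insert _ _
    refine ⟨hD, ?_⟩
    have hT' := hT.mono hD
    have hn : (Term.const (Sum.inr n) : Term sig (Cst K)).All (OnlyF sig)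
        (· ∈ constants K (insert n D)) := inr_mem_constants.2 (Finset.mem_insert_self _ _)
    have hsa := hT' _ hmem s (by simp)
    rintro e (he | he | he)
    · exact hT' e he.1
    · subst he
      simp only [Sym2.mem_iff, forall_eq_or_imp, forall_eq]
      refine ⟨hsa.rewrite ?_ hs, hT' _ hmem t (by simp)⟩
      rintro _ _ ⟨rfl, rfl⟩ _
      exact hn
    · rw [Set.mem_singleton_iff] at he
      subst he
      simp only [Sym2.mem_iff, forall_eq_or_imp, forall_eq]
      exact ⟨hsa.of_rewrite hs, hn⟩
  | oneSide _ _ u v n hmem hflat hname =>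
    have hD : D ⊆ insert n D := Finset.subset_insert _ _
    refine ⟨hD, ?_⟩
    have hT' := hT.mono hD
    have hn : (Term.const (Sum.inr n) : Term sig (Cst K)).All (OnlyF sig)
        (· ∈ constants K (insert n D)) := inr_mem_constants.2 (Finset.mem_insert_self _ _)
    rintro e (he | he | he)
    · exact hT' e he.1
    · subst he
      simp only [Sym2.mem_iff, forall_eq_or_imp, forall_eq]
      exact ⟨hT' _ hmem _ (by simp), hn⟩
    · rw [Set.mem_singleton_iff] at he
      subst he
      simp only [Sym2.mem_iff, forall_eq_or_imp, forall_eq]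
      exact ⟨hT' _ hmem _ (by simp), hn⟩
  | bothSides _ _ u v m n hmem hflat hu hv =>
    have hD : D ⊆ insert n (insert m D) :=
      (Finset.subset_insert _ _).trans (Finset.subset_insert _ _)
    refine ⟨hD, ?_⟩
    have hT' := hT.mono hD
    have hn : (Term.const (Sum.inr n) : Term sig (Cst K)).All (OnlyF sig)
        (· ∈ constants K (insert n (insert m D))) := inr_mem_constants.2 (by simp)
    have hm : (Term.const (Sum.inr m) : Term sig (Cst K)).All (OnlyF sig)
        (· ∈ constants K (insert n (insert m D))) := inr_mem_constants.2 (by simp)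
    rintro e (he | he | he | he)
    · exact hT' e he.1
    · subst he
      simp only [Sym2.mem_iff, forall_eq_or_imp, forall_eq]
      exact ⟨hT' _ hmem _ (by simp), hm⟩
    · subst he
      simp only [Sym2.mem_iff, forall_eq_or_imp, forall_eq]
      exact ⟨hT' _ hmem _ (by simp), hn⟩
    · rw [Set.mem_singleton_iff] at he
      subst he
      simp only [Sym2.mem_iff, forall_eq_or_imp, forall_eq]
      exact ⟨hm, hn⟩

/-- The replaced equation follows from the new ones by substituting the named terms for their names.
-/
theorem sat_of_step {op : F → List A → A} {φ : Cst K → A} {D D' : Finset ℕ}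
    {T T' : Set (Sym2 (Term sig (Cst K)))} (h : FlattenStep sig (D, T) (D', T'))
    (hT' : ∀ e ∈ T', Sat op φ e) : ∀ e ∈ T, Sat op φ e := by
  intro e he
  cases h with
  | inner _ _ s s' t g w h n hmem hflat hproper hname hs =>
    by_cases hee : e = s(s, t)
    · have h₁ := sat_mk.1 (hT' s(s', t) (by simp))
      have h₂ := sat_mk.1 (hT' s((FlatTerm.app g w h).toTerm, .const (Sum.inr n)) (by simp))
      rw [hee, sat_mk, ← h₁]
      refine Term.eval_eq_of_rewrite ?_ hs
      rintro _ _ ⟨rfl, rfl⟩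
      exact h₂
    · exact hT' e (.inl ⟨he, hee⟩)
  | oneSide _ _ u v n hmem hflat hname =>
    by_cases hee : e = s(u.toTerm, v.toTerm)
    · have h₁ := sat_mk.1 (hT' s(v.toTerm, .const (Sum.inr n)) (by simp))
      have h₂ := sat_mk.1 (hT' s(u.toTerm, .const (Sum.inr n)) (by simp))
      rw [hee, sat_mk, h₁, h₂]
    · exact hT' e (.inl ⟨he, hee⟩)
  | bothSides _ _ u v m n hmem hflat hu hv =>
    by_cases hee : e = s(u.toTerm, v.toTerm)
    · have h₁ := sat_mk.1 (hT' s(u.toTerm, .const (Sum.inr m)) (by simp))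
      have h₂ := sat_mk.1 (hT' s(v.toTerm, .const (Sum.inr n)) (by simp))
      have h₃ := sat_mk.1 (hT' s(.const (Sum.inr m), .const (Sum.inr n)) (by simp))
      rw [hee, sat_mk, h₁, h₂, h₃]
    · exact hT' e (.inl ⟨he, hee⟩)

theorem Term.All.eval_eq {P : F → Prop} {Q : V → Prop} {op : F → List A → A} {φ φ' : V → A}
    (h : ∀ c, Q c → φ' c = φ c) {t : Term sig V} (ht : t.All P Q) :
    t.eval op φ' = t.eval op φ := by
  induction t with
  | const c => exact h c ht
  | app g n _ args ih =>
    simp only [Term.eval]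
    congr 2
    funext k
    exact ih k (ht.2 k)

theorem Good.sat_congr {op : F → List A → A} {φ φ' : Cst K → A} {D : Finset ℕ}
    (h : ∀ c ∈ constants K D, φ' c = φ c) {T : Set (Sym2 (Term sig (Cst K)))} (hT : Good D T)
    {e : Sym2 (Term sig (Cst K))} (he : e ∈ T) (hs : Sat op φ e) : Sat op φ' e := by
  induction e with
  | _ s t =>
  rw [sat_mk] at hs ⊢
  rw [(hT _ he s (by simp)).eval_eq h, (hT _ he t (by simp)).eval_eq h, hs]

/-- A fresh constant is given the value of the term it names, which does not disturb that value
because the constant does not occur in the term. A reused constant satisfies its naming equation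
already. -/
theorem exists_name {op : F → List A → A} {φ : Cst K → A} {D : Finset ℕ}
    {T : Set (Sym2 (Term sig (Cst K)))} (hT : ∀ e ∈ T, Sat op φ e) {u : FlatTerm sig} {n : ℕ}
    (hu : u.toTerm.All (OnlyF sig) (· ∈ constants K D)) (hn : IsName sig D T u n) :
    ∃ φ' : Cst K → A, (∀ c ∈ constants K D, φ' c = φ c) ∧
      u.toTerm.eval op φ' = φ' (Sum.inr n) := by
  classical
  rcases hn with hn | hn
  · have hφ : ∀ c ∈ constants K D,
        Function.update φ (Sum.inr n) (u.toTerm.eval op φ) c = φ c := by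
      intro c hc
      refine Function.update_of_ne ?_ _ _
      rintro rfl
      exact hn (inr_mem_constants.1 hc)
    refine ⟨_, hφ, ?_⟩
    rw [hu.eval_eq hφ, Function.update_self]
  · exact ⟨φ, fun _ _ => rfl, sat_mk.1 (hT _ hn)⟩

theorem exists_sat_step {op : F → List A → A} {φ : Cst K → A} {D D' : Finset ℕ}
    {T T' : Set (Sym2 (Term sig (Cst K)))} (h : FlattenStep sig (D, T) (D', T')) (hg : Good D T)
    (hT : ∀ e ∈ T, Sat op φ e) :
    ∃ φ' : Cst K → A, (∀ c ∈ constants K D, φ' c = φ c) ∧ ∀ e ∈ T', Sat op φ' e := by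
  cases h with
  | inner _ _ s s' t g w h n hmem hflat hproper hname hs =>
    obtain ⟨φ', h₁, h₂⟩ := exists_name hT ((hg _ hmem s (by simp)).of_rewrite hs) hname
    refine ⟨φ', h₁, ?_⟩
    rintro e (he | he | he)
    · exact hg.sat_congr h₁ he.1 (hT e he.1)
    · subst he
      rw [sat_mk, ← sat_mk.1 (hg.sat_congr h₁ hmem (hT _ hmem))]
      refine (Term.eval_eq_of_rewrite ?_ hs).symm
      rintro _ _ ⟨rfl, rfl⟩
      exact h₂
    · rw [Set.mem_singleton_iff] at he
      subst he
      exact sat_mk.2 h₂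
  | oneSide _ _ u v n hmem hflat hname =>
    obtain ⟨φ', h₁, h₂⟩ := exists_name hT (hg _ hmem u.toTerm (by simp)) hname
    refine ⟨φ', h₁, ?_⟩
    rintro e (he | he | he)
    · exact hg.sat_congr h₁ he.1 (hT e he.1)
    · subst he
      rw [sat_mk, ← sat_mk.1 (hg.sat_congr h₁ hmem (hT _ hmem))]
      exact h₂
    · rw [Set.mem_singleton_iff] at he
      subst he
      exact sat_mk.2 h₂
  | bothSides _ _ u v m n hmem hflat hu hv =>
    obtain ⟨φ₁, h₁, h₁'⟩ := exists_name hT (hg _ hmem u.toTerm (by simp)) hu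
    have hD : D ⊆ insert m D := Finset.subset_insert _ _
    have hg' := hg.mono hD
    obtain ⟨φ₂, h₂, h₂'⟩ := exists_name (fun e he => hg.sat_congr h₁ he (hT e he))
      (hg' _ hmem v.toTerm (by simp)) hv
    have h₃ : ∀ c ∈ constants K D, φ₂ c = φ c := fun c hc =>
      (h₂ c (constants_mono hD hc)).trans (h₁ c hc)
    have hum : u.toTerm.eval op φ₂ = φ₂ (Sum.inr m) := by
      rw [(hg' _ hmem u.toTerm (by simp)).eval_eq h₂, h₁',
        h₂ _ (inr_mem_constants.2 (Finset.mem_insert_self _ _))]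
    refine ⟨φ₂, h₃, ?_⟩
    rintro e (he | he | he | he)
    · exact hg.sat_congr h₃ he.1 (hT e he.1)
    · subst he
      exact sat_mk.2 hum
    · subst he
      exact sat_mk.2 h₂'
    · rw [Set.mem_singleton_iff] at he
      subst he
      rw [sat_mk, Term.eval_const, Term.eval_const, ← hum, ← h₂']
      exact sat_mk.1 (hg.sat_congr h₃ hmem (hT _ hmem))

/-- The first state of the flattening procedure. -/
def initialState (sig : GroupSignature F K) (E : Set (Sym2 (Term sig K))) :
    Set (Sym2 (Term sig (Cst K))) :=
  Sym2.map (Term.map Sum.inl) '' normalizedEqns sig (flattenedEqns sig E)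

theorem sat_initialState [Group A] {op : F → List A → A} (h : IsGroupModel sig op)
    {φ : Cst K → A} (hφ : φ (Sum.inl sig.one) = 1) {E : Set (Sym2 (Term sig K))} :
    (∀ e ∈ initialState sig E, Sat op φ e) ↔ ∀ e ∈ E, Sat op (φ ∘ Sum.inl) e := by
  rw [← sat_normalizedEqns h (φ := φ ∘ Sum.inl) hφ, initialState, Set.forall_mem_image]
  refine forall₂_congr fun e _ => ?_
  induction e with
  | _ s t => simp [Term.eval_map]

theorem good_initialState {E : Set (Sym2 (Term sig K))}
    (hE : ∀ e ∈ E, ∀ t ∈ e, ∀ g ∈ sig.assoc, t.Occurs g → g = sig.f) :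
    Good ∅ (initialState sig E) := by
  have hnf : ∀ s t : Term sig K, IsGroupNormalForm sig s t →
      s.All (OnlyF sig) (fun _ => True) → t.All (OnlyF sig) fun _ => True := by
    intro s t hst hs
    obtain ⟨hst, -⟩ := hst
    induction hst with
    | refl => exact hs
    | tail _ hs' ih =>
      obtain ⟨a, b, h₁, h₂, h₃⟩ := hs'
      rw [← Term.all_iff_of_assocEq h₃]
      refine ((Term.all_iff_of_assocEq h₁).1 ih).rewrite ?_ h₂
      intro s t hst hs
      have hi : OnlyF sig sig.i := fun h => absurd h sig.i_not_assoc
      have hf : OnlyF sig sig.f := fun _ => rfl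
      cases hst <;> simp_all [unit]
  rintro _ ⟨_, ⟨s₁, t₁, s₂, t₂, ⟨s, t, s₀, t₀, he, hs₀, -, ht₀, -, heq⟩, hs₂, ht₂, -, rfl⟩, rfl⟩
  have hs := (Term.all_iff_of_assocEq hs₀).1 (Term.all_of_occurs s (hE _ he s (by simp)))
  have ht := (Term.all_iff_of_assocEq ht₀).1 (Term.all_of_occurs t (hE _ he t (by simp)))
  have key : s₂.All (OnlyF sig) (fun _ => True) ∧ t₂.All (OnlyF sig) fun _ => True := by
    rcases Sym2.eq_iff.1 heq with ⟨rfl, rfl⟩ | ⟨rfl, rfl⟩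
    · exact ⟨hnf _ _ hs₂ hs, hnf _ _ ht₂ ht⟩
    · exact ⟨hnf _ _ hs₂ ht, hnf _ _ ht₂ hs⟩
  simp only [Sym2.map_mk, Sym2.mem_iff, forall_eq_or_imp, forall_eq, Term.all_map]
  exact ⟨key.1.mono (fun _ h => h) fun _ _ => inl_mem_constants,
    key.2.mono (fun _ h => h) fun _ _ => inl_mem_constants⟩

end GroupSignature

namespace GroupSignature

variable {F K V A : Type*} {sig : GroupSignature F K}

/-! ### Whole runs of Phase I: validity of the output and transfer of models. -/

section PhaseOne

variable {E : Set (Sym2 (Term sig K))} {D : Finset ℕ} {E' : Set (Sym2 (FlatTerm sig))}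

theorem good_of_path {D D' : Finset ℕ} {T T' : Set (Sym2 (Term sig (Cst K)))}
    (h : Relation.ReflTransGen (FlattenStep sig) (D, T) (D', T')) (hT : Good D T) :
    Good D' T' := by
  generalize hx : (D, T) = x at h
  generalize hy : (D', T') = y at h
  induction h generalizing D' T' with
  | refl =>
    rw [← hx] at hy
    obtain ⟨rfl, rfl⟩ := Prod.mk.injEq _ _ _ _ ▸ hy
    exact hT
  | @tail y z _ hs ih =>
    obtain ⟨D₁, T₁⟩ := y
    subst hy
    exact (good_step hs (ih rfl)).2

theorem exists_sat_path {op : F → List A → A} {φ : Cst K → A} {D D' : Finset ℕ}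
    {T T' : Set (Sym2 (Term sig (Cst K)))}
    (h : Relation.ReflTransGen (FlattenStep sig) (D, T) (D', T')) (hg : Good D T)
    (hT : ∀ e ∈ T, Sat op φ e) :
    ∃ φ' : Cst K → A, (∀ c, φ' (Sum.inl c) = φ (Sum.inl c)) ∧ ∀ e ∈ T', Sat op φ' e := by
  generalize hx : (D, T) = x at h
  generalize hy : (D', T') = y at h
  induction h generalizing D' T' with
  | refl =>
    rw [← hx] at hy
    obtain ⟨rfl, rfl⟩ := Prod.mk.injEq _ _ _ _ ▸ hy
    exact ⟨φ, fun _ => rfl, hT⟩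
  | @tail y z hp hs ih =>
    obtain ⟨D₁, T₁⟩ := y
    subst hy
    obtain ⟨φ₁, h₁, h₁'⟩ := ih rfl
    subst hx
    obtain ⟨φ₂, h₂, h₂'⟩ := exists_sat_step hs (good_of_path hp hg) h₁'
    exact ⟨φ₂, fun c => (h₂ _ inl_mem_constants).trans (h₁ c), h₂'⟩

theorem sat_of_path {op : F → List A → A} {φ : Cst K → A}
    {x y : Finset ℕ × Set (Sym2 (Term sig (Cst K)))}
    (h : Relation.ReflTransGen (FlattenStep sig) x y)
    (hT : ∀ e ∈ y.2, Sat op φ e) : ∀ e ∈ x.2, Sat op φ e := by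
  induction h with
  | refl => exact hT
  | @tail y z _ hs ih => exact ih (sat_of_step (D := y.1) (D' := z.1) hs hT)

theorem IsPhaseOne.valid (h : IsPhaseOne sig E D E')
    (hE : ∀ e ∈ E, ∀ t ∈ e, ∀ g ∈ sig.assoc, t.Occurs g → g = sig.f) :
    ∀ e ∈ E', ValidEqn sig (constants K D) e := by
  obtain ⟨T, hT, hflat, rfl⟩ := h
  intro e he
  refine ⟨?_, fun t ht => ?_⟩
  · obtain ⟨e', he', hee⟩ := hflat _ he
    rwa [← Sym2.map.injective FlatTerm.toTerm_injective hee]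
  · rw [← FlatTerm.all_toTerm]
    exact good_of_path hT (good_initialState hE) _ he _ (Sym2.mem_map.2 ⟨t, ht, rfl⟩)

theorem IsPhaseOne.exists_sat [Group A] {op : F → List A → A} (hop : IsGroupModel sig op)
    (h : IsPhaseOne sig E D E')
    (hE : ∀ e ∈ E, ∀ t ∈ e, ∀ g ∈ sig.assoc, t.Occurs g → g = sig.f) {φ : K → A}
    (hφ : φ sig.one = 1) (hs : ∀ e ∈ E, Sat op φ e) :
    ∃ φ' : Cst K → A, (∀ c, φ' (Sum.inl c) = φ c) ∧ ∀ e ∈ E', FlatSat op φ' e := by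
  obtain ⟨T, hT, -, rfl⟩ := h
  obtain ⟨φ', h₁, h₂⟩ := exists_sat_path (φ := Sum.elim φ fun _ => 1) hT (good_initialState hE)
    ((sat_initialState hop hφ).2 hs)
  exact ⟨φ', h₁, fun e he => h₂ _ he⟩

theorem IsPhaseOne.sat [Group A] {op : F → List A → A} (hop : IsGroupModel sig op)
    (h : IsPhaseOne sig E D E') {φ : Cst K → A} (hφ : φ (Sum.inl sig.one) = 1)
    (hs : ∀ e ∈ E', FlatSat op φ e) : ∀ e ∈ E, Sat op (φ ∘ Sum.inl) e := by
  obtain ⟨T, hT, hflat, rfl⟩ := h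
  refine (sat_initialState hop hφ).1 (sat_of_path hT fun e he => ?_)
  obtain ⟨e', -, rfl⟩ := hflat e he
  exact hs e' he

end PhaseOne

/-! ### Phase II: inverses of the constants, and the properties of the initial system. -/

section PhaseTwo

variable {D : Finset ℕ} {E' : Set (Sym2 (FlatTerm sig))} {C : Set (Cst K)}
  {S : Set (Sym2 (FlatTerm sig))}

theorem eval_flatInv [Group A] {op : F → List A → A} (hop : IsGroupModel sig op) (φ : Cst K → A)
    (c : Cst K) : (sig.flatInv c).toTerm.eval op φ = (φ c)⁻¹ := by
  simp [flatInv, FlatTerm.eval_toTerm_app, hop.op_i]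

theorem eval_flatMul [Group A] {op : F → List A → A} (hop : IsGroupModel sig op) (φ : Cst K → A)
    (c d : Cst K) : (sig.flatMul c d).toTerm.eval op φ = φ c * φ d := by
  simp [flatMul, FlatTerm.eval_toTerm_app, hop.op_f]

theorem eval_flatOne {op : F → List A → A} (φ : Cst K → A) :
    (sig.flatOne).toTerm.eval op φ = φ (Sum.inl sig.one) := rfl

theorem IsPhaseTwo.exists_sat [Group A] {op : F → List A → A} (hop : IsGroupModel sig op)
    (h : IsPhaseTwo sig D E' C S) (hE' : ∀ e ∈ E', ValidEqn sig (constants K D) e)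
    {φ : Cst K → A} (hφ : φ (Sum.inl sig.one) = 1) (hs : ∀ e ∈ E', FlatSat op φ e) :
    ∃ φ' : Cst K → A, (∀ c, φ' (Sum.inl c) = φ (Sum.inl c)) ∧ ∀ e ∈ S, FlatSat op φ' e := by
  classical
  obtain ⟨ν, E'', hinj, hfresh, hE'', -, rfl⟩ := h
  -- Each constant added for a missing inverse receives the inverse of the value of its partner.
  -- Injectivity of `ν` makes the partner unique, and freshness keeps the old values.
  let φ' : Cst K → A := fun x =>
    if hx : ∃ c, NeedsInverse sig D E' c ∧ x = Sum.inr (ν c) then (φ hx.choose)⁻¹ else φ x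
  have hν : ∀ c, NeedsInverse sig D E' c → φ' (Sum.inr (ν c)) = (φ c)⁻¹ := by
    intro c hc
    have hx : ∃ d, NeedsInverse sig D E' d ∧ (Sum.inr (ν c) : Cst K) = Sum.inr (ν d) := ⟨c, hc, rfl⟩
    have : φ' (Sum.inr (ν c)) = (φ hx.choose)⁻¹ := dif_pos hx
    have hch : hx.choose = c :=
      (hinj hc hx.choose_spec.1 (Sum.inr_injective hx.choose_spec.2)).symm
    rw [this, hch]
  have hold : ∀ c ∈ constants K D, φ' c = φ c := by
    intro c hc
    refine dif_neg ?_
    rintro ⟨d, hd, rfl⟩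
    exact hfresh d hd (inr_mem_constants.1 hc)
  have hone : φ' (Sum.inl sig.one) = 1 := (hold _ inl_mem_constants).trans hφ
  have hsE : ∀ e ∈ E'', FlatSat op φ' e := by
    subst hE''
    rintro e (he | ⟨c, hc, rfl⟩)
    · have hv := (hE' e he).2
      have hse := hs e he
      induction e with
      | _ s t =>
      rw [flatSat_mk] at hse ⊢
      rw [(FlatTerm.all_toTerm.2 (hv s (by simp))).eval_eq hold,
        (FlatTerm.all_toTerm.2 (hv t (by simp))).eval_eq hold, hse]
    · rw [flatSat_mk, eval_flatInv hop, FlatTerm.toTerm_const, Term.eval_const, hν c hc,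
        hold c hc.1]
  refine ⟨φ', fun c => hold _ inl_mem_constants, ?_⟩
  rintro e ((he | (he | ⟨c, d, hcd, he⟩)) | ⟨c, -, he⟩)
  · exact hsE e he
  · rw [Set.mem_singleton_iff] at he
    subst he
    simp [eval_flatInv hop, eval_flatOne, hone]
  · have hcd := hsE _ hcd
    rw [flatSat_mk, eval_flatInv hop, FlatTerm.toTerm_const, Term.eval_const] at hcd
    rcases he with rfl | rfl | rfl <;>
      simp [eval_flatInv hop, eval_flatMul hop, eval_flatOne, hone, ← hcd]
  · rcases he with rfl | rfl <;> simp [eval_flatMul hop, hone]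

theorem validEqn_flatInv {C : Set (Cst K)} {c d : Cst K} (hc : c ∈ C) (hd : d ∈ C) :
    ValidEqn sig C s(sig.flatInv c, .const d) := by
  refine ⟨.dflat _ _ _ _, ?_⟩
  simp only [Sym2.mem_iff, forall_eq_or_imp, forall_eq]
  exact ⟨⟨fun h => absurd h sig.i_not_assoc, by simpa using hc⟩, hd⟩

theorem validEqn_flatMul {C : Set (Cst K)} {c d x : Cst K} (hc : c ∈ C) (hd : d ∈ C)
    (hx : x ∈ C) : ValidEqn sig C s(sig.flatMul c d, .const x) := by
  refine ⟨.dflat _ _ _ _, ?_⟩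
  simp only [Sym2.mem_iff, forall_eq_or_imp, forall_eq]
  exact ⟨⟨fun _ => rfl, by simp [hc, hd]⟩, hx⟩

theorem admissible_flatInv {C : Set (Cst K)} {c : Cst K}
    (h : (sig.flatInv c).Admissible C) : c ∈ C := h.2 c (by simp)

/-- What is needed about a set `S(E)` for the completion procedure. -/
structure IsGroupSystem (sig : GroupSignature F K) (C : Set (Cst K))
    (S : Set (Sym2 (FlatTerm sig))) : Prop where
  finite : C.Finite
  one_mem : Sum.inl sig.one ∈ C
  valid : ∀ e ∈ S, ValidEqn sig C e
  unitEqns_subset : unitEqns sig C ⊆ S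
  mem_generators : ∀ c ∈ C, c ≠ Sum.inl sig.one → c ∈ generators sig C S

theorem flatMul_notMem_unitEqns {C : Set (Cst K)} {c d : Cst K}
    (h : c ≠ Sum.inl sig.one ∨ d ≠ Sum.inl sig.one) :
    s(sig.flatMul c d, sig.flatOne) ∉ unitEqns sig C := by
  rintro ⟨x, -, hx⟩
  simp only [flatMul, flatOne, Sym2.eq_iff, FlatTerm.app.injEq, FlatTerm.const.injEq,
    List.cons.injEq, reduceCtorEq, false_and, or_false, true_and, and_true] at hx
  rcases hx with ⟨⟨rfl, rfl⟩, rfl⟩ | ⟨⟨rfl, rfl⟩, rfl⟩ <;> simp at h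

/-- The point is `mem_generators`. After Phase II every constant `c ≠ 1` is one of `x`, `y` in some
equation `i(x) ≈ y`, and hence occurs in the relation `f(x, y) ≈ 1`. This is not a unit equation, as
`x` and `y` are not both `1`. -/
theorem IsPhaseTwo.isGroupSystem [Finite K] (h : IsPhaseTwo sig D E' C S)
    (hE' : ∀ e ∈ E', ValidEqn sig (constants K D) e) : IsGroupSystem sig C S := by
  obtain ⟨ν, E'', hinj, hfresh, hE'', hC, rfl⟩ := h
  have hDC : constants K D ⊆ C := by rw [hC]; exact Set.subset_union_left
  have hDfin : (constants K D).Finite :=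
    (Set.finite_range _).union ((Finset.finite_toSet D).image _)
  have hone : Sum.inl sig.one ∈ C := hDC inl_mem_constants
  have hνC : ∀ c, NeedsInverse sig D E' c → Sum.inr (ν c) ∈ C := by
    intro c hc
    rw [hC]
    exact .inr ⟨c, hc, rfl⟩
  have hvalid : ∀ e ∈ E'', ValidEqn sig C e := by
    rw [hE'']
    rintro e (he | ⟨c, hc, rfl⟩)
    · exact ⟨(hE' e he).1, fun t ht => ((hE' e he).2 t ht).mono hDC⟩
    · exact validEqn_flatInv (hDC hc.1) (hνC c hc)
  have hinv : ∀ c ∈ C, c ≠ Sum.inl sig.one → ∃ x y : Cst K,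
      s(sig.flatInv x, .const y) ∈ E'' ∧ (c = x ∨ c = y) := by
    intro c hc hc1
    rw [hC] at hc
    rcases hc with hc | ⟨d, hd, rfl⟩
    · by_cases hn : NeedsInverse sig D E' c
      · exact ⟨c, Sum.inr (ν c), by rw [hE'']; exact .inr ⟨c, hn, rfl⟩, .inl rfl⟩
      · have : (∃ d ∈ constants K D, s(sig.flatInv c, .const d) ∈ E') ∨
            ∃ d ∈ constants K D, s(sig.flatInv d, .const c) ∈ E' := by
          by_contra! hcon
          exact hn ⟨hc, hc1, hcon⟩
        rcases this with ⟨d, -, hd⟩ | ⟨d, -, hd⟩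
        · exact ⟨c, d, by rw [hE'']; exact .inl hd, .inl rfl⟩
        · exact ⟨d, c, by rw [hE'']; exact .inl hd, .inr rfl⟩
    · exact ⟨d, Sum.inr (ν d), by rw [hE'']; exact .inr ⟨d, hd, rfl⟩, .inr rfl⟩
  refine ⟨?_, hone, ?_, fun e he => .inr he, ?_⟩
  · rw [hC]
    refine hDfin.union ((hDfin.image fun c => (Sum.inr (ν c) : Cst K)).subset ?_)
    rintro _ ⟨c, hc, rfl⟩
    exact ⟨c, hc.1, rfl⟩
  · rintro e ((he | (he | ⟨c, d, hcd, he⟩)) | ⟨c, hc, he⟩)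
    · exact hvalid e he
    · rw [Set.mem_singleton_iff] at he
      rw [he]
      exact validEqn_flatInv hone hone
    · have hc : c ∈ C := admissible_flatInv ((hvalid _ hcd).2 _ (by simp))
      have hd : d ∈ C := (hvalid _ hcd).2 (.const d) (by simp)
      rcases he with rfl | rfl | rfl
      · exact validEqn_flatInv hd hc
      · exact validEqn_flatMul hc hd hone
      · exact validEqn_flatMul hd hc hone
    · rcases he with rfl | rfl
      · exact validEqn_flatMul hc hone hc
      · exact validEqn_flatMul hone hc hc
  · intro c hc hc1
    obtain ⟨x, y, hxy, hcxy⟩ := hinv c hc hc1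
    refine ⟨hc1, s(sig.flatMul x y, sig.flatOne), ⟨⟨.inl (.inr (.inr ⟨x, y, hxy, by simp⟩)), ?_⟩,
      sig.flatMul x y, by simp, rfl⟩, sig.flatMul x y, by simp, ?_⟩
    · exact flatMul_notMem_unitEqns (by rcases hcxy with rfl | rfl <;> simp [hc1])
    · simpa [flatMul, FlatTerm.word] using hcxy

theorem IsPhaseTwo.subset (h : IsPhaseTwo sig D E' C S) : E' ⊆ S := by
  obtain ⟨ν, E'', -, -, rfl, -, rfl⟩ := h
  exact fun e he => .inl (.inl (.inl he))

end PhaseTwo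

end GroupSignature

/-! ### Flat terms as strings -/

namespace GroupSignature

open StringCompletion Relation

variable {F K : Type*} {sig : GroupSignature F K}

/-- Letters: the constants, the function symbols, and a separator. -/
abbrev Letter (F K : Type*) := Cst K ⊕ Option F

/-! ### Well-foundedness and context compatibility of the length-lexicographic order. -/

section Smaller

variable [LinearOrder K]

theorem Smaller.trans {a b c : Cst K} (h₁ : Smaller a b) (h₂ : Smaller b c) : Smaller a c := by
  rcases a with a | a <;> rcases b with b | b <;> rcases c with c | c <;>
    simp only [Smaller] at *
  · exact lt_trans h₁ h₂
  · exact lt_trans h₂ h₁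

theorem Smaller.irrefl (a : Cst K) : ¬ Smaller a a := by
  rcases a with a | a <;> simp [Smaller]

instance : Std.Trichotomous (Smaller (K := K)) where
  trichotomous a b h₁ h₂ := by
    rcases a with a | a <;> rcases b with b | b <;> simp only [Smaller, not_true, not_lt] at h₁ h₂
    · rw [le_antisymm h₂ h₁]
    · rw [le_antisymm h₁ h₂]

/-- The order on the letters from `C`; the other letters are incomparable. -/
def LetterLt (C : Set (Cst K)) : Letter F K → Letter F K → Prop
  | .inl a, .inl b => a ∈ C ∧ b ∈ C ∧ Smaller a b
  | _, _ => False

/-- The length-lexicographic order on strings. -/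
def WordLt (C : Set (Cst K)) : List (Letter F K) → List (Letter F K) → Prop :=
  List.Shortlex (LetterLt C)

theorem lex_trans {α : Type*} {r : α → α → Prop} (hr : ∀ a b c, r a b → r b c → r a c) :
    ∀ {u v w : List α}, List.Lex r u v → List.Lex r v w → List.Lex r u w
  | _, _, _, .nil, .cons _ => .nil
  | _, _, _, .nil, .rel _ => .nil
  | _, _, _, .cons h₁, .cons h₂ => .cons (lex_trans hr h₁ h₂)
  | _, _, _, .cons _, .rel h₂ => .rel h₂
  | _, _, _, .rel h₁, .cons _ => .rel h₁
  | _, _, _, .rel h₁, .rel h₂ => .rel (hr _ _ _ h₁ h₂)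

theorem lex_append {α : Type*} {r : α → α → Prop} (w : List α) :
    ∀ {u v : List α}, u.length = v.length → List.Lex r u v → List.Lex r (u ++ w) (v ++ w)
  | _, _, h, .nil => by simp at h
  | _, _, h, .cons h₁ => .cons (lex_append w (by simpa using h) h₁)
  | _, _, _, .rel h₁ => .rel h₁

theorem isReductionOrder_shortlex {α : Type*} {r : α → α → Prop} (wf : WellFounded r)
    (hr : ∀ a b c, r a b → r b c → r a c) : IsReductionOrder (List.Shortlex r) where
  wf := List.Shortlex.wf wf
  trans := by
    intro a b c h₁ h₂
    rw [List.shortlex_def] at *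
    rcases h₁ with h₁ | ⟨h₁, h₁'⟩ <;> rcases h₂ with h₂ | ⟨h₂, h₂'⟩
    · exact .inl (h₁.trans h₂)
    · exact .inl (h₂ ▸ h₁)
    · exact .inl (h₁ ▸ h₂)
    · exact .inr ⟨h₁.trans h₂, lex_trans hr h₁' h₂'⟩
  context := by
    intro p q a b h
    rw [List.append_assoc, List.append_assoc]
    refine List.Shortlex.append_left ?_ p
    rw [List.shortlex_def] at *
    rcases h with h | ⟨h, h'⟩
    · left
      simpa using h
    · right
      exact ⟨by simpa using h, lex_append q h h'⟩

/-- The precedence descends forever along `c₀ ≻ c₁ ≻ …`. Its restriction to the finite set `C` is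
well founded, and inferences introduce no constants outside `C`. -/
theorem isReductionOrder_wordLt {C : Set (Cst K)} (hC : C.Finite) :
    IsReductionOrder (WordLt (F := F) C) := by
  have htr : ∀ a b c : Letter F K, LetterLt C a b → LetterLt C b c → LetterLt C a c := by
    rintro (a | a) (b | b) (c | c) h₁ h₂ <;> simp only [LetterLt] at *
    exact ⟨h₁.1, h₂.2.1, h₁.2.2.trans h₂.2.2⟩
  refine isReductionOrder_shortlex ?_ htr
  have hir : ∀ a : Letter F K, ¬ LetterLt C a a := by
    rintro (a | a) h
    · exact Smaller.irrefl a h.2.2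
    · exact h
  have hacc : ∀ a ∈ (Sum.inl '' C : Set (Letter F K)), Acc (LetterLt C) a := by
    have : IsStrictOrder (Letter F K) (LetterLt C) :=
      { irrefl := hir, trans := htr }
    have hwf := (hC.image (Sum.inl : Cst K → Letter F K)).wellFoundedOn (r := LetterLt C)
    intro a ha
    refine hwf.induction (P := fun a => Acc (LetterLt C) a) ha ?_
    intro y hy ih
    refine ⟨_, fun z hz => ih z ?_ hz⟩
    rcases z with z | z <;> rcases y with y | y <;> simp only [LetterLt] at hz
    exact ⟨z, hz.1, rfl⟩
  refine ⟨fun a => ⟨_, fun b hb => hacc b ?_⟩⟩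
  rcases b with b | b <;> rcases a with a | a <;> simp only [LetterLt] at hb
  exact ⟨b, hb.1, rfl⟩

theorem lex_map_inl {C : Set (Cst K)} {u v : List (Cst K)} (h : List.Lex Smaller u v) :
    (∀ c ∈ u, c ∈ C) → (∀ c ∈ v, c ∈ C) →
      List.Lex (LetterLt (F := F) C) (u.map Sum.inl) (v.map Sum.inl) := by
  induction h with
  | nil => exact fun _ _ => .nil
  | cons _ ih =>
    exact fun hu hv =>
      .cons (ih (fun c hc => hu c (by simp [hc])) fun c hc => hv c (by simp [hc]))
  | rel h => exact fun hu hv => .rel ⟨hu _ (by simp), hv _ (by simp), h⟩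

theorem wordLt_of_shortlex {C : Set (Cst K)} {u v : List (Cst K)} (hu : ∀ c ∈ u, c ∈ C)
    (hv : ∀ c ∈ v, c ∈ C) (h : List.Shortlex Smaller u v) :
    WordLt (F := F) C (u.map Sum.inl) (v.map Sum.inl) := by
  unfold WordLt
  rw [List.shortlex_def] at *
  simp only [List.length_map]
  exact h.imp id fun h => ⟨h.1, lex_map_inl h.2 hu hv⟩

end Smaller

theorem isReductionOrder_asymm {Γ : Type*} {lt : List Γ → List Γ → Prop}
    (ho : IsReductionOrder lt) {a b : List Γ} (h₁ : lt a b) (h₂ : lt b a) : False :=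
  ho.wf.asymmetric _ _ h₁ h₂

/-! #### The encoding -/

/-- A string of constants with separators. -/
def separated (w : List (Cst K)) : List (Letter F K) :=
  w.flatMap fun c => [Sum.inl c, Sum.inr none]

@[simp] theorem separated_nil : separated (F := F) ([] : List (Cst K)) = [] := rfl

@[simp] theorem separated_cons (c : Cst K) (w : List (Cst K)) :
    separated (F := F) (c :: w) = Sum.inl c :: Sum.inr none :: separated w := rfl

theorem separated_append (v w : List (Cst K)) :
    separated (F := F) (v ++ w) = separated v ++ separated w := by
  simp [separated]

theorem length_separated (w : List (Cst K)) :
    (separated (F := F) w).length = 2 * w.length := by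
  induction w with
  | nil => rfl
  | cons c w ih => simp only [separated_cons, List.length_cons, ih]; omega

theorem separated_injective : Function.Injective (separated (F := F) (K := K)) := by
  intro v
  induction v with
  | nil =>
    rintro (_ | ⟨c, w⟩) h
    · rfl
    · simp at h
  | cons c v ih =>
    rintro (_ | ⟨d, w⟩) h
    · simp at h
    · simp only [separated_cons, List.cons.injEq, Sum.inl.injEq, true_and] at h
      rw [h.1, ih h.2]

theorem symbol_notMem_separated (g : F) (w : List (Cst K)) :
    (Sum.inr (some g) : Letter F K) ∉ separated w := by
  simp [separated]

theorem separated_eq_append_cons {w : List (Cst K)} {c : Cst K} :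
    ∀ {p q : List (Letter F K)}, separated w = p ++ Sum.inl c :: q →
      ∃ w₁ w₂, w = w₁ ++ c :: w₂ ∧ p = separated w₁ ∧ q = Sum.inr none :: separated w₂ := by
  induction w with
  | nil => intro p q h; simp at h
  | cons d w ih =>
    rintro (_ | ⟨x, _ | ⟨y, p⟩⟩) q h
    · simp only [separated_cons, List.nil_append, List.cons.injEq, Sum.inl.injEq] at h
      obtain ⟨rfl, rfl⟩ := h
      exact ⟨[], w, rfl, rfl, rfl⟩
    · simp at h
    · simp only [separated_cons, List.cons_append, List.cons.injEq] at h
      obtain ⟨rfl, rfl, h⟩ := h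
      obtain ⟨w₁, w₂, rfl, rfl, rfl⟩ := ih h
      exact ⟨d :: w₁, w₂, rfl, rfl, rfl⟩

theorem inl_prefix_of_append_cons {w : List (Cst K)} {g : F} {c : Cst K}
    {p q : List (Letter F K)} (h : Sum.inr (some g) :: separated w = p ++ Sum.inl c :: q) :
    ∃ w₁ w₂, w = w₁ ++ c :: w₂ ∧ p = Sum.inr (some g) :: separated w₁ ∧
      q = Sum.inr none :: separated w₂ := by
  rcases p with _ | ⟨x, p⟩
  · simp at h
  · simp only [List.cons_append, List.cons.injEq] at h
    obtain ⟨rfl, h⟩ := h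
    obtain ⟨w₁, w₂, rfl, rfl, rfl⟩ := separated_eq_append_cons h
    exact ⟨w₁, w₂, rfl, rfl, rfl⟩

namespace FlatTerm

open Classical in
/-- The encoding of flat terms by strings: `f(w)` is encoded by `w`, and a term that is headed by
a non-associative symbol by this symbol and its arguments, with separators. -/
noncomputable def enc : FlatTerm sig → List (Letter F K)
  | const c => [Sum.inl c]
  | app g w _ => if g ∈ sig.assoc then w.map Sum.inl else Sum.inr (some g) :: separated w

@[simp] theorem enc_const (c : Cst K) : (const c : FlatTerm sig).enc = [Sum.inl c] := rfl

theorem enc_app_assoc {g : F} (hg : g ∈ sig.assoc) (w : List (Cst K))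
    (h : sig.IsArity g w.length) : (app g w h).enc = w.map Sum.inl := if_pos hg

theorem enc_app {g : F} (hg : g ∉ sig.assoc) (w : List (Cst K))
    (h : sig.IsArity g w.length) : (app g w h).enc = Sum.inr (some g) :: separated w := if_neg hg

end FlatTerm

open FlatTerm

theorem Represents.enc {g : F} (hg : g ∈ sig.assoc) {u : List (Cst K)} {t : FlatTerm sig}
    (h : Represents g u t) : t.enc = u.map Sum.inl := by
  cases h with
  | constant c => rfl
  | app w h => exact enc_app_assoc hg _ h

theorem Represents.ne_nil {g : F} {u : List (Cst K)} {t : FlatTerm sig}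
    (h : Represents g u t) : u ≠ [] := by
  cases h with
  | constant c => simp
  | app w h =>
    have := pos_of_isArity h
    rintro rfl
    simp at this

theorem Represents.eq_app {g : F} {u : List (Cst K)} {t : FlatTerm sig}
    (h : Represents g u t) (hu : 2 ≤ u.length) : ∃ h, t = .app g u h := by
  cases h with
  | constant c => simp at hu
  | app w h => exact ⟨h, rfl⟩

theorem Represents.eq_const {g : F} (hg : g ∈ sig.assoc) {c : Cst K} {t : FlatTerm sig}
    (h : Represents g [c] t) : t = .const c := by
  cases h with
  | constant c => rfl
  | app w h => exact absurd (h.1 hg) (by simp)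

theorem exists_represents {g : F} (hg : g ∈ sig.assoc) {u : List (Cst K)} (hu : u ≠ []) :
    ∃ t : FlatTerm sig, Represents g u t := by
  rcases u with _ | ⟨c, _ | ⟨d, u⟩⟩
  · exact absurd rfl hu
  · exact ⟨_, .constant c⟩
  · exact ⟨_, .app _ (isArity_of_assoc hg (by simp))⟩

theorem length_eq_one_or {u : List (Cst K)} (hu : u ≠ []) : (∃ c, u = [c]) ∨ 2 ≤ u.length := by
  rcases u with _ | ⟨c, _ | ⟨d, u⟩⟩
  · exact absurd rfl hu
  · exact .inl ⟨c, rfl⟩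
  · exact .inr (by simp)

theorem Represents.unique {g : F} (hg : g ∈ sig.assoc) {u : List (Cst K)} {s t : FlatTerm sig}
    (hs : Represents g u s) (ht : Represents g u t) : s = t := by
  rcases length_eq_one_or hs.ne_nil with ⟨c, rfl⟩ | h
  · rw [hs.eq_const hg, ht.eq_const hg]
  · obtain ⟨_, rfl⟩ := hs.eq_app h
    obtain ⟨_, rfl⟩ := ht.eq_app h
    rfl

theorem Represents.admissible {C : Set (Cst K)} {u : List (Cst K)} {t : FlatTerm sig}
    (h : Represents sig.f u t) : t.Admissible C ↔ ∀ c ∈ u, c ∈ C := by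
  cases h with
  | constant c => simp [Admissible]
  | app w h => simp [Admissible, OnlyF]

theorem admissible_cases {C : Set (Cst K)} {t : FlatTerm sig} (h : t.Admissible C) :
    (∃ u, Represents sig.f u t) ∨ ∃ g w, ∃ h : sig.IsArity g w.length, g ∉ sig.assoc ∧
      t = .app g w h := by
  cases t with
  | const c => exact .inl ⟨_, .constant c⟩
  | app g w hw =>
    by_cases hg : g ∈ sig.assoc
    · obtain rfl := h.1 hg
      exact .inl ⟨_, .app w hw⟩
    · exact .inr ⟨g, w, hw, hg, rfl⟩

theorem represents_of_enc_eq {C : Set (Cst K)} {t : FlatTerm sig} (h : t.Admissible C)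
    {u : List (Cst K)} (hu : t.enc = u.map Sum.inl) : Represents sig.f u t := by
  rcases admissible_cases h with ⟨v, hv⟩ | ⟨g, w, hw, hg, rfl⟩
  · rw [hv.enc sig.f_assoc] at hu
    rwa [← List.map_injective_iff.2 Sum.inl_injective hu]
  · rw [enc_app hg] at hu
    rcases u with _ | ⟨c, u⟩ <;> simp at hu

/-- Terms with the same arguments under two associative symbols would share a code; admissibility
leaves only `f`. A non-associative head is visible as the first letter. -/
theorem enc_injective {C : Set (Cst K)} {s t : FlatTerm sig} (hs : s.Admissible C)
    (ht : t.Admissible C) (h : s.enc = t.enc) : s = t := by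
  rcases admissible_cases hs with ⟨v, hv⟩ | ⟨g, w, hw, hg, rfl⟩
  · rw [hv.enc sig.f_assoc] at h
    exact hv.unique sig.f_assoc (represents_of_enc_eq ht h.symm)
  · rcases admissible_cases ht with ⟨v, hv⟩ | ⟨g', w', hw', hg', rfl⟩
    · rw [hv.enc sig.f_assoc] at h
      exact (represents_of_enc_eq hs h).unique sig.f_assoc hv
    · rw [enc_app hg, enc_app hg', List.cons.injEq] at h
      obtain rfl : g = g' := by simpa using h.1
      obtain rfl := separated_injective h.2
      rfl

/-- The context is nonempty since an associative symbol has at least two arguments and any other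
symbol contributes a letter. Replacing an argument by COLLAPSE therefore uses a strictly shorter
left-hand side. -/
theorem enc_arg (g : F) (v w : List (Cst K)) (c : Cst K)
    (h : sig.IsArity g (v ++ c :: w).length) :
    ∃ p q, p ++ q ≠ [] ∧ ∀ d (h' : sig.IsArity g (v ++ d :: w).length),
      (FlatTerm.app g (v ++ d :: w) h').enc = p ++ [Sum.inl d] ++ q := by
  by_cases hg : g ∈ sig.assoc
  · refine ⟨v.map Sum.inl, w.map Sum.inl, ?_, fun d h' => ?_⟩
    · have := h.1 hg
      intro he
      simp only [List.append_eq_nil_iff, List.map_eq_nil_iff] at he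
      simp [he.1, he.2] at this
    · simp [enc_app_assoc hg]
  · refine ⟨Sum.inr (some g) :: separated v, Sum.inr none :: separated w, by simp, fun d h' => ?_⟩
    simp [enc_app hg, separated_append]

/-! #### Valid equations -/

theorem validEqn_mk {C : Set (Cst K)} {s t : FlatTerm sig} :
    ValidEqn sig C s(s, t) ↔ IsFlatEqn sig s(s, t) ∧ s.Admissible C ∧ t.Admissible C := by
  simp [ValidEqn]

theorem isFlatEqn_const (t : FlatTerm sig) (d : Cst K) : IsFlatEqn sig s(t, .const d) := by
  cases t with
  | const c => exact .constant c d
  | app g w h => exact .dflat g w h d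

theorem Represents.isFlatEqn {g : F} (hg : g ∈ sig.assoc) {u v : List (Cst K)}
    {s t : FlatTerm sig} (hs : Represents g u s) (ht : Represents g v t) :
    IsFlatEqn sig s(s, t) := by
  cases ht with
  | constant d => exact isFlatEqn_const s d
  | app w h =>
    cases hs with
    | constant c => rw [Sym2.eq_swap]; exact isFlatEqn_const _ c
    | app w' h' => exact .aflat g hg _ _ h' h

theorem isFlatEqn_cases {s t : FlatTerm sig} (h : IsFlatEqn sig s(s, t)) :
    (∃ c, s = .const c) ∨ (∃ c, t = .const c) ∨
      ∃ g ∈ sig.assoc, ∃ w w' h h', s = .app g w h ∧ t = .app g w' h' := by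
  generalize he : s(s, t) = e at h
  cases h with
  | constant c d =>
    rcases Sym2.eq_iff.1 he with ⟨rfl, rfl⟩ | ⟨rfl, rfl⟩ <;> simp
  | dflat g w h c =>
    rcases Sym2.eq_iff.1 he with ⟨rfl, rfl⟩ | ⟨rfl, rfl⟩ <;> simp
  | aflat g hg w w' h h' =>
    rcases Sym2.eq_iff.1 he with ⟨rfl, rfl⟩ | ⟨rfl, rfl⟩
    · exact .inr (.inr ⟨g, hg, w, w', h, h', rfl, rfl⟩)
    · exact .inr (.inr ⟨g, hg, w', w, h', h, rfl, rfl⟩)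

/-- The two sides of a valid equation are strings, or one is headed by a non-associative symbol
and the other one is a constant. -/
theorem ValidEqn.cases {C : Set (Cst K)} {s t : FlatTerm sig} (h : ValidEqn sig C s(s, t)) :
    (∃ u v, Represents sig.f u s ∧ Represents sig.f v t) ∨
    (∃ g w, ∃ h : sig.IsArity g w.length, ∃ c, g ∉ sig.assoc ∧ s = .app g w h ∧ t = .const c) ∨
    (∃ g w, ∃ h : sig.IsArity g w.length, ∃ c, g ∉ sig.assoc ∧ t = .app g w h ∧ s = .const c) := by
  obtain ⟨h, hs, ht⟩ := validEqn_mk.1 h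
  rcases isFlatEqn_cases h with ⟨c, rfl⟩ | ⟨c, rfl⟩ | ⟨g, hg, w, w', hw, hw', rfl, rfl⟩
  · rcases admissible_cases ht with ⟨v, hv⟩ | ⟨g, w, hw, hg, rfl⟩
    · exact .inl ⟨_, v, .constant c, hv⟩
    · exact .inr (.inr ⟨g, w, hw, c, hg, rfl, rfl⟩)
  · rcases admissible_cases hs with ⟨v, hv⟩ | ⟨g, w, hw, hg, rfl⟩
    · exact .inl ⟨v, _, hv, .constant c⟩
    · exact .inr (.inl ⟨g, w, hw, c, hg, rfl, rfl⟩)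
  · obtain rfl := hs.1 hg
    exact .inl ⟨w, w', .app w hw, .app w' hw'⟩

/-! ### Orientation of valid equations. -/

section Order

variable [LinearOrder K] {C : Set (Cst K)}

theorem wordLt_of_greater {s t : FlatTerm sig} (hs : s.Admissible C) (ht : t.Admissible C)
    (h : Greater sig s t) : WordLt C t.enc s.enc := by
  cases h with
  | constant h =>
    exact wordLt_of_shortlex (u := [_]) (v := [_]) (List.forall_mem_singleton.2 ht)
      (List.forall_mem_singleton.2 hs) (by simpa using h)
  | appConst g w h c =>
    refine .of_length_lt ?_
    by_cases hg : g ∈ sig.assoc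
    · rw [enc_app_assoc hg]
      simpa using lt_of_lt_of_le one_lt_two (h.1 hg)
    · have := pos_of_isArity h
      rw [enc_app hg]
      simp only [enc_const, List.length_cons, List.length_nil, length_separated]
      omega
  | string hg hv hw h =>
    rw [enc_app_assoc hg, enc_app_assoc hg]
    exact wordLt_of_shortlex ht.2 hs.2 h

theorem Represents.greater_or {u v : List (Cst K)} {s t : FlatTerm sig}
    (hs : Represents sig.f u s) (ht : Represents sig.f v t) :
    s = t ∨ Greater sig s t ∨ Greater sig t s := by
  cases hs with
  | constant c =>
    cases ht with
    | constant d =>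
      by_cases h₁ : Smaller c d
      · exact .inr (.inr (.constant h₁))
      by_cases h₂ : Smaller d c
      · exact .inr (.inl (.constant h₂))
      · exact .inl (by rw [Std.Trichotomous.trichotomous c d h₁ h₂])
    | app w h => exact .inr (.inr (.appConst _ _ _ _))
  | app u hu =>
    cases ht with
    | constant d => exact .inr (.inl (.appConst _ _ _ _))
    | app v hv =>
      by_cases h₁ : List.Shortlex Smaller u v
      · exact .inr (.inr (.string sig.f_assoc _ _ h₁))
      by_cases h₂ : List.Shortlex Smaller v u
      · exact .inr (.inl (.string sig.f_assoc _ _ h₂))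
      · obtain rfl := Std.Trichotomous.trichotomous u v h₁ h₂
        exact .inl rfl

/-- The order is not total on flat terms, but a valid equation never has two sides headed by
non-associative symbols, and strings under `f` are comparable. -/
theorem ValidEqn.greater_or {s t : FlatTerm sig} (h : ValidEqn sig C s(s, t)) :
    s = t ∨ Greater sig s t ∨ Greater sig t s := by
  rcases h.cases with ⟨u, v, hs, ht⟩ | ⟨g, w, hw, c, -, rfl, rfl⟩ | ⟨g, w, hw, c, -, rfl, rfl⟩
  · exact hs.greater_or ht
  · exact .inr (.inl (.appConst _ _ _ _))
  · exact .inr (.inr (.appConst _ _ _ _))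

/-- The sides of an oriented valid equation. -/
theorem ValidEqn.cases_of_greater {s t : FlatTerm sig} (h : ValidEqn sig C s(s, t))
    (hst : Greater sig s t) : (∃ u v, Represents sig.f u s ∧ Represents sig.f v t) ∨
    (∃ g w, ∃ h : sig.IsArity g w.length, ∃ c, g ∉ sig.assoc ∧ s = .app g w h ∧ t = .const c) := by
  rcases h.cases with h | h | ⟨g, w, hw, c, -, rfl, rfl⟩
  · exact .inl h
  · exact .inr h
  · cases hst

end Order

end GroupSignature

/-! ### Completion of flat equations as completion of a string rewriting system -/

namespace GroupSignature

open StringCompletion Relation FlatTerm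

variable {F K : Type*} {sig : GroupSignature F K} {C : Set (Cst K)}

theorem eq_f_of_represents {g : F} (hg : g ∈ sig.assoc) {u : List (Cst K)} {t : FlatTerm sig}
    (h : Represents g u t) (hu : 2 ≤ u.length) (ht : t.Admissible C) : g = sig.f := by
  obtain ⟨_, rfl⟩ := h.eq_app hu
  exact ht.1 hg

theorem ValidEqn.represents_right {l r : FlatTerm sig} (h : ValidEqn sig C s(l, r))
    {u : List (Cst K)} (hl : Represents sig.f u l) (hu : 2 ≤ u.length) :
    ∃ v, Represents sig.f v r := by
  obtain ⟨_, rfl⟩ := hl.eq_app hu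
  rcases h.cases with ⟨_, v, -, hv⟩ | ⟨g, w, hw, c, hg, he, -⟩ | ⟨g, w, hw, c, hg, -, he⟩
  · exact ⟨v, hv⟩
  · cases he
    exact absurd sig.f_assoc hg
  · cases he

theorem Represents.validEqn {u v : List (Cst K)} {s t : FlatTerm sig}
    (hs : Represents sig.f u s) (ht : Represents sig.f v t) (hu : ∀ c ∈ u, c ∈ C)
    (hv : ∀ c ∈ v, c ∈ C) : ValidEqn sig C s(s, t) :=
  validEqn_mk.2 ⟨hs.isFlatEqn sig.f_assoc ht, hs.admissible.2 hu, ht.admissible.2 hv⟩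

variable {S : ℕ → Set (Sym2 (FlatTerm sig))}

/-- All the equations of a derivation. -/
def allEqns (S : ℕ → Set (Sym2 (FlatTerm sig))) : Set (Sym2 (FlatTerm sig)) := ⋃ j, S j

theorem persisting_subset : persisting S ⊆ allEqns S := by
  rintro e ⟨k, hk⟩
  exact Set.mem_iUnion.2 ⟨k, hk k le_rfl⟩

theorem exists_stage {U : Set (Sym2 (FlatTerm sig))} (hU : U.Finite) (h : U ⊆ persisting S) :
    ∃ k, ∀ j ≥ k, U ⊆ S j := by
  induction U, hU using Set.Finite.induction_on with
  | empty => exact ⟨0, fun j _ => Set.empty_subset _⟩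
  | @insert e U _ _ ih =>
    obtain ⟨k, hk⟩ := ih ((Set.subset_insert _ _).trans h)
    obtain ⟨k', hk'⟩ := h (Set.mem_insert _ _)
    refine ⟨max k k', fun j hj => Set.insert_subset (hk' j ?_) (hk j ?_)⟩
    · exact (le_max_right _ _).trans hj
    · exact (le_max_left _ _).trans hj

variable [LinearOrder K]

/-- The equation `A ≈ B` is replaced by `A' ≈ B`, where `A'` arises from `A` by the rule
`L → R`. -/
structure IsReplacement (C : Set (Cst K)) (A B A' L R : FlatTerm sig) : Prop where
  greater : Greater sig L R
  valid : ValidEqn sig C s(A', B)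
  context : ∃ p q, A.enc = p ++ L.enc ++ q ∧ A'.enc = p ++ R.enc ++ q
  cost : Greater sig A B →
    WordLt C L.enc A.enc ∨ (L.enc = A.enc ∧ WordLt C R.enc B.enc)

/-- SIMPLIFY, COLLAPSE and COMPOSE share one shape, so redundancy need be checked only once. For a
replacement at the root of the larger side, the side condition of the rule gives the second
alternative of `cost`; for one strictly inside, the rule applied has a shorter left-hand side. -/
theorem Inference.cases {del keep add : Set (Sym2 (FlatTerm sig))}
    (h : Inference sig del keep add) (hd : ∀ e ∈ del, ValidEqn sig C e)
    (hk : ∀ e ∈ keep, ValidEqn sig C e) (hC : C.Finite) :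
    (del = ∅ ∧ ∀ e ∈ add, ValidEqn sig C e) ∨ (∃ s, del = {s(s, s)} ∧ add = ∅) ∨
    ∃ A B A' L R, IsReplacement C A B A' L R ∧ del = {s(A, B)} ∧ keep = {s(L, R)} ∧
      add = {s(A', B)} := by
  have ho := isReductionOrder_wordLt (F := F) hC
  cases h with
  | deduce g hg u₁ u₂ u₃ v w l₁ l₂ s t x y hu₁ hu₂ hu₃ hl₁ hl₂ hs ht hls hlt hx hy =>
    left
    refine ⟨rfl, ?_⟩
    obtain ⟨-, h₁, h₁'⟩ := validEqn_mk.1 (hk s(l₁, s) (by simp))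
    obtain ⟨-, h₂, h₂'⟩ := validEqn_mk.1 (hk s(l₂, t) (by simp))
    have hlen : 2 ≤ (u₁ ++ u₂).length := by
      have := List.length_pos_iff.2 hu₁
      have := List.length_pos_iff.2 hu₂
      simp only [List.length_append]; omega
    obtain rfl := eq_f_of_represents hg hl₁ hlen h₁
    rw [hl₁.admissible] at h₁
    rw [hl₂.admissible] at h₂
    rw [hs.admissible] at h₁'
    rw [ht.admissible] at h₂'
    simp only [Set.mem_singleton_iff, forall_eq]
    refine hx.validEqn hy ?_ ?_ <;> simp only [List.mem_append]
    · rintro c (hc | hc)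
      · exact h₁ c (by simp [hc])
      · exact h₂' c hc
    · rintro c (hc | hc)
      · exact h₁' c hc
      · exact h₂ c (by simp [hc])
  | simplify g hg u₁ u₂ u₃ w l₁ l₂ s t x hu₂ hl₁ hl₂ ht hlt hst hx =>
    right; right
    have hv := hd s(l₁, s) (by simp)
    obtain ⟨-, h₁, h₁'⟩ := validEqn_mk.1 hv
    obtain ⟨-, h₂, h₂'⟩ := validEqn_mk.1 (hk s(l₂, t) (by simp))
    obtain rfl := eq_f_of_represents hg hl₂ hu₂ h₂
    obtain ⟨v, hs⟩ := hv.represents_right hl₁ (by simp only [List.length_append]; omega)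
    refine ⟨l₁, s, x, l₂, t, ⟨hlt, ?_, ⟨u₁.map Sum.inl, u₃.map Sum.inl, ?_, ?_⟩, ?_⟩,
      rfl, rfl, rfl⟩
    · rw [hl₁.admissible] at h₁
      rw [hs.admissible] at h₁'
      rw [ht.admissible] at h₂'
      refine hx.validEqn hs ?_ h₁'
      simp only [List.mem_append]
      rintro c ((hc | hc) | hc)
      · exact h₁ c (by simp [hc])
      · exact h₂' c hc
      · exact h₁ c (by simp [hc])
    · simp [hl₁.enc hg, hl₂.enc hg]
    · simp [hx.enc hg, ht.enc hg]
    · intro _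
      rw [hl₁.enc hg, hl₂.enc hg]
      by_cases hu : u₁ ++ u₃ = []
      · have := hst hu
        rw [List.append_eq_nil_iff] at hu
        obtain ⟨rfl, rfl⟩ := hu
        exact .inr ⟨by simp, wordLt_of_greater h₁' h₂' this⟩
      · left
        refine .of_length_lt ?_
        have := List.length_pos_iff.2 hu
        simp only [List.length_append, List.length_map] at this ⊢
        omega
  | collapse s t u s' d hst hud hu hs htd =>
    right; right
    have hv := hd s(s, t) (by simp)
    obtain ⟨-, h₁, h₁'⟩ := validEqn_mk.1 hv
    obtain ⟨-, h₂, hdC⟩ := validEqn_mk.1 (hk s(u, .const d) (by simp))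
    cases hs with
    | root =>
      refine ⟨s, t, .const d, s, .const d, ⟨hud, ?_, ⟨[], [], by simp, by simp⟩, ?_⟩,
        rfl, rfl, rfl⟩
      · refine validEqn_mk.2 ⟨?_, hdC, h₁'⟩
        rcases hv.cases_of_greater hst with ⟨_, v, hu', ht⟩ | ⟨g, w, hw, c, -, -, rfl⟩
        · exact (Represents.constant d).isFlatEqn sig.f_assoc ht
        · exact isFlatEqn_const _ _
      · exact fun _ => .inr ⟨rfl, wordLt_of_greater h₁' hdC (htd rfl)⟩
    | arg g v w c hc h h' =>
      subst hc
      obtain ⟨p, q, hpq, henc⟩ := enc_arg g v w c h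
      refine ⟨.app g (v ++ c :: w) h, t, .app g (v ++ d :: w) h', .const c, .const d,
        ⟨hud, ?_, ⟨p, q, henc c h, henc d h'⟩, ?_⟩, rfl, rfl, rfl⟩
      · refine validEqn_mk.2 ⟨?_, ⟨h₁.1, ?_⟩, h₁'⟩
        · rcases hv.cases_of_greater hst with ⟨u', v', hu', ht⟩ | ⟨g, w, hw, c, -, -, rfl⟩
          · cases hu' with
            | app => exact (Represents.app _ h').isFlatEqn sig.f_assoc ht
          · exact isFlatEqn_const _ _
        · have h₃ := h₁.2
          simp only [List.mem_append, List.mem_cons] at h₃ ⊢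
          rintro x (hx | rfl | hx)
          · exact h₃ x (.inl hx)
          · exact hdC
          · exact h₃ x (.inr (.inr hx))
      · intro _
        left
        refine .of_length_lt ?_
        rw [henc c h]
        have := List.length_pos_iff.2 hpq
        simp only [List.length_append, enc_const, List.length_singleton] at this ⊢
        omega
  | compose t c d htc hcd =>
    right; right
    obtain ⟨-, h₁, h₁'⟩ := validEqn_mk.1 (hd s(t, .const c) (by simp))
    obtain ⟨-, h₂, hdC⟩ := validEqn_mk.1 (hk s(.const c, .const d) (by simp))
    -- COMPOSE rewrites the smaller side, so the rewritten side is listed first here and the premise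
    -- of `cost` is contradictory.
    refine ⟨.const c, t, .const d, .const c, .const d,
      ⟨.constant hcd, ?_, ⟨[], [], by simp, by simp⟩, ?_⟩, ?_, rfl, ?_⟩
    · rw [Sym2.eq_swap]
      exact validEqn_mk.2 ⟨isFlatEqn_const _ _, h₁, hdC⟩
    · intro h
      exact (isReductionOrder_asymm ho (wordLt_of_greater h₁ h₁' htc)
        (wordLt_of_greater h₁' h₁ h)).elim
    · rw [Sym2.eq_swap]
    · rw [Sym2.eq_swap]
  | delete s => exact .inr (.inl ⟨s, rfl, rfl⟩)

/-- The string rewriting system of the oriented equations of `U`. -/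
def rules (U : Set (Sym2 (FlatTerm sig))) (a b : List (Letter F K)) : Prop :=
  ∃ l r : FlatTerm sig, s(l, r) ∈ U ∧ Greater sig l r ∧ a = l.enc ∧ b = r.enc

/-- Write `A = plq`, `A' = prq`. If `A` is the larger side, the path `A → A' ↔ b` is cheap: its
first step has the same source `A` but a smaller rule by `hcost`, and the second has a source below
`A`. If `b` is the larger side, the path is `b → A' ← A`: its first step has the same source and
left-hand side but the smaller target `A'`, and its second step starts at `A`, below `b`. -/
theorem redundant_replace {Γ : Type*} {lt N : List Γ → List Γ → Prop} (ho : IsReductionOrder lt)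
    (hN : ∀ l r, N l r → lt r l) {l r p q b : List Γ} (hlr : N l r)
    (hb : p ++ r ++ q = b ∨ N (p ++ r ++ q) b ∨ N b (p ++ r ++ q))
    (hcost : lt b (p ++ l ++ q) → lt l (p ++ l ++ q) ∨ (l = p ++ l ++ q ∧ lt r b)) :
    (lt b (p ++ l ++ q) →
      ReflTransGen (CostStep lt N (p ++ l ++ q, p ++ l ++ q, b)) (p ++ l ++ q) b) ∧
    (lt (p ++ l ++ q) b → ReflTransGen (CostStep lt N (b, b, p ++ l ++ q)) b (p ++ l ++ q)) := by
  have hlt := ho.context p q (hN _ _ hlr)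
  constructor
  · intro h
    refine .head (b := p ++ r ++ q) ⟨p, q, l, r, hlr, ?_, .inl ⟨rfl, rfl⟩⟩ ?_
    · unfold CostLt
      simp only [Prod.lex_def]
      exact .inr ⟨trivial, hcost h⟩
    · rcases hb with hb | hb | hb
      · rw [hb]
      · refine .single ⟨[], [], _, _, hb, ?_, .inl ⟨by simp, by simp⟩⟩
        exact Prod.Lex.left _ _ (by simpa using hlt)
      · refine .single ⟨[], [], _, _, hb, ?_, .inr ⟨by simp, by simp⟩⟩
        exact Prod.Lex.left _ _ (by simpa using h)
  · intro h
    have hN' : N b (p ++ r ++ q) := by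
      rcases hb with hb | hb | hb
      · rw [hb] at hlt
        exact (isReductionOrder_asymm ho hlt h).elim
      · exact (isReductionOrder_asymm ho (hN _ _ hb) (ho.trans hlt h)).elim
      · exact hb
    refine .head (b := p ++ r ++ q) ⟨[], [], _, _, hN', ?_, .inl ⟨by simp, by simp⟩⟩
      (.single ⟨p, q, l, r, hlr, ?_, .inr ⟨rfl, rfl⟩⟩)
    · unfold CostLt
      simp only [Prod.lex_def]
      exact .inr ⟨by simp, .inr ⟨trivial, hlt⟩⟩
    · exact Prod.Lex.left _ _ h

theorem IsDerivation.valid {S₀ : Set (Sym2 (FlatTerm sig))} (hS : IsDerivation sig S₀ S)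
    (hC : C.Finite) (h₀ : ∀ e ∈ S₀, ValidEqn sig C e) (j : ℕ) : ∀ e ∈ S j, ValidEqn sig C e := by
  induction j with
  | zero => rw [hS.1]; exact h₀
  | succ j ih =>
    rcases hS.2 j with h | ⟨del, keep, add, hinf, hdel, hkeep, h⟩
    · rw [h]; exact ih
    rw [h]
    rintro e (he | he)
    · exact ih e he.1
    rcases hinf.cases (fun e he => ih e (hdel he)) (fun e he => ih e (hkeep he)) hC with
      ⟨-, hadd⟩ | ⟨s, -, rfl⟩ | ⟨A, B, A', L, R, hrep, -, -, rfl⟩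
    · exact hadd e he
    · exact he.elim
    · rw [Set.mem_singleton_iff.1 he]
      exact hrep.valid

theorem rules_mono {U V : Set (Sym2 (FlatTerm sig))} (h : U ⊆ V) {a b : List (Letter F K)}
    (hab : rules U a b) : rules V a b := by
  obtain ⟨l, r, hlr, h'⟩ := hab
  exact ⟨l, r, h hlr, h'⟩

theorem rules_or {U : Set (Sym2 (FlatTerm sig))} (hU : ∀ e ∈ U, ValidEqn sig C e)
    {s t : FlatTerm sig} (h : s(s, t) ∈ U) :
    s.enc = t.enc ∨ rules U s.enc t.enc ∨ rules U t.enc s.enc := by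
  rcases (hU _ h).greater_or with rfl | hg | hg
  · exact .inl rfl
  · exact .inr (.inl ⟨s, t, h, hg, rfl, rfl⟩)
  · exact .inr (.inr ⟨t, s, by rwa [Sym2.eq_swap], hg, rfl, rfl⟩)

theorem wordLt_of_rules {U : Set (Sym2 (FlatTerm sig))} (hU : ∀ e ∈ U, ValidEqn sig C e)
    {a b : List (Letter F K)} (h : rules U a b) : WordLt C b a := by
  obtain ⟨l, r, hlr, hg, rfl, rfl⟩ := h
  obtain ⟨-, hl, hr⟩ := validEqn_mk.1 (hU _ hlr)
  exact wordLt_of_greater hl hr hg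

/-- An equation that does not persist is removed at some stage. Its sides are strictly ordered, so
DELETE did not remove it, and the removal was a replacement. -/
theorem IsDerivation.redundant {S₀ : Set (Sym2 (FlatTerm sig))} (hS : IsDerivation sig S₀ S)
    (hC : C.Finite) (hv : ∀ e ∈ allEqns S, ValidEqn sig C e) {a b : List (Letter F K)}
    (h : rules (allEqns S) a b) (hP : ¬ rules (persisting S) a b) :
    ReflTransGen (CostStep (WordLt C) (rules (allEqns S)) (a, a, b)) a b := by
  obtain ⟨l, r, hlr, hg, rfl, rfl⟩ := h
  have ho := isReductionOrder_wordLt (F := F) hC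
  have hnot : s(l, r) ∉ persisting S := fun h => hP ⟨l, r, h, hg, rfl, rfl⟩
  obtain ⟨k, hk⟩ := Set.mem_iUnion.1 hlr
  obtain ⟨j, hj, hj'⟩ : ∃ j, s(l, r) ∈ S j ∧ s(l, r) ∉ S (j + 1) := by
    by_contra! hcon
    refine hnot ⟨k, fun j hj => ?_⟩
    induction j, hj using Nat.le_induction with
    | base => exact hk
    | succ j _ ih => exact hcon j ih
  rcases hS.2 j with h | ⟨del, keep, add, hinf, hdel, hkeep, h⟩
  · exact absurd (h ▸ hj) hj'
  have hmem : ∀ i, S i ⊆ allEqns S := Set.subset_iUnion S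
  have hlt := wordLt_of_rules hv ⟨l, r, hlr, hg, rfl, rfl⟩
  have hed : s(l, r) ∈ del := by
    by_contra hcon
    exact hj' (h ▸ .inl ⟨hj, hcon⟩)
  rcases hinf.cases (fun e he => hv e (hmem j (hdel he))) (fun e he => hv e (hmem j (hkeep he)))
    hC with ⟨rfl, -⟩ | ⟨s, rfl, -⟩ | ⟨A, B, A', L, R, hrep, rfl, rfl, rfl⟩
  · exact hed.elim
  · rw [Set.mem_singleton_iff, Sym2.eq_iff] at hed
    rcases hed with ⟨rfl, rfl⟩ | ⟨rfl, rfl⟩ <;>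
      exact (isReductionOrder_asymm ho hlt hlt).elim
  · have hLR : rules (allEqns S) L.enc R.enc :=
      ⟨L, R, hmem j (hkeep rfl), hrep.greater, rfl, rfl⟩
    have hA'B : s(A', B) ∈ allEqns S := hmem (j + 1) (h ▸ .inr rfl)
    obtain ⟨p, q, hA, hA'⟩ := hrep.context
    have hb := rules_or hv hA'B
    have hcost : WordLt C B.enc A.enc →
        WordLt C L.enc A.enc ∨ (L.enc = A.enc ∧ WordLt C R.enc B.enc) := by
      intro hBA
      rcases (hv _ (hmem j (hdel rfl))).greater_or with rfl | hg' | hg'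
      · exact (isReductionOrder_asymm ho hBA hBA).elim
      · exact hrep.cost hg'
      · have hBA' := wordLt_of_rules hv
          ⟨B, A, by rw [Sym2.eq_swap]; exact hmem j (hdel rfl), hg', rfl, rfl⟩
        exact (isReductionOrder_asymm ho hBA hBA').elim
    rw [hA'] at hb
    rw [hA] at hcost
    have key := redundant_replace ho (fun _ _ h => wordLt_of_rules hv h) hLR hb hcost
    rw [← hA] at key
    rw [Set.mem_singleton_iff, Sym2.eq_iff] at hed
    rcases hed with ⟨rfl, rfl⟩ | ⟨rfl, rfl⟩
    · exact key.1 hlt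
    · exact key.2 hlt

/-- Persisting premises enable the inference from some stage on, so fairness applies it. A deleted
premise is still present right after a late application, which is possible only if the inference
adds it back. -/
theorem IsFair.mem_add (hf : IsFair sig S) {del keep add : Set (Sym2 (FlatTerm sig))}
    (hinf : Inference sig del keep add) (hfin : del.Finite ∧ keep.Finite)
    (hdel : del ⊆ persisting S) (hkeep : keep ⊆ persisting S) :
    add ⊆ allEqns S ∧ del ⊆ add := by
  obtain ⟨k, hk⟩ := exists_stage (hfin.1.union hfin.2) (Set.union_subset hdel hkeep)
  obtain ⟨j, hj, -, -, h⟩ := hf del keep add hinf k fun j hj => Set.union_subset_iff.1 (hk j hj)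
  refine ⟨fun e he => Set.mem_iUnion.2 ⟨j + 1, h ▸ .inr he⟩, fun e he => ?_⟩
  have hmem : e ∈ S (j + 1) := hk (j + 1) ((hj ⟨e, he⟩).trans (Nat.le_succ j)) (.inl he)
  rw [h] at hmem
  exact hmem.resolve_left fun hcon => hcon.2 he

theorem IsFair.eq_of_inference (hf : IsFair sig S) {e e' d : Sym2 (FlatTerm sig)}
    (hinf : Inference sig {e} {d} {e'}) (he : e ∈ persisting S) (hd : d ∈ persisting S) :
    e = e' :=
  (hf.mem_add hinf ⟨Set.finite_singleton _, Set.finite_singleton _⟩ (by simpa using he)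
    (by simpa using hd)).2 rfl

/-- If `r₁ ≻ r₂`, the rule `l → r₂` would replace `l ≈ r₁` by `r₂ ≈ r₁`; the inequality is just the
side condition for rewriting at the root. A replacement between persisting equations must reproduce
its premise, and here it cannot. -/
theorem IsFair.eq_rhs (hf : IsFair sig S) (hC : C.Finite)
    (hv : ∀ e ∈ allEqns S, ValidEqn sig C e) {l r₁ r₂ : FlatTerm sig}
    (h₁ : s(l, r₁) ∈ persisting S) (h₂ : s(l, r₂) ∈ persisting S) (hg₁ : Greater sig l r₁)
    (hg₂ : Greater sig l r₂) : r₁ = r₂ := by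
  have ho := isReductionOrder_wordLt (F := F) hC
  have key : ∀ r₁ r₂, s(l, r₁) ∈ persisting S → s(l, r₂) ∈ persisting S → Greater sig l r₁ →
      Greater sig l r₂ → ¬ Greater sig r₁ r₂ := by
    intro r₁ r₂ h₁ h₂ hg₁ hg₂ hg
    have hv₁ := hv _ (persisting_subset h₁)
    have hv₂ := hv _ (persisting_subset h₂)
    obtain ⟨-, hl, hr₁⟩ := validEqn_mk.1 hv₁
    obtain ⟨-, -, hr₂⟩ := validEqn_mk.1 hv₂
    have hinf : Inference sig {s(l, r₁)} {s(l, r₂)} {s(r₂, r₁)} := by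
      rcases hv₂.cases_of_greater hg₂ with ⟨u, v, hu, hv'⟩ | ⟨g, w, hw, c, hg', rfl, rfl⟩
      · rcases length_eq_one_or hu.ne_nil with ⟨c, rfl⟩ | hlen
        · obtain rfl := hu.eq_const sig.f_assoc
          cases hg₂ with
          | constant hcd =>
            exact .collapse _ _ _ _ _ hg₁ (.constant hcd) (fun h => h) .root fun _ => hg
        · exact .simplify sig.f sig.f_assoc [] u [] v l l r₁ r₂ r₂ hlen (by simpa using hu) hu hv'
            hg₂ (fun _ => hg) (by simpa using hv')
      · exact .collapse _ _ _ _ _ hg₁ hg₂ hg' .root fun _ => hg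
    have he := hf.eq_of_inference hinf h₁ h₂
    rcases Sym2.eq_iff.1 he with ⟨rfl, -⟩ | ⟨rfl, -⟩
    · exact isReductionOrder_asymm ho (wordLt_of_greater hl hl hg₂)
        (wordLt_of_greater hl hl hg₂)
    · exact isReductionOrder_asymm ho (wordLt_of_greater hl hl hg₁)
        (wordLt_of_greater hl hl hg₁)
  have hw : r₁ = r₂ ∨ Greater sig r₁ r₂ ∨ Greater sig r₂ r₁ := by
    have hv₁ := hv _ (persisting_subset h₁)
    have hv₂ := hv _ (persisting_subset h₂)
    have hrep : ∀ r, ValidEqn sig C s(l, r) → Greater sig l r → ∃ v, Represents sig.f v r := by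
      intro r hv hg
      rcases hv.cases_of_greater hg with ⟨_, v, -, hv'⟩ | ⟨g, w, hw, c, -, -, rfl⟩
      · exact ⟨v, hv'⟩
      · exact ⟨_, .constant c⟩
    obtain ⟨v₁, hr₁⟩ := hrep _ hv₁ hg₁
    obtain ⟨v₂, hr₂⟩ := hrep _ hv₂ hg₂
    exact hr₁.greater_or hr₂
  rcases hw with hw | hw | hw
  · exact hw
  · exact (key _ _ h₁ h₂ hg₁ hg₂ hw).elim
  · exact (key _ _ h₂ h₁ hg₂ hg₁ hw).elim

/-- A proper factor would enable a SIMPLIFY (factor of length at least two) or a COLLAPSE (single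
constant) that produces a smaller equation, against `eq_of_inference`. Factors that do not come from
subterms are excluded by the separators, by the symbol letter at the front and by the fixed arities.
-/
theorem IsFair.no_proper_factor (hf : IsFair sig S) (hC : C.Finite)
    (hv : ∀ e ∈ allEqns S, ValidEqn sig C e) {l₁ r₁ l₂ r₂ : FlatTerm sig}
    (h₁ : s(l₁, r₁) ∈ persisting S) (h₂ : s(l₂, r₂) ∈ persisting S) (hg₁ : Greater sig l₁ r₁)
    (hg₂ : Greater sig l₂ r₂) {p q : List (Letter F K)} (he : l₁.enc = p ++ l₂.enc ++ q) :
    p ++ q = [] := by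
  by_contra hpq
  have ho := isReductionOrder_wordLt (F := F) hC
  have hv₁ := hv _ (persisting_subset h₁)
  have hv₂ := hv _ (persisting_subset h₂)
  obtain ⟨-, hl₁, hr₁⟩ := validEqn_mk.1 hv₁
  obtain ⟨-, hl₂, hr₂⟩ := validEqn_mk.1 hv₂
  suffices ∃ x : FlatTerm sig, Inference sig {s(l₁, r₁)} {s(l₂, r₂)} {s(x, r₁)} ∧
      x.enc = p ++ r₂.enc ++ q by
    obtain ⟨x, hinf, hx⟩ := this
    have hlt : WordLt C x.enc l₁.enc := by
      rw [he, hx]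
      exact ho.context p q (wordLt_of_greater hl₂ hr₂ hg₂)
    have hee := hf.eq_of_inference hinf h₁ h₂
    have : l₁ = x := by
      rcases Sym2.eq_iff.1 hee with ⟨h, -⟩ | ⟨h, h'⟩
      · exact h
      · exact h.trans h'
    rw [← this] at hlt
    exact isReductionOrder_asymm ho hlt hlt
  rcases hv₂.cases_of_greater hg₂ with ⟨u₂, v₂, hu₂, hv₂'⟩ | ⟨g, w, hw, c, hg, rfl, rfl⟩
  · rw [hu₂.enc sig.f_assoc] at he
    rw [hv₂'.enc sig.f_assoc]
    rcases admissible_cases hl₁ with ⟨u₁, hu₁⟩ | ⟨g, w, hw, hg, rfl⟩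
    · rw [hu₁.enc sig.f_assoc] at he
      obtain ⟨ab, b, rfl, hab, rfl⟩ := List.map_eq_append_iff.1 he
      obtain ⟨a, u, rfl, rfl, hu⟩ := List.map_eq_append_iff.1 hab
      obtain rfl := List.map_injective_iff.2 Sum.inl_injective hu
      have hab' : a ++ b ≠ [] := by
        intro h
        rw [List.append_eq_nil_iff] at h
        simp [h.1, h.2] at hpq
      have hlab := List.length_pos_iff.2 hab'
      have hlu := List.length_pos_iff.2 hu₂.ne_nil
      have hlv := List.length_pos_iff.2 hv₂'.ne_nil
      obtain ⟨x, hx⟩ := exists_represents (sig := sig) sig.f_assoc (u := a ++ v₂ ++ b) (by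
        intro h
        simp only [List.append_eq_nil_iff] at h
        exact hv₂'.ne_nil h.1.2)
      refine ⟨x, ?_, by simp [hx.enc sig.f_assoc]⟩
      rcases length_eq_one_or hu₂.ne_nil with ⟨c, rfl⟩ | hlen
      · obtain rfl := hu₂.eq_const sig.f_assoc
        cases hg₂ with
        | @constant _ d hcd =>
          cases hv₂' with
          | constant =>
            simp only [List.append_assoc, List.singleton_append] at hu₁ hx
            simp only [List.length_append] at hlab
            obtain ⟨hA, rfl⟩ := hu₁.eq_app (by
              simp only [List.length_append, List.length_cons]; omega)
            obtain ⟨hA', rfl⟩ := hx.eq_app (by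
              simp only [List.length_append, List.length_cons]; omega)
            refine .collapse _ _ _ _ d hg₁ (.constant hcd) (fun h => h)
              (.arg sig.f a b c rfl hA hA') ?_
            intro h
            cases h
      · exact .simplify sig.f sig.f_assoc a _ b v₂ l₁ l₂ r₁ r₂ x hlen hu₁ hu₂ hv₂' hg₂
          (fun h => absurd h hab') hx
    · rw [enc_app hg] at he
      rcases length_eq_one_or hu₂.ne_nil with ⟨c, rfl⟩ | hlen
      · obtain rfl := hu₂.eq_const sig.f_assoc
        cases hg₂ with
        | @constant _ d hcd =>
          cases hv₂' with
          | constant =>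
            obtain ⟨a, b, rfl, rfl, rfl⟩ := inl_prefix_of_append_cons
              (p := p) (c := c) (q := q) (by simpa using he)
            have hA' : sig.IsArity g (a ++ d :: b).length := by simpa using hw
            refine ⟨.app g (a ++ d :: b) hA', ?_, by simp [enc_app hg, separated_append]⟩
            refine .collapse _ _ _ _ d hg₁ (.constant hcd) (fun h => h) (.arg g a b c rfl hw hA') ?_
            intro h
            cases h
      -- Two consecutive constants cannot occur in the code of a non-associative application, where
      -- a separator follows every constant.
      · exfalso
        rcases u₂ with _ | ⟨c, _ | ⟨d, u⟩⟩
        · simp at hlen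
        · simp at hlen
        · obtain ⟨a, b, rfl, rfl, hq⟩ := inl_prefix_of_append_cons
            (p := p) (c := c) (q := Sum.inl d :: (u.map Sum.inl ++ q)) (by simpa using he)
          simp at hq
  · exfalso
    rw [enc_app hg] at he
    rcases admissible_cases hl₁ with ⟨u₁, hu₁⟩ | ⟨g', w', hw', hg', rfl⟩
    · have : (Sum.inr (some g) : Letter F K) ∈ u₁.map Sum.inl := by
        rw [← hu₁.enc sig.f_assoc, he]
        simp
      simp at this
    · rw [enc_app hg'] at he
      rcases p with _ | ⟨x, p⟩
      · simp only [List.nil_append, List.cons_append, List.cons.injEq, Sum.inr.injEq,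
          Option.some.injEq] at he
        obtain ⟨rfl, he⟩ := he
        have := congrArg List.length he
        rw [List.length_append, length_separated, length_separated, hw.2 hg, hw'.2 hg] at this
        have hq : q = [] := List.length_eq_zero_iff.1 (by omega)
        exact hpq (by simp [hq])
      · simp only [List.cons_append, List.cons.injEq] at he
        refine symbol_notMem_separated g w' ?_
        rw [he.2]
        simp

/-- Between strings the critical pair is produced by DEDUCE. A code `g(w)` takes part in no proper
overlap: a proper suffix of it ends in a separator and contains no symbol letter, whereas a
left-hand side either has no separator or begins with a symbol letter. -/
theorem IsFair.overlap (hf : IsFair sig S)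
    (hv : ∀ e ∈ allEqns S, ValidEqn sig C e) {l₁ r₁ l₂ r₂ : FlatTerm sig}
    (h₁ : s(l₁, r₁) ∈ persisting S) (h₂ : s(l₂, r₂) ∈ persisting S) (hg₁ : Greater sig l₁ r₁)
    (hg₂ : Greater sig l₂ r₂) {p q t : List (Letter F K)} (hp : p ≠ []) (hq : q ≠ []) (ht : t ≠ [])
    (he₁ : l₁.enc = p ++ q) (he₂ : l₂.enc = q ++ t) :
    p ++ r₂.enc = r₁.enc ++ t ∨ rules (allEqns S) (p ++ r₂.enc) (r₁.enc ++ t) ∨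
      rules (allEqns S) (r₁.enc ++ t) (p ++ r₂.enc) := by
  have hv₁ := hv _ (persisting_subset h₁)
  have hv₂ := hv _ (persisting_subset h₂)
  rcases hv₁.cases_of_greater hg₁ with ⟨u₁, v₁, hu₁, hv₁'⟩ | ⟨g, w, hw, c, hg, rfl, rfl⟩
  · rw [hu₁.enc sig.f_assoc] at he₁
    obtain ⟨a, b, rfl, rfl, rfl⟩ := List.map_eq_append_iff.1 he₁
    rcases hv₂.cases_of_greater hg₂ with ⟨u₂, v₂, hu₂, hv₂'⟩ | ⟨g, w, hw, c, hg, rfl, rfl⟩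
    · rw [hu₂.enc sig.f_assoc] at he₂
      obtain ⟨b', c, rfl, hb', rfl⟩ := List.map_eq_append_iff.1 he₂
      obtain rfl := List.map_injective_iff.2 Sum.inl_injective hb'
      simp only [ne_eq, List.map_eq_nil_iff] at hp hq ht
      obtain ⟨x, hx⟩ := exists_represents (sig := sig) sig.f_assoc (u := a ++ v₂) (by simp [hp])
      obtain ⟨y, hy⟩ := exists_represents (sig := sig) sig.f_assoc (u := v₁ ++ c) (by simp [ht])
      have hinf : Inference sig ∅ {s(l₁, r₁), s(l₂, r₂)} {s(x, y)} :=
        .deduce sig.f sig.f_assoc a b' c v₁ v₂ l₁ l₂ r₁ r₂ x y hp hq ht hu₁ hu₂ hv₁' hv₂' hg₁ hg₂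
          hx hy
      have hmem := (hf.mem_add hinf ⟨Set.finite_empty, by simp⟩ (Set.empty_subset _) (by
        rintro e (rfl | rfl) <;> assumption)).1 rfl
      have := rules_or hv hmem
      rw [hx.enc sig.f_assoc, hy.enc sig.f_assoc] at this
      rw [hv₁'.enc sig.f_assoc, hv₂'.enc sig.f_assoc]
      simpa using this
    · exfalso
      rw [enc_app hg] at he₂
      rcases b with _ | ⟨c, b⟩
      · simp at hq
      · simp at he₂
  · exfalso
    rw [enc_app hg] at he₁
    rcases p with _ | ⟨x, p⟩
    · exact hp rfl
    simp only [List.cons_append, List.cons.injEq] at he₁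
    have hnone : (Sum.inr none : Letter F K) ∈ q := by
      obtain ⟨w', d, rfl⟩ : ∃ w' d, w = w' ++ [d] := by
        rcases List.eq_nil_or_concat w with rfl | ⟨w', d, rfl⟩
        · exact absurd (pos_of_isArity hw) (by simp)
        · exact ⟨w', d, by simp⟩
      have he := he₁.2
      obtain ⟨q', z, rfl⟩ : ∃ q' z, q = q' ++ [z] := by
        rcases List.eq_nil_or_concat q with rfl | ⟨w', d, rfl⟩
        · exact absurd rfl hq
        · exact ⟨w', d, by simp⟩
      rw [separated_append, separated_cons, separated_nil,
        show separated w' ++ [Sum.inl d, Sum.inr none] =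
          (separated w' ++ [Sum.inl d]) ++ [Sum.inr none] by simp, ← List.append_assoc] at he
      have := (List.append_inj' he rfl).2
      simp only [List.cons.injEq, and_true] at this
      rw [this]
      simp
    have hsym : ∀ g, (Sum.inr (some g) : Letter F K) ∉ q := by
      intro g' hg'
      refine symbol_notMem_separated g' w ?_
      rw [he₁.2]
      simp [hg']
    have hmem : (Sum.inr none : Letter F K) ∈ l₂.enc := by rw [he₂]; simp [hnone]
    rcases hv₂.cases_of_greater hg₂ with ⟨u₂, v₂, hu₂, hv₂'⟩ | ⟨g', w', hw', c, hg', rfl, rfl⟩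
    · rw [hu₂.enc sig.f_assoc] at hmem
      simp at hmem
    · rw [enc_app hg'] at he₂
      rcases q with _ | ⟨z, q⟩
      · exact hq rfl
      · simp only [List.cons_append, List.cons.injEq] at he₂
        exact hsym g' (by rw [he₂.1]; simp)

/-- A fair derivation is a completion process. -/
theorem IsFair.isCompletion {S₀ : Set (Sym2 (FlatTerm sig))} (hS : IsDerivation sig S₀ S)
    (hf : IsFair sig S) (hC : C.Finite) (hv : ∀ e ∈ allEqns S, ValidEqn sig C e) :
    IsCompletion (WordLt C) (rules (allEqns S)) (rules (persisting S)) where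
  le := rules_mono persisting_subset
  decreasing := wordLt_of_rules hv
  redundant := hS.redundant hC hv
  overlap := by
    rintro p q t _ _ hp hq ht ⟨l₁, r₁, h₁, hg₁, he₁, rfl⟩ ⟨l₂, r₂, h₂, hg₂, he₂, rfl⟩
    exact hf.overlap hv h₁ h₂ hg₁ hg₂ hp hq ht he₁.symm he₂.symm
  factor := by
    rintro p _ q _ _ ⟨l₁, r₁, h₁, hg₁, he₁, rfl⟩ ⟨l₂, r₂, h₂, hg₂, rfl, rfl⟩
    have hpq := hf.no_proper_factor hC hv h₁ h₂ hg₁ hg₂ he₁.symm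
    rw [List.append_eq_nil_iff] at hpq
    obtain ⟨rfl, rfl⟩ := hpq
    obtain ⟨-, hl₁, -⟩ := validEqn_mk.1 (hv _ (persisting_subset h₁))
    obtain ⟨-, hl₂, -⟩ := validEqn_mk.1 (hv _ (persisting_subset h₂))
    obtain rfl := enc_injective hl₁ hl₂ (by simpa using he₁.symm)
    exact ⟨rfl, rfl, by rw [hf.eq_rhs hC hv h₁ h₂ hg₁ hg₂]⟩

end GroupSignature

/-! ### Termination of the completion -/

namespace GroupSignature

open StringCompletion Relation FlatTerm

variable {F K : Type*} {sig : GroupSignature F K} {C : Set (Cst K)}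

/-! #### From strings back to terms -/

theorem FlatTerm.toTerm_eq_appList {g : F} {w : List (Cst K)} {h : sig.IsArity g w.length}
    {l : List (Term sig (Cst K))} (hl : w.map Term.const = l) (h' : sig.IsArity g l.length) :
    (FlatTerm.app g w h).toTerm = Term.appList g l h' := by
  subst hl
  exact toTerm_app g w h h'

theorem Represents.assocEq_context {g : F} (hg : g ∈ sig.assoc) {p u q : List (Cst K)}
    {l t : FlatTerm sig} (hl : Represents g u l) (ht : Represents g (p ++ u ++ q) t)
    (hpq : p ++ q ≠ [])
    (h : sig.IsArity g (p.map Term.const ++ l.toTerm :: q.map Term.const :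
      List (Term sig (Cst K))).length) :
    AssocEq sig t.toTerm (Term.appList g (p.map Term.const ++ l.toTerm :: q.map Term.const) h) := by
  have hpq' := List.length_pos_iff.2 hpq
  have hu' := List.length_pos_iff.2 hl.ne_nil
  obtain ⟨ht', rfl⟩ := ht.eq_app (by simp only [List.length_append] at hpq' ⊢; omega)
  rcases length_eq_one_or hl.ne_nil with ⟨c, rfl⟩ | hlen
  · obtain rfl := hl.eq_const hg
    rw [toTerm_eq_appList (l := p.map Term.const ++ Term.const c :: q.map Term.const) (by simp) h]
    exact .refl _
  · obtain ⟨hl', rfl⟩ := hl.eq_app hlen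
    have hy : sig.IsArity g (u.map Term.const : List (Term sig (Cst K))).length := by
      simpa using hl'
    have h₃ : sig.IsArity g (p.map Term.const ++ (u.map Term.const ++ q.map Term.const) :
        List (Term sig (Cst K))).length := by
      simpa using ht'
    rw [toTerm_eq_appList (by simp) h₃]
    have he : (FlatTerm.app g u hl').toTerm = Term.appList g (u.map Term.const) hy :=
      toTerm_app g u hl' hy
    revert h
    rw [he]
    exact fun h => (AssocEq.splice hg _ _ _ hy h h₃).symm

/-- Associativity isolates the factor `u` as a subterm, the rule acts on this subterm, and
associativity flattens the result. -/
theorem rewriteMod_context {g : F} (hg : g ∈ sig.assoc) {p u v q : List (Cst K)}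
    {l r t t' : FlatTerm sig} (hl : Represents g u l) (hr : Represents g v r)
    (ht : Represents g (p ++ u ++ q) t) (ht' : Represents g (p ++ v ++ q) t')
    {R : Term sig (Cst K) → Term sig (Cst K) → Prop} (hR : R l.toTerm r.toTerm) :
    RewriteMod R t.toTerm t'.toTerm := by
  by_cases hpq : p ++ q = []
  · rw [List.append_eq_nil_iff] at hpq
    obtain ⟨rfl, rfl⟩ := hpq
    obtain rfl := hl.unique hg (by simpa using ht)
    obtain rfl := hr.unique hg (by simpa using ht')
    exact ⟨_, _, .refl _, .root hR, .refl _⟩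
  · have h : ∀ a : Term sig (Cst K), sig.IsArity g
        (p.map Term.const ++ a :: q.map Term.const : List (Term sig (Cst K))).length := by
      intro a
      refine isArity_of_assoc hg ?_
      have hpq' := List.length_pos_iff.2 hpq
      simp only [List.length_append, List.length_cons, List.length_map] at hpq' ⊢
      omega
    exact ⟨_, _, hl.assocEq_context hg ht hpq (h _), Rewrite.appList g _ _ (.root hR) _ _,
      (hr.assocEq_context hg ht' hpq (h _)).symm⟩

variable [LinearOrder K]

/-- String steps never leave the codes of flat terms and correspond to steps of `R/A`. Hence
confluence proved for strings carries over to terms. -/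
theorem exists_rewriteMod {U : Set (Sym2 (FlatTerm sig))} (hU : ∀ e ∈ U, ValidEqn sig C e)
    {t : FlatTerm sig} (ht : t.Admissible C) {y : List (Letter F K)}
    (h : Step (rules U) t.enc y) :
    ∃ t' : FlatTerm sig, t'.Admissible C ∧ t'.enc = y ∧
      RewriteMod (orient U) t.toTerm t'.toTerm := by
  obtain ⟨p, q, _, _, ⟨l, r, hlr, hg, rfl, rfl⟩, he, rfl⟩ := h
  have hR : orient U l.toTerm r.toTerm := ⟨l, r, hlr, hg, rfl, rfl⟩
  have hv := hU _ hlr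
  obtain ⟨-, hlC, hrC⟩ := validEqn_mk.1 hv
  rcases hv.cases_of_greater hg with ⟨u, v, hu, hv'⟩ | ⟨g, w, hw, c, hg', rfl, rfl⟩
  · rw [hu.enc sig.f_assoc] at he
    rw [hv'.enc sig.f_assoc]
    rcases admissible_cases ht with ⟨z, hz⟩ | ⟨g, w, hw, hg', rfl⟩
    · rw [hz.enc sig.f_assoc] at he
      obtain ⟨ab, b, rfl, hab, rfl⟩ := List.map_eq_append_iff.1 he
      obtain ⟨a, u', rfl, rfl, hu'⟩ := List.map_eq_append_iff.1 hab
      obtain rfl := List.map_injective_iff.2 Sum.inl_injective hu'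
      obtain ⟨x, hx⟩ := exists_represents (sig := sig) sig.f_assoc (u := a ++ v ++ b) (by
        intro h
        simp only [List.append_eq_nil_iff] at h
        exact hv'.ne_nil h.1.2)
      refine ⟨x, hx.admissible.2 ?_, by simp [hx.enc sig.f_assoc],
        rewriteMod_context sig.f_assoc hu hv' hz hx hR⟩
      rw [hz.admissible] at ht
      rw [hv'.admissible] at hrC
      simp only [List.mem_append] at ht ⊢
      rintro c ((hc | hc) | hc)
      · exact ht c (.inl (.inl hc))
      · exact hrC c hc
      · exact ht c (.inr hc)
    · rw [enc_app hg'] at he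
      rcases length_eq_one_or hu.ne_nil with ⟨c, rfl⟩ | hlen
      · obtain rfl := hu.eq_const sig.f_assoc
        cases hg with
        | @constant _ d hcd =>
          cases hv' with
          | constant =>
            obtain ⟨a, b, rfl, rfl, rfl⟩ := inl_prefix_of_append_cons
              (p := p) (c := c) (q := q) (by simpa using he)
            have hA' : sig.IsArity g (a ++ d :: b).length := by simpa using hw
            refine ⟨.app g (a ++ d :: b) hA', ⟨ht.1, ?_⟩,
              by simp [enc_app hg', separated_append], ?_⟩
            · have ht' := ht.2
              simp only [List.mem_append, List.mem_cons] at ht' ⊢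
              rintro x (hx | rfl | hx)
              · exact ht' x (.inl hx)
              · exact hrC
              · exact ht' x (.inr (.inr hx))
            · refine ⟨_, _, .refl _, ?_, .refl _⟩
              rw [toTerm_eq_appList
                  (l := a.map Term.const ++ Term.const c :: b.map Term.const) (by simp)
                  (by simpa using hw),
                toTerm_eq_appList
                  (l := a.map Term.const ++ Term.const d :: b.map Term.const) (by simp)
                  (by simpa using hA')]
              exact Rewrite.appList g _ _ (.root hR) _ _
      · exfalso
        rcases u with _ | ⟨c, _ | ⟨d, u⟩⟩
        · simp at hlen
        · simp at hlen
        · obtain ⟨a, b, rfl, rfl, hq⟩ := inl_prefix_of_append_cons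
            (p := p) (c := c) (q := Sum.inl d :: (u.map Sum.inl ++ q)) (by simpa using he)
          simp at hq
  · rcases admissible_cases ht with ⟨z, hz⟩ | ⟨g', w', hw', hg'', rfl⟩
    · exfalso
      have : (Sum.inr (some g) : Letter F K) ∈ z.map Sum.inl := by
        rw [← hz.enc sig.f_assoc, he, enc_app hg']
        simp
      simp at this
    · have hpq : p = [] ∧ q = [] := by
        rw [enc_app hg', enc_app hg''] at he
        rcases p with _ | ⟨x, p⟩
        · simp only [List.nil_append, List.cons_append, List.cons.injEq, Sum.inr.injEq,
            Option.some.injEq] at he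
          obtain ⟨rfl, he⟩ := he
          have := congrArg List.length he
          rw [List.length_append, length_separated, length_separated, hw.2 hg', hw'.2 hg'] at this
          exact ⟨rfl, List.length_eq_zero_iff.1 (by omega)⟩
        · exfalso
          simp only [List.cons_append, List.cons.injEq] at he
          refine symbol_notMem_separated g w' ?_
          rw [he.2]
          simp
      obtain ⟨rfl, rfl⟩ := hpq
      rw [enc_injective ht hlC (by simpa using he)]
      exact ⟨.const c, hrC, by simp, _, _, .refl _, .root hR, .refl _⟩

theorem exists_rewriteMod_path {U : Set (Sym2 (FlatTerm sig))} (hU : ∀ e ∈ U, ValidEqn sig C e)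
    {t : FlatTerm sig} (ht : t.Admissible C) {y : List (Letter F K)}
    (h : ReflTransGen (Step (rules U)) t.enc y) :
    ∃ t' : FlatTerm sig, t'.Admissible C ∧ t'.enc = y ∧
      ReflTransGen (RewriteMod (orient U)) t.toTerm t'.toTerm := by
  induction h with
  | refl => exact ⟨t, ht, rfl, .refl⟩
  | tail _ hs ih =>
    obtain ⟨t₁, ht₁, rfl, hp⟩ := ih
    obtain ⟨t₂, ht₂, he, hs'⟩ := exists_rewriteMod hU ht₁ hs
    exact ⟨t₂, ht₂, he, hp.tail hs'⟩

/-- Two strings are connected by the equations of `U`. -/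
def Connected (U : Set (Sym2 (FlatTerm sig))) : List (Letter F K) → List (Letter F K) → Prop :=
  ReflTransGen fun x y => Step (rules U) x y ∨ Step (rules U) y x

namespace Connected

variable {U : Set (Sym2 (FlatTerm sig))} {a b c : List (Letter F K)}

theorem symm (h : Connected U a b) : Connected U b a := by
  induction h with
  | refl => exact .refl
  | tail _ hs ih => exact .head hs.symm ih

theorem trans (h₁ : Connected U a b) (h₂ : Connected U b c) : Connected U a c :=
  ReflTransGen.trans h₁ h₂

theorem context (h : Connected U a b) (p q : List (Letter F K)) :
    Connected U (p ++ a ++ q) (p ++ b ++ q) := by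
  induction h with
  | refl => exact .refl
  | tail _ hs ih => exact ih.tail (hs.imp (fun h => h.context p q) fun h => h.context p q)

theorem of_mem (hU : ∀ e ∈ U, ValidEqn sig C e) {s t : FlatTerm sig} (h : s(s, t) ∈ U) :
    Connected U s.enc t.enc := by
  rcases rules_or hU h with h | h | h
  · rw [h]; exact .refl
  · exact .single (.inl ⟨[], [], _, _, h, by simp, by simp⟩)
  · exact .single (.inr ⟨[], [], _, _, h, by simp, by simp⟩)

end Connected

variable {S : ℕ → Set (Sym2 (FlatTerm sig))} {S₀ : Set (Sym2 (FlatTerm sig))}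

theorem IsFair.joinable (hS : IsDerivation sig S₀ S) (hf : IsFair sig S) (hC : C.Finite)
    (hv : ∀ e ∈ allEqns S, ValidEqn sig C e) {a b : List (Letter F K)}
    (h : Connected (allEqns S) a b) : Joinable (Step (rules (persisting S))) a b :=
  joinable_of_connected (isReductionOrder_wordLt hC) (hf.isCompletion hS hC hv) h

theorem IsFair.joinableMod (hS : IsDerivation sig S₀ S) (hf : IsFair sig S) (hC : C.Finite)
    (hv : ∀ e ∈ allEqns S, ValidEqn sig C e) {s t : FlatTerm sig} (h : s(s, t) ∈ allEqns S) :
    JoinableMod (orient (persisting S)) s.toTerm t.toTerm := by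
  obtain ⟨-, hs, ht⟩ := validEqn_mk.1 (hv _ h)
  obtain ⟨z, hz₁, hz₂⟩ := hf.joinable hS hC hv (Connected.of_mem hv h)
  have hvP : ∀ e ∈ persisting S, ValidEqn sig C e := fun e he => hv e (persisting_subset he)
  obtain ⟨u, hu, hue, hsu⟩ := exists_rewriteMod_path hvP hs hz₁
  obtain ⟨v, hv', hve, htv⟩ := exists_rewriteMod_path hvP ht hz₂
  obtain rfl := enc_injective hu hv' (hue.trans hve.symm)
  exact ⟨_, _, hsu, htv, .refl _⟩

end GroupSignature

/-! ### Finiteness of the limit system -/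

namespace GroupSignature

open StringCompletion Relation FlatTerm

variable {F K : Type*} {sig : GroupSignature F K} {C : Set (Cst K)}
  {SE : Set (Sym2 (FlatTerm sig))}

theorem exists_map_val {α : Type*} {A : Set α} {w : List α} (h : ∀ c ∈ w, c ∈ A) :
    ∃ l : List A, w = l.map Subtype.val := by
  have : w ∈ Set.range (List.map (Subtype.val : A → α)) := by
    rw [Set.range_list_map_coe]
    exact h
  obtain ⟨l, hl⟩ := this
  exact ⟨l, hl.symm⟩

/-- A homomorphism from the presented monoid is determined by values of the constants that
satisfy the relations. -/
theorem IsGroupSystem.exists_hom (h : IsGroupSystem sig C SE) {M : Type*} [Monoid M]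
    (φ : Cst K → M) (hone : φ (Sum.inl sig.one) = 1)
    (hrel : ∀ l r, s(l, r) ∈ relationEqns sig C SE →
      (l.word.map φ).prod = (r.word.map φ).prod) :
    ∃ Φ : PresentationMonoid sig C SE →* M, ∀ c ∈ C, φ c ∈ Set.range Φ := by
  classical
  have hword : ∀ t : FlatTerm sig, (∀ c ∈ t.word, c ∈ C) →
      FreeMonoid.lift (fun c : generators sig C SE => φ c) (monoidWord sig C SE t) =
        (t.word.map φ).prod := by
    intro t
    unfold monoidWord
    generalize t.word = w
    intro hw
    rw [FreeMonoid.lift_ofList]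
    induction w with
    | nil => simp
    | cons c w ih =>
      have ih := ih fun x hx => hw x (by simp [hx])
      by_cases hc : c ∈ generators sig C SE
      · simp [hc, ih]
      -- The only constant of `C` that is not a generator is `1`; `monoidWord` drops it and `φ` maps
      -- it to the unit.
      · have : c = Sum.inl sig.one := by
          by_contra hne
          exact hc (h.mem_generators c (hw c (by simp)) hne)
        subst this
        simp [hc, ih, hone]
  have hC : ∀ e ∈ relationEqns sig C SE, ∀ t ∈ e, ∀ c ∈ t.word, c ∈ C := by
    rintro e he t ht c hc
    have := (h.valid e he.1.1).2 t ht
    cases t with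
    | const d => rw [List.mem_singleton.1 hc]; exact this
    | app g w hw => exact this.2 c hc
  refine ⟨PresentedMonoid.lift (fun c : generators sig C SE => φ c) ?_, fun c hc => ?_⟩
  · rintro _ _ ⟨l, r, hlr, rfl, rfl⟩
    rw [hword l (hC _ hlr l (by simp)), hword r (hC _ hlr r (by simp)), hrel l r hlr]
  · by_cases hc1 : c = Sum.inl sig.one
    · exact ⟨1, by rw [hc1, hone, map_one]⟩
    · exact ⟨PresentedMonoid.of _ ⟨c, h.mem_generators c hc hc1⟩, by simp⟩

theorem ValidEqn.represents_of_headIn {l r : FlatTerm sig} (h : ValidEqn sig C s(l, r))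
    (hf : ∃ t ∈ s(l, r), t.HeadIn {sig.f}) :
    Represents sig.f l.word l ∧ Represents sig.f r.word r := by
  have aux : ∀ {u} {t : FlatTerm sig}, Represents sig.f u t → Represents sig.f t.word t := by
    intro u t ht
    cases ht with
    | constant c => exact .constant c
    | app w hw => exact .app _ hw
  rcases h.cases with ⟨u, v, hu, hv⟩ | ⟨g, w, hw, c, hg, rfl, rfl⟩ | ⟨g, w, hw, c, hg, rfl, rfl⟩
  · exact ⟨aux hu, aux hv⟩
  all_goals
    exfalso
    obtain ⟨t, ht, hf⟩ := hf
    rcases Sym2.mem_iff.1 ht with rfl | rfl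
    · first
        | exact hf
        | (obtain rfl : g = sig.f := hf; exact hg sig.f_assoc)
    · first
        | exact hf
        | (obtain rfl : g = sig.f := hf; exact hg sig.f_assoc)

/-- Codes are strings of bounded length over a finite alphabet, and the code is injective on
admissible terms. -/
theorem finite_admissible [Finite F] (hC : C.Finite) (N : ℕ) :
    {t : FlatTerm sig | t.Admissible C ∧ t.enc.length ≤ N}.Finite := by
  have := hC.to_subtype
  let A : Set (List (Letter F K)) :=
    List.map (Sum.map Subtype.val id) '' {l : List (C ⊕ Option F) | l.length ≤ N}
  have hA : A.Finite := (List.finite_length_le _ N).image _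
  refine Set.Finite.of_finite_image (f := FlatTerm.enc) (hA.subset ?_) ?_
  · rintro _ ⟨t, ⟨ht, hN⟩, rfl⟩
    have hmem : ∀ x ∈ t.enc, x ∈ Set.range (Sum.map Subtype.val id : C ⊕ Option F → _) := by
      intro x hx
      rcases x with c | o
      · have hc : c ∈ C := by
          cases t with
          | const d =>
            simp only [enc_const, List.mem_singleton, Sum.inl.injEq] at hx
            exact hx ▸ ht
          | app g w hw =>
            refine ht.2 c ?_
            by_cases hg : g ∈ sig.assoc
            · rw [enc_app_assoc hg] at hx
              simpa using hx
            · rw [enc_app hg] at hx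
              simpa [separated] using hx
        exact ⟨.inl ⟨c, hc⟩, rfl⟩
      · exact ⟨.inr o, rfl⟩
    have : t.enc ∈ Set.range (List.map (Sum.map Subtype.val id : C ⊕ Option F → _)) := by
      rw [Set.range_list_map]
      exact hmem
    obtain ⟨l, hl⟩ := this
    exact ⟨l, by simpa [← hl] using hN, hl⟩
  · rintro s ⟨hs, -⟩ t ⟨ht, -⟩ h
    exact enc_injective hs ht h

variable [LinearOrder K] {U : Set (Sym2 (FlatTerm sig))}

theorem connected_one_cons (hv : ∀ e ∈ U, ValidEqn sig C e) (hU : unitEqns sig C ⊆ U)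
    {w : List (Cst K)} (hw : w ≠ []) (hwC : ∀ c ∈ w, c ∈ C) :
    Connected (F := F) U (Sum.inl (Sum.inl sig.one) :: w.map Sum.inl) (w.map Sum.inl) := by
  rcases w with _ | ⟨c, w⟩
  · exact absurd rfl hw
  have := Connected.of_mem hv (hU ⟨c, hwC c (by simp), .inr rfl⟩)
  rw [flatMul, enc_app_assoc sig.f_assoc] at this
  simpa using this.context [] (w.map Sum.inl)

theorem connected_append_one (hv : ∀ e ∈ U, ValidEqn sig C e) (hU : unitEqns sig C ⊆ U)
    {w : List (Cst K)} (hw : w ≠ []) (hwC : ∀ c ∈ w, c ∈ C) :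
    Connected (F := F) U (w.map Sum.inl ++ [Sum.inl (Sum.inl sig.one)]) (w.map Sum.inl) := by
  obtain ⟨w, c, rfl⟩ := (List.eq_nil_or_concat' w).resolve_left hw
  have := Connected.of_mem hv (hU ⟨c, hwC c (by simp), .inl rfl⟩)
  rw [flatMul, enc_app_assoc sig.f_assoc] at this
  simpa using this.context (w.map Sum.inl) []

/-- The congruence on strings over `C` that is generated by the equations of `U`; the empty string
is identified with `1`. -/
def stringCon (hv : ∀ e ∈ U, ValidEqn sig C e) (hU : unitEqns sig C ⊆ U)
    (hone : Sum.inl sig.one ∈ C) : Con (FreeMonoid C) where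
  r w w' := Connected (F := F) U
    ((Sum.inl sig.one :: (FreeMonoid.toList w).map Subtype.val).map Sum.inl)
    ((Sum.inl sig.one :: (FreeMonoid.toList w').map Subtype.val).map Sum.inl)
  iseqv := ⟨fun _ => .refl, Connected.symm, Connected.trans⟩
  mul' := by
    intro w x y z hwx hyz
    have hC : ∀ w : FreeMonoid C, ∀ c ∈ Sum.inl sig.one :: (FreeMonoid.toList w).map Subtype.val,
        c ∈ C := by
      intro w c hc
      simp only [List.mem_cons, List.mem_map] at hc
      rcases hc with rfl | ⟨a, -, rfl⟩
      · exact hone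
      · exact a.2
    -- The leading `1` of the second factor is absorbed by the nonempty string before it. This is
    -- why every string is prefixed by `1`: no flat term is empty, and the unit equations need a
    -- neighbour.
    have key : ∀ w y : FreeMonoid C, Connected (F := F) U
        ((Sum.inl sig.one :: (FreeMonoid.toList w).map Subtype.val).map Sum.inl ++
          (Sum.inl sig.one :: (FreeMonoid.toList y).map Subtype.val).map Sum.inl)
        ((Sum.inl sig.one :: (FreeMonoid.toList (w * y)).map Subtype.val).map Sum.inl) := by
      intro w y
      have := (connected_append_one (F := F) hv hU (List.cons_ne_nil _ _) (hC w)).context []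
        (((FreeMonoid.toList y).map Subtype.val).map Sum.inl)
      simpa using this
    have h₁ := hwx.context [] ((Sum.inl sig.one :: (FreeMonoid.toList y).map Subtype.val).map
      Sum.inl)
    have h₂ := hyz.context ((Sum.inl sig.one :: (FreeMonoid.toList x).map Subtype.val).map
      Sum.inl) []
    simp only [List.nil_append, List.append_nil] at h₁ h₂
    exact (key w y).symm.trans (h₁.trans (h₂.trans (key x z)))

/-- The relations of the presentation hold in this quotient, in which the class of `1` is the unit.
The classes of the constants generate it, so it is a homomorphic image of the presented monoid. -/
theorem finite_stringCon (h : IsGroupSystem sig C SE)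
    [Finite (PresentationMonoid sig C SE)] (hv : ∀ e ∈ U, ValidEqn sig C e) (hSU : SE ⊆ U) :
    Finite (stringCon hv (h.unitEqns_subset.trans hSU) h.one_mem).Quotient := by
  classical
  set r := stringCon hv (h.unitEqns_subset.trans hSU) h.one_mem with hr
  let φ : Cst K → r.Quotient := fun c => if hc : c ∈ C then r.mk' (FreeMonoid.of ⟨c, hc⟩) else 1
  have hφ : ∀ c : C, φ c = r.mk' (FreeMonoid.of c) := fun c => dif_pos c.2
  have hone : φ (Sum.inl sig.one) = 1 := by
    rw [hφ ⟨_, h.one_mem⟩, ← map_one r.mk']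
    refine (Con.eq r).2 ?_
    exact connected_append_one hv (h.unitEqns_subset.trans hSU) (w := [Sum.inl sig.one]) (by simp)
      (by simpa using h.one_mem)
  have hprod : ∀ w : List C, ((w.map Subtype.val).map φ).prod = r.mk' (FreeMonoid.ofList w) := by
    intro w
    induction w with
    | nil => exact (map_one r.mk').symm
    | cons c w ih =>
      rw [List.map_cons, List.map_cons, List.prod_cons, ih, hφ, ← map_mul]
      rfl
  obtain ⟨Φ, hΦ⟩ := h.exists_hom φ hone (by
    intro l s hls
    have hv' := h.valid _ hls.1.1
    obtain ⟨hl, hs⟩ := hv'.represents_of_headIn hls.2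
    have hc := Connected.of_mem hv (hSU hls.1.1)
    rw [hl.enc sig.f_assoc, hs.enc sig.f_assoc] at hc
    have hC : ∀ t ∈ s(l, s), ∃ w : List C, t.word = w.map Subtype.val := by
      intro t ht
      have ha := hv'.2 t ht
      have : ∀ c ∈ t.word, c ∈ C := by
        cases t with
        | const d => intro c hc; rw [List.mem_singleton.1 hc]; exact ha
        | app g w hw => exact ha.2
      exact exists_map_val this
    obtain ⟨w, hw⟩ := hC l (by simp)
    obtain ⟨w', hw'⟩ := hC s (by simp)
    rw [hw, hw'] at hc ⊢
    rw [hprod, hprod]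
    refine (Con.eq r).2 ?_
    simpa [r, stringCon] using hc.context [Sum.inl (Sum.inl sig.one)] [])
  have hsurj : Function.Surjective Φ := by
    rw [← MonoidHom.mrange_eq_top, eq_top_iff]
    rintro x -
    obtain ⟨w, rfl⟩ := Con.mk'_surjective x
    have := hprod (FreeMonoid.toList w)
    rw [FreeMonoid.ofList_toList] at this
    rw [← this]
    refine list_prod_mem ?_
    intro y hy
    simp only [List.mem_map] at hy
    obtain ⟨_, ⟨c, -, rfl⟩, rfl⟩ := hy
    obtain ⟨z, hz⟩ := hΦ c c.2
    exact ⟨z, hz⟩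
  exact Finite.of_surjective Φ hsurj

variable {S : ℕ → Set (Sym2 (FlatTerm sig))}

theorem eq_of_joinable_of_irreducible {α : Type*} {R : α → α → Prop} {a b : α}
    (h : Joinable R a b) (ha : ∀ c, ¬ R a c) (hb : ∀ c, ¬ R b c) : a = b := by
  obtain ⟨c, hac, hbc⟩ := h
  rcases hac.cases_head with rfl | ⟨_, h, -⟩
  · rcases hbc.cases_head with rfl | ⟨_, h, -⟩
    · rfl
    · exact absurd h (hb _)
  · exact absurd h (ha _)

/-- Connected irreducible strings are joinable, hence equal. So the nonempty irreducible strings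
inject into the finite quotient by `stringCon`, and their lengths are bounded. -/
theorem IsFair.exists_length_le (h : IsGroupSystem sig C SE)
    [Finite (PresentationMonoid sig C SE)] (hS : IsDerivation sig SE S) (hf : IsFair sig S)
    (hv : ∀ e ∈ allEqns S, ValidEqn sig C e) :
    ∃ B : ℕ, ∀ u : List (Cst K), (∀ c ∈ u, c ∈ C) →
      (∀ b, ¬ Step (rules (F := F) (persisting S)) (u.map Sum.inl) b) → u.length ≤ B := by
  have hSU : SE ⊆ allEqns S := fun e he => Set.mem_iUnion.2 ⟨0, hS.1 ▸ he⟩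
  have := finite_stringCon h hv hSU
  set r := stringCon hv (h.unitEqns_subset.trans hSU) h.one_mem
  let I : Set (FreeMonoid C) := {w | FreeMonoid.toList w ≠ [] ∧
    ∀ b, ¬ Step (rules (F := F) (persisting S))
      (((FreeMonoid.toList w).map Subtype.val).map Sum.inl) b}
  have hI : I.Finite := by
    refine Set.Finite.of_finite_image (f := r.mk') (Set.toFinite _) ?_
    rintro w ⟨hw, hw'⟩ x ⟨hx, hx'⟩ hwx
    have hc : Connected (F := F) (allEqns S) _ _ := (Con.eq r).1 hwx
    have key : ∀ w : FreeMonoid C, FreeMonoid.toList w ≠ [] → Connected (F := F) (allEqns S)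
        ((Sum.inl sig.one :: (FreeMonoid.toList w).map Subtype.val).map Sum.inl)
        (((FreeMonoid.toList w).map Subtype.val).map Sum.inl) := by
      intro w hw
      refine connected_one_cons hv (h.unitEqns_subset.trans hSU) (by simpa using hw) fun c hc => ?_
      obtain ⟨a, -, rfl⟩ := List.mem_map.1 hc
      exact a.2
    have := eq_of_joinable_of_irreducible (hf.joinable hS h.finite hv
      ((key w hw).symm.trans (hc.trans (key x hx)))) hw' hx'
    exact FreeMonoid.toList.injective
      (List.map_injective_iff.2 Subtype.val_injective (List.map_injective_iff.2
        Sum.inl_injective this))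
  obtain ⟨B, hB⟩ := (hI.image fun w => (FreeMonoid.toList w).length).bddAbove
  refine ⟨B, fun u hu hirr => ?_⟩
  by_cases hu0 : u = []
  · simp [hu0]
  · obtain ⟨w, rfl⟩ := exists_map_val hu
    exact hB ⟨FreeMonoid.ofList w, ⟨by simpa using hu0, hirr⟩, by simp⟩

theorem length_le_of_wordLt {a b : List (Letter F K)} (h : WordLt C a b) :
    a.length ≤ b.length := by
  unfold WordLt at h
  rw [List.shortlex_def] at h
  rcases h with h | h
  · exact h.le
  · exact h.1.le

/-- A fair derivation has only finitely many persisting equations. -/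
theorem IsFair.finite_persisting [Finite F] (h : IsGroupSystem sig C SE)
    [Finite (PresentationMonoid sig C SE)] (hS : IsDerivation sig SE S) (hf : IsFair sig S)
    (hv : ∀ e ∈ allEqns S, ValidEqn sig C e) : (persisting S).Finite := by
  obtain ⟨B, hB⟩ := hf.exists_length_le h hS hv
  obtain ⟨A, hA⟩ := (Set.finite_range sig.arity).bddAbove
  -- Strings on the left turn out to have length at most `B + 1`, and a code `g(w)` has length `1 +
  -- 2 * arity`; the sum covers both.
  have hlen : ∀ l r, s(l, r) ∈ persisting S → Greater sig l r →
      l.enc.length ≤ B + 2 * A + 1 := by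
    intro l r hlr hg
    have hv' := hv _ (persisting_subset hlr)
    obtain ⟨-, hl, hr⟩ := validEqn_mk.1 hv'
    rcases hv'.cases_of_greater hg with ⟨u, v, hu, -⟩ | ⟨g, w, hw, c, hg', rfl, -⟩
    · rcases u with _ | ⟨a, u⟩
      · exact absurd rfl hu.ne_nil
      -- Without its first letter the left-hand side is irreducible, since a redex in the remainder
      -- would be a proper factor of a persisting left-hand side.
      have hle := hB u (fun c hc => hu.admissible.1 hl c (by simp [hc])) (by
        rintro b ⟨p, q, _, _, ⟨l', r', hlr', hg', rfl, rfl⟩, he, rfl⟩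
        have := hf.no_proper_factor h.finite hv hlr hlr' hg hg' (p := Sum.inl a :: p) (q := q)
          (by rw [hu.enc sig.f_assoc, List.map_cons, he]; simp)
        simp at this)
      rw [hu.enc sig.f_assoc]
      simp only [List.map_cons, List.length_cons, List.length_map]
      omega
    · have : sig.arity g ≤ A := hA ⟨g, rfl⟩
      rw [enc_app hg', List.length_cons, length_separated, hw.2 hg']
      omega
  have hfin := finite_admissible (sig := sig) h.finite (B + 2 * A + 1)
  refine ((hfin.prod hfin).image fun p => s(p.1, p.2)).subset ?_
  intro e
  induction e using Sym2.inductionOn with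
  | hf s t =>
  intro he
  have key : ∀ l r, s(l, r) ∈ persisting S → Greater sig l r →
      (l.Admissible C ∧ l.enc.length ≤ B + 2 * A + 1) ∧
        (r.Admissible C ∧ r.enc.length ≤ B + 2 * A + 1) := by
    intro l r hlr hg
    obtain ⟨-, hl, hr⟩ := validEqn_mk.1 (hv _ (persisting_subset hlr))
    have := hlen l r hlr hg
    exact ⟨⟨hl, this⟩, hr, (length_le_of_wordLt (wordLt_of_greater hl hr hg)).trans this⟩
  rcases (hv _ (persisting_subset he)).greater_or with rfl | hg | hg
  -- A trivial equation cannot persist: DELETE would be applied and adds nothing back.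
  · have := (hf.mem_add (.delete s) ⟨Set.finite_singleton _, Set.finite_empty⟩ (by simpa using he)
      (by simp)).2 rfl
    exact absurd this (Set.notMem_empty _)
  · exact ⟨(s, t), key s t he hg, rfl⟩
  · have := key t s (by rwa [Sym2.eq_swap]) hg
    exact ⟨(s, t), ⟨this.2, this.1⟩, rfl⟩

/-- Completion yields a finite limit system and terminates. -/
theorem IsFair.terminates [Finite F] (h : IsGroupSystem sig C SE)
    [Finite (PresentationMonoid sig C SE)] (hS : IsDerivation sig SE S) (hf : IsFair sig S) :
    (persisting S).Finite ∧ ∃ n, ∀ j ≥ n, persisting S ⊆ S j ∧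
      ∀ s t : FlatTerm sig, s(s, t) ∈ S j →
        JoinableMod (orient (persisting S)) s.toTerm t.toTerm := by
  have hv : ∀ e ∈ allEqns S, ValidEqn sig C e := by
    intro e he
    obtain ⟨j, hj⟩ := Set.mem_iUnion.1 he
    exact hS.valid h.finite h.valid j e hj
  have hfin := hf.finite_persisting h hS hv
  obtain ⟨n, hn⟩ := exists_stage hfin subset_rfl
  exact ⟨hfin, n, fun j hj => ⟨hn j hj, fun s t hst =>
    hf.joinableMod hS h.finite hv (Set.mem_iUnion.2 ⟨j, hst⟩)⟩⟩

end GroupSignature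

/-! ### Reduced words in a free product of copies of a group -/

/-- The free product of countably many copies of a group. -/
abbrev FreePower (H : Type*) [Group H] := Monoid.CoprodI fun _ : ℕ => H

namespace FreePower

variable {H : Type*} [Group H]

/-- The element `h` of the `i`-th copy of `H`. -/
def of (p : ℕ × H) : FreePower H := Monoid.CoprodI.of (M := fun _ : ℕ => H) (i := p.1) p.2

/-- The product of a string of letters. -/
def val (w : List (ℕ × H)) : FreePower H := (w.map of).prod

@[simp] theorem val_nil : val ([] : List (ℕ × H)) = 1 := rfl

@[simp] theorem val_cons (p : ℕ × H) (w : List (ℕ × H)) : val (p :: w) = of p * val w := by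
  simp [val]

/-- Reduced words: no letter is trivial, and adjacent letters come from different copies. -/
def Reduced (w : List (ℕ × H)) : Prop :=
  (∀ p ∈ w, p.2 ≠ 1) ∧ w.IsChain fun p q => p.1 ≠ q.1

/-- The reduced word of an element. -/
noncomputable def nf (m : FreePower H) : List (ℕ × H) := by
  classical exact (Monoid.CoprodI.Word.equiv m).toList.map fun p => (p.1, p.2)

theorem reduced_nf (m : FreePower H) : Reduced (nf m) := by
  classical
  refine ⟨?_, ?_⟩
  · intro p hp
    obtain ⟨q, hq, rfl⟩ := List.mem_map.1 hp
    exact (Monoid.CoprodI.Word.equiv m).ne_one q hq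
  · exact List.isChain_map _ |>.2 (Monoid.CoprodI.Word.equiv m).chain_ne

@[simp] theorem val_nf (m : FreePower H) : val (nf m) = m := by
  classical
  conv_rhs => rw [← Monoid.CoprodI.Word.equiv.symm_apply_apply m]
  unfold nf val
  rw [List.map_map]
  rfl

theorem nf_val {w : List (ℕ × H)} (hw : Reduced w) : nf (val w) = w := by
  classical
  let W : Monoid.CoprodI.Word fun _ : ℕ => H :=
    ⟨w.map fun p => ⟨p.1, p.2⟩, by
      intro l hl
      obtain ⟨q, hq, rfl⟩ := List.mem_map.1 hl
      exact hw.1 q hq, List.isChain_map _ |>.2 hw.2⟩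
  have h : val w = Monoid.CoprodI.Word.equiv.symm W := by
    change (w.map of).prod = ((w.map fun p => (⟨p.1, p.2⟩ : Σ _ : ℕ, H)).map fun l =>
      Monoid.CoprodI.of (M := fun _ : ℕ => H) l.2).prod
    rw [List.map_map]
    rfl
  unfold nf
  rw [h, Equiv.apply_symm_apply, List.map_map]
  exact List.map_id _

theorem nf_injective : Function.Injective (nf (H := H)) :=
  Function.LeftInverse.injective val_nf

@[simp] theorem nf_one : nf (1 : FreePower H) = [] := nf_val (w := []) ⟨by simp, .nil⟩

theorem nf_of {p : ℕ × H} (hp : p.2 ≠ 1) : nf (of p) = [p] := by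
  have := nf_val (w := [p]) ⟨by simpa using hp, .singleton _⟩
  simpa using this

open Classical in
/-- Multiplication of a reduced word by a letter. -/
noncomputable def act (p : ℕ × H) (w : List (ℕ × H)) : List (ℕ × H) :=
  if p.2 = 1 then w else
    List.casesOn w [p] fun q v =>
      if p.1 = q.1 then (if p.2 * q.2 = 1 then v else (p.1, p.2 * q.2) :: v) else p :: q :: v

/-- When the letter cancels the first one, the tail is already reduced; when they merge to a
nontrivial letter, the copy index is unchanged and so is the condition on neighbours. -/
theorem act_spec (p : ℕ × H) {w : List (ℕ × H)} (hw : Reduced w) :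
    Reduced (act p w) ∧ val (act p w) = of p * val w := by
  obtain ⟨i, h⟩ := p
  unfold act
  split_ifs with h1
  · obtain rfl : h = 1 := h1
    exact ⟨hw, by simp [of]⟩
  rcases w with _ | ⟨⟨j, k⟩, v⟩
  · exact ⟨⟨by simpa using h1, .singleton _⟩, by simp⟩
  have hv : Reduced v := ⟨fun p hp => hw.1 p (by simp [hp]), hw.2.of_cons⟩
  dsimp only
  split_ifs with hij hhk
  · obtain rfl : i = j := hij
    refine ⟨hv, ?_⟩
    rw [val_cons, ← mul_assoc]
    have : of (i, h) * of (i, k) = 1 := by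
      simp only [of, ← map_mul]
      exact (congrArg _ hhk).trans (map_one _)
    rw [this, one_mul]
  · obtain rfl : i = j := hij
    refine ⟨⟨?_, ?_⟩, ?_⟩
    · simpa using ⟨hhk, fun p q hp => hv.1 (p, q) hp⟩
    · have := hw.2
      rw [List.isChain_cons] at this ⊢
      exact this
    · simp [of, mul_assoc]
  · refine ⟨⟨?_, ?_⟩, by simp⟩
    · intro p hp
      rcases List.mem_cons.1 hp with rfl | hp
      · exact h1
      · exact hw.1 p hp
    · exact List.IsChain.cons_cons hij hw.2

theorem nf_of_mul (p : ℕ × H) (m : FreePower H) : nf (of p * m) = act p (nf m) := by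
  obtain ⟨h₁, h₂⟩ := act_spec p (reduced_nf m)
  rw [← nf_val h₁, h₂, val_nf]

/-- The product of reduced words. -/
noncomputable def mulWord (v w : List (ℕ × H)) : List (ℕ × H) := v.foldr act w

theorem nf_val_mul (v : List (ℕ × H)) (m : FreePower H) :
    nf (val v * m) = mulWord v (nf m) := by
  induction v with
  | nil => simp [mulWord]
  | cons p v ih => rw [val_cons, mul_assoc, nf_of_mul, ih]; rfl

theorem nf_mul (m m' : FreePower H) : nf (m * m') = mulWord (nf m) (nf m') := by
  rw [← nf_val_mul, val_nf]

theorem nf_prod (l : List (FreePower H)) : nf l.prod = (l.map nf).foldr mulWord [] := by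
  induction l with
  | nil => simp
  | cons m l ih => rw [List.prod_cons, nf_mul, ih]; rfl

/-- The inverse of a reduced word. -/
noncomputable def invWord (w : List (ℕ × H)) : List (ℕ × H) :=
  mulWord (w.map fun p => (p.1, p.2⁻¹)).reverse []

theorem nf_inv (m : FreePower H) : nf m⁻¹ = invWord (nf m) := by
  have h : ∀ w : List (ℕ × H), val (w.map fun p => (p.1, p.2⁻¹)).reverse = (val w)⁻¹ := by
    intro w
    simp only [val, List.prod_inv_reverse, List.map_reverse, List.map_map]
    congr 2
  have := nf_val_mul (nf m |>.map fun p => (p.1, p.2⁻¹)).reverse 1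
  rwa [h, val_nf, mul_one, nf_one] at this

/-- The homomorphism that is given by a family of homomorphisms. -/
def lift {Q : Type*} [Group Q] (r : ℕ → H →* Q) : FreePower H →* Q := Monoid.CoprodI.lift r

@[simp] theorem lift_of {Q : Type*} [Group Q] (r : ℕ → H →* Q) (p : ℕ × H) :
    lift r (of p) = r p.1 p.2 := Monoid.CoprodI.lift_of r p.2

/-! #### Computability -/

open Primrec

variable [Primcodable H]

theorem primrec_act (hmul : Primrec₂ fun a b : H => a * b) : Primrec₂ (act (H := H)) := by
  classical
  have h1 : PrimrecPred fun x : (ℕ × H) × List (ℕ × H) => x.1.2 = 1 :=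
    Primrec.eq.comp (snd.comp fst) (const 1)
  have hm : Primrec fun x : ((ℕ × H) × List (ℕ × H)) × ((ℕ × H) × List (ℕ × H)) =>
      x.1.1.2 * x.2.1.2 :=
    hmul.comp (snd.comp (fst.comp fst)) (snd.comp (fst.comp snd))
  refine Primrec.ite h1 snd ?_
  refine list_casesOn (h := fun (x : (ℕ × H) × List (ℕ × H)) (y : (ℕ × H) × List (ℕ × H)) =>
    if x.1.1 = y.1.1 then (if x.1.2 * y.1.2 = 1 then y.2 else (x.1.1, x.1.2 * y.1.2) :: y.2)
      else x.1 :: y.1 :: y.2) snd (list_cons.comp fst (const [])) ?_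
  refine Primrec.ite ?_ (Primrec.ite ?_ ?_ ?_) ?_
  · exact Primrec.eq.comp (fst.comp (fst.comp fst)) (fst.comp (fst.comp snd))
  · exact Primrec.eq.comp hm (const 1)
  · exact snd.comp snd
  · exact list_cons.comp (pair (fst.comp (fst.comp fst)) hm) (snd.comp snd)
  · exact list_cons.comp (fst.comp fst) (list_cons.comp (fst.comp snd) (snd.comp snd))

theorem primrec_mulWord (hmul : Primrec₂ fun a b : H => a * b) :
    Primrec₂ (mulWord (H := H)) :=
  list_foldr fst snd ((primrec_act hmul).comp (fst.comp snd) (snd.comp snd)).to₂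

theorem primrec_invWord (hmul : Primrec₂ fun a b : H => a * b)
    (hinv : Primrec fun a : H => a⁻¹) : Primrec (invWord (H := H)) :=
  (primrec_mulWord hmul).comp (list_reverse.comp
    (list_map .id ((pair (fst.comp snd) (hinv.comp (snd.comp snd))).to₂))) (const [])

theorem primrec_prodWord (hmul : Primrec₂ fun a b : H => a * b) :
    Primrec fun l : List (List (ℕ × H)) => l.foldr mulWord [] :=
  list_foldr .id (const []) ((primrec_mulWord hmul).comp (fst.comp snd) (snd.comp snd)).to₂

end FreePower

/-! #### Primitive recursive functions -/

/-- Finitely many exceptional values can be built into the algorithm, however they were obtained;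
this serves for the operation table of the model. -/
theorem Primrec.of_finite_support {α β : Type*} [Primcodable α] [Primcodable β] (d : β)
    (f : α → β) (h : {a | f a ≠ d}.Finite) : Primrec f := by
  classical
  have key : ∀ s : Finset α, Primrec fun a => if a ∈ s then f a else d := by
    intro s
    induction s using Finset.induction_on with
    | empty => simpa using Primrec.const d
    | insert a s _ ih =>
      refine (Primrec.ite (Primrec.eq.comp .id (.const a)) (.const (f a)) ih).of_eq fun b => ?_
      by_cases hb : b = a
      · simp [hb]
      · simp [hb]
  refine (key h.toFinset).of_eq fun a => ?_
  by_cases ha : f a = d <;> simp [ha]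

theorem Int.encode_natCast (n : ℕ) : Encodable.encode (n : ℤ) = 2 * n := by
  change Equiv.natSumNatEquivNat (Sum.inl n) = _
  simp

theorem Int.encode_negSucc (n : ℕ) : Encodable.encode (Int.negSucc n) = 2 * n + 1 := by
  change Equiv.natSumNatEquivNat (Sum.inr n) = _
  simp

namespace Primrec

/-- The code of `n` is `2n` and that of `-(n + 1)` is `2n + 1`, so parity tells the sign. Integer
arithmetic then reduces to positive and negative parts. -/
theorem int_encode_even : PrimrecPred fun z : ℤ => Encodable.encode z % 2 = 0 :=
  Primrec.eq.comp (nat_mod.comp .encode (const 2)) (const 0)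

theorem int_toNat : Primrec Int.toNat := by
  refine (Primrec.ite int_encode_even (nat_div.comp .encode (const 2)) (const 0)).of_eq fun z => ?_
  rcases z with n | n
  · rw [Int.ofNat_eq_natCast, Int.encode_natCast]
    simp
  · rw [Int.encode_negSucc]
    simp [Nat.add_mod]

theorem int_toNat_neg : Primrec fun z : ℤ => (-z).toNat := by
  refine (Primrec.ite int_encode_even (const 0)
    (succ.comp (nat_div.comp .encode (const 2)))).of_eq fun z => ?_
  rcases z with n | n
  · rw [Int.ofNat_eq_natCast, Int.encode_natCast]
    simp
  · rw [Int.encode_negSucc]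
    simp only [Nat.mul_add_mod_self_left, Nat.one_mod, one_ne_zero, if_false, Int.neg_negSucc]
    rw [Int.toNat_natCast]
    omega

theorem int_sub_nat : Primrec₂ fun m n : ℕ => (m : ℤ) - n := by
  have h : Primrec₂ fun m n : ℕ => Denumerable.ofNat ℤ
      (if n ≤ m then 2 * (m - n) else 2 * (n - m - 1) + 1) := by
    refine (Primrec.ofNat ℤ).comp (Primrec.ite (nat_le.comp snd fst) ?_ ?_)
    · exact nat_mul.comp (const 2) (nat_sub.comp fst snd)
    · exact succ.comp (nat_mul.comp (const 2) (nat_sub.comp (nat_sub.comp snd fst) (const 1)))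
  refine h.of_eq fun m n => ?_
  split_ifs with hmn
  · rw [← Int.encode_natCast, Denumerable.ofNat_encode]
    omega
  · rw [← Int.encode_negSucc, Denumerable.ofNat_encode]
    omega

theorem int_add : Primrec₂ fun a b : ℤ => a + b := by
  refine (int_sub_nat.comp (nat_add.comp (int_toNat.comp fst) (int_toNat.comp snd))
    (nat_add.comp (int_toNat_neg.comp fst) (int_toNat_neg.comp snd))).of_eq fun p => ?_
  push_cast
  omega

theorem int_neg : Primrec fun a : ℤ => -a := by
  refine (int_sub_nat.comp int_toNat_neg int_toNat).of_eq fun a => ?_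
  omega

end Primrec

instance : Primcodable (Multiplicative ℤ) := inferInstanceAs (Primcodable ℤ)

section Finite

open Primrec

variable {G : Type*} [Group G] [Finite G] [Primcodable G]

theorem primrec_prod_mul :
    Primrec₂ fun a b : G × Multiplicative ℤ => a * b := by
  have h₁ : Primrec fun p : G × G => p.1 * p.2 := Primrec.dom_finite _
  exact pair (h₁.comp (pair (fst.comp fst) (fst.comp snd)))
    (int_add.comp (snd.comp fst) (snd.comp snd))

theorem primrec_prod_inv : Primrec fun a : G × Multiplicative ℤ => a⁻¹ :=
  pair ((Primrec.dom_finite fun a : G => a⁻¹).comp fst) (int_neg.comp snd)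

end Finite

/-! ### The group of ground terms modulo `E` and the group axioms -/

namespace GroupSignature

variable {F K : Type*} {sig : GroupSignature F K}

/-- Equality of ground terms modulo `E` and the group axioms. -/
def eqModSetoid (sig : GroupSignature F K) (E : Set (Sym2 (Term sig K))) :
    Setoid (Term sig K) where
  r := EqMod sig E
  iseqv := ⟨.refl, .symm, .trans⟩

/-- The ground terms modulo `E` and the group axioms. -/
def TermGroup (sig : GroupSignature F K) (E : Set (Sym2 (Term sig K))) : Type _ :=
  Quotient (eqModSetoid sig E)

namespace TermGroup

variable {E : Set (Sym2 (Term sig K))}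

/-- The class of a ground term. -/
def mk (E : Set (Sym2 (Term sig K))) (t : Term sig K) : TermGroup sig E :=
  Quotient.mk (eqModSetoid sig E) t

theorem mk_eq {s t : Term sig K} : mk E s = mk E t ↔ EqMod sig E s t := Quotient.eq

theorem mk_surjective : Function.Surjective (mk E) := Quotient.mk_surjective

theorem exists_map_mk (l : List (TermGroup sig E)) : ∃ ts : List (Term sig K),
    l = ts.map (mk E) := by
  obtain ⟨ts, rfl⟩ := List.map_surjective_iff.2 mk_surjective l
  exact ⟨ts, rfl⟩

/-- A representative of a class. -/
noncomputable def out (a : TermGroup sig E) : Term sig K := Quotient.out (s := eqModSetoid sig E) a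

theorem mk_out (a : TermGroup sig E) : mk E a.out = a :=
  Quotient.out_eq (s := eqModSetoid sig E) a

open Classical in
/-- The operation of a function symbol on classes of terms. -/
noncomputable def op (E : Set (Sym2 (Term sig K))) (g : F) (l : List (TermGroup sig E)) :
    TermGroup sig E :=
  if h : sig.IsArity g (l.map out).length then
    -- The second value is a default for argument lists of illegal length, which no term produces.
    mk E (Term.appList g (l.map out) h) else mk E sig.unit

theorem op_map_mk {g : F} {ts : List (Term sig K)} (h : sig.IsArity g ts.length) :
    op E g (ts.map (mk E)) = mk E (Term.appList g ts h) := by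
  have h' : sig.IsArity g ((ts.map (mk E)).map out).length := by simpa using h
  rw [op, dif_pos h', mk_eq]
  refine CongruenceClosure.appList g _ _ ?_
  rw [List.map_map, List.forall₂_map_left_iff, List.forall₂_same]
  exact fun t _ => mk_eq.1 (mk_out _)

theorem mk_mul (s t : Term sig K) : mk E (sig.mul s t) = op E sig.f [mk E s, mk E t] := by
  have := op_map_mk (E := E) (ts := [s, t]) (sig.isArity_f le_rfl)
  rw [List.map_cons, List.map_cons, List.map_nil] at this
  rw [this, mul, Term.app_eq_appList (l := [s, t]) (by simp)]

theorem mk_inv (s : Term sig K) : mk E (sig.inv s) = op E sig.i [mk E s] := by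
  have := op_map_mk (E := E) (ts := [s]) sig.isArity_i
  rw [List.map_cons, List.map_nil] at this
  rw [this, inv, Term.app_eq_appList (l := [s]) (by simp)]

theorem isAssocOp_op : Term.IsAssocOp sig (op E) := by
  intro g hg x y z hy h
  obtain ⟨x, rfl⟩ := exists_map_mk x
  obtain ⟨y, rfl⟩ := exists_map_mk y
  obtain ⟨z, rfl⟩ := exists_map_mk z
  rw [List.length_map] at hy
  have hy' := isArity_of_assoc hg hy
  simp only [List.length_append, List.length_cons, List.length_map] at h
  rw [op_map_mk hy', ← List.map_cons, ← List.map_append, ← List.map_append, ← List.map_append,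
    op_map_mk (isArity_of_assoc hg (by simpa using h)),
    op_map_mk (isArity_of_assoc hg (by simp only [List.length_append]; omega)), mk_eq]
  exact .base (.inr (.assoc (.mk g hg x y z hy' _ _)))

theorem mk_eq_of_groupAxiom {s t : Term sig K} (h : GroupAxiom sig s t) : mk E s = mk E t :=
  mk_eq.2 (.base (.inr h))

noncomputable instance : Group (TermGroup sig E) :=
  { mul := fun a b => op E sig.f [a, b]
    one := mk E sig.unit
    inv := fun a => op E sig.i [a]
    mul_assoc := by
      intro a b c
      have h₁ := isAssocOp_op (E := E) sig.f sig.f_assoc [] [a, b] [c] le_rfl le_rfl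
      have h₂ := isAssocOp_op (E := E) sig.f sig.f_assoc [a] [b, c] [] le_rfl le_rfl
      exact h₁.trans h₂.symm
    one_mul := by
      intro a
      obtain ⟨s, rfl⟩ := mk_surjective a
      exact (mk_mul _ _).symm.trans (mk_eq_of_groupAxiom (.one_mul s))
    mul_one := by
      intro a
      obtain ⟨s, rfl⟩ := mk_surjective a
      exact (mk_mul _ _).symm.trans (mk_eq_of_groupAxiom (.mul_one s))
    inv_mul_cancel := by
      intro a
      obtain ⟨s, rfl⟩ := mk_surjective a
      change op E sig.f [op E sig.i [mk E s], mk E s] = _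
      rw [← mk_inv, ← mk_mul]
      exact mk_eq_of_groupAxiom (.inv_mul s) }

theorem isGroupModel : IsGroupModel sig (op E) where
  op_f := by
    intro l
    induction l with
    | nil => intro h; simp at h
    | cons a l ih =>
      intro h
      rcases l with _ | ⟨b, _ | ⟨c, l⟩⟩
      · simp at h
      · change _ = [a, b].prod
        rw [List.prod_cons, List.prod_singleton]
        rfl
      · have ih := ih (by simp)
        -- The variadic operation is an iterated binary one: `f(a, f(b, c, …)) = f(a, b, c, …)`.
        have := isAssocOp_op (E := E) sig.f sig.f_assoc [a] (b :: c :: l) [] (by simp) (by simp)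
        rw [List.append_nil] at this
        rw [List.prod_cons, ← ih]
        exact this.symm
  op_i _ := rfl
  assoc := isAssocOp_op

theorem eval_op (t : Term sig K) : t.eval (op E) (fun c => mk E (.const c)) = mk E t := by
  induction t using Term.induction_list with
  | const c => rfl
  | app g l h ih =>
    rw [Term.eval_appList, List.map_congr_left ih, op_map_mk h]

theorem sat (e : Sym2 (Term sig K)) (he : e ∈ E) :
    Sat (op E) (fun c => mk E (.const c)) e := by
  induction e with
  | h s t => rw [sat_mk, eval_op, eval_op, mk_eq]; exact .base (.inl he)

end TermGroup

end GroupSignature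

/-! ### A model with computable normal forms -/

namespace GroupSignature

open FreePower Encodable

variable {F K : Type*} {sig : GroupSignature F K} {Q : Type*} [Group Q] {G : Subgroup Q}

/-- The free product of `G` and a free group of countable rank is a quotient of this group. -/
abbrev Model (G : Subgroup Q) := FreePower (G × Multiplicative ℤ)

/-- Strings of letters of the model. -/
abbrev Code (G : Subgroup Q) := List (ℕ × (G × Multiplicative ℤ))

namespace Model

/-- The embedding of `G`. -/
def emb (G : Subgroup Q) : G →* Model G where
  toFun a := of (0, (a, 1))
  map_one' := map_one (Monoid.CoprodI.of (M := fun _ : ℕ => G × Multiplicative ℤ) (i := 0))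
  map_mul' a b := by
    simp only [of, ← map_mul, Prod.mk_mul_mk, mul_one]

/-- The code of a free generator. -/
def genCode (G : Subgroup Q) (n : ℕ) : Code G := [(n + 1, (1, Multiplicative.ofAdd 1))]

/-- The free generators. -/
def gen (G : Subgroup Q) (n : ℕ) : Model G := of (n + 1, (1, Multiplicative.ofAdd 1))

theorem val_genCode (n : ℕ) : val (genCode G n) = gen G n := by simp [genCode, gen]

theorem nf_gen (n : ℕ) : nf (gen G n) = genCode G n :=
  nf_of (by
    intro h
    have h' : Multiplicative.ofAdd (1 : ℤ) = Multiplicative.ofAdd 0 := congrArg Prod.snd h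
    exact one_ne_zero (Multiplicative.ofAdd.injective h'))

/-- Projecting every copy onto its factor `G` gives a left inverse. -/
theorem emb_injective : Function.Injective (emb G) := by
  have h : ∀ a, lift (fun _ => MonoidHom.fst G (Multiplicative ℤ)) (emb G a) = a := fun a =>
    lift_of _ _
  exact Function.LeftInverse.injective h

/-- The homomorphism from the model with given values of the free generators. -/
noncomputable def liftGen (G : Subgroup Q) (r : ℕ → Q) : Model G →* Q :=
  lift fun i => Nat.casesOn i (G.subtype.comp (MonoidHom.fst _ _))
    fun n => (zpowersHom Q (r n)).comp (MonoidHom.snd _ _)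

theorem liftGen_emb (r : ℕ → Q) (a : G) : liftGen G r (emb G a) = a := lift_of _ _

theorem liftGen_gen (r : ℕ → Q) (n : ℕ) : liftGen G r (gen G n) = r n := by
  refine (lift_of _ _).trans ?_
  simp

/-- Only the generators that occur in a word matter, which permits choosing their values by
recursion. -/
theorem liftGen_congr {r r' : ℕ → Q} {w : Code G}
    (h : ∀ p ∈ w, ∀ n, p.1 = n + 1 → r n = r' n) :
    liftGen G r (val w) = liftGen G r' (val w) := by
  induction w with
  | nil => simp
  | cons p w ih =>
    rw [val_cons, map_mul, map_mul, ih fun q hq => h q (by simp [hq])]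
    congr 1
    obtain ⟨i, a⟩ := p
    unfold liftGen
    rw [lift_of, lift_of]
    cases i with
    | zero => rfl
    | succ n => simp only [h (n + 1, a) (by simp) n rfl]

theorem i_ne_f : sig.i ≠ sig.f := fun h => sig.i_not_assoc (h ▸ sig.f_assoc)

section Table

variable (sig) (opQ : F → List Q → Q)

open Classical in
/-- The values of the operations of the non-associative symbols in `G`. -/
noncomputable def table (p : F × List (Code G)) : Option (Code G) :=
  if h : ∃ as : List G, as.map (fun a => nf (emb G a)) = p.2 ∧ as.length = sig.arity p.1 ∧
      opQ p.1 (as.map Subtype.val) ∈ G then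
    some (nf (emb G ⟨_, h.choose_spec.2.2⟩)) else none

variable {sig opQ}

theorem table_emb {g : F} {as : List G} (hl : as.length = sig.arity g)
    (h : opQ g (as.map Subtype.val) ∈ G) :
    table sig opQ (g, as.map fun a => nf (emb G a)) = some (nf (emb G ⟨_, h⟩)) := by
  have hex : ∃ bs : List G, bs.map (fun a => nf (emb G a)) = as.map (fun a => nf (emb G a)) ∧
      bs.length = sig.arity g ∧ opQ g (bs.map Subtype.val) ∈ G := ⟨as, rfl, hl, h⟩
  have hinj : Function.Injective fun a => nf (emb G a) := nf_injective.comp emb_injective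
  have he := List.map_injective_iff.2 hinj hex.choose_spec.1
  rw [table, dif_pos hex]
  congr 3
  exact Subtype.ext (congrArg (fun bs : List G => opQ g (bs.map Subtype.val)) he)

theorem table_eq_some {g : F} {ws : List (Code G)} {w : Code G}
    (h : table sig opQ (g, ws) = some w) : ∃ as : List G,
      as.map (fun a => nf (emb G a)) = ws ∧ as.length = sig.arity g ∧
      ∃ h : opQ g (as.map Subtype.val) ∈ G, w = nf (emb G ⟨_, h⟩) := by
  unfold table at h
  split_ifs at h with hex
  have hs := hex.choose_spec
  exact ⟨_, hs.1, hs.2.1, hs.2.2, (Option.some.inj h).symm⟩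

end Table

variable [Primcodable G] [Primcodable F]

open Classical in
/-- The arguments of a string under the associative symbol `g`. -/
noncomputable def flat (g : F) (w : Code G) : List (Code G) :=
  -- The generator number `n` lives in copy `n + 1`. A word that is not exactly such a generator,
  -- with head `g` and at least two arguments, fails the test and counts as a single argument.
  ((w.head?.bind fun q => decode (α := F × List (Code G)) (q.1 - 1)).bind fun p =>
    if w = genCode G (encode p) ∧ p.1 = g ∧ 2 ≤ p.2.length then some p.2 else none).getD [w]

theorem flat_gen {g : F} {ls : List (Code G)} (h : 2 ≤ ls.length) :
    flat g (genCode G (encode (g, ls))) = ls := by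
  simp [flat, genCode, h]

theorem flat_cases (g : F) (w : Code G) : flat g w = [w] ∨
    ∃ ls, 2 ≤ ls.length ∧ w = genCode G (encode (g, ls)) ∧ flat g w = ls := by
  unfold flat
  generalize (w.head?.bind fun q => decode (α := F × List (Code G)) (q.1 - 1)) = o
  rcases o with _ | ⟨g', ls⟩
  · exact .inl rfl
  · by_cases h : w = genCode G (encode (g', ls)) ∧ g' = g ∧ 2 ≤ ls.length
    · obtain ⟨h₁, rfl, h₂⟩ := h
      exact .inr ⟨ls, h₂, h₁, by rw [Option.bind_some, if_pos ⟨h₁, rfl, h₂⟩]; rfl⟩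
    · exact .inl (by rw [Option.bind_some, if_neg h]; rfl)

theorem flat_ne_nil (g : F) (w : Code G) : flat g w ≠ [] := by
  rcases flat_cases g w with h | ⟨ls, h, -, h'⟩
  · simp [h]
  · rintro h0
    rw [h'] at h0
    simp [h0] at h

theorem le_length_flatMap {α β : Type*} {f : α → List β} (hf : ∀ a, f a ≠ []) (l : List α) :
    l.length ≤ (l.flatMap f).length := by
  induction l with
  | nil => simp
  | cons a l ih =>
    have := List.length_pos_iff.2 (hf a)
    simp only [List.flatMap_cons, List.length_append, List.length_cons]
    omega

section Operations

variable (sig) (opQ : F → List Q → Q)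

open Classical in
/-- The operations of the model in terms of codes. -/
noncomputable def opCode (g : F) (ws : List (Code G)) : Code G :=
  if g = sig.f then ws.foldr mulWord []
  else if g = sig.i then invWord (ws.foldr mulWord [])
  else if g ∈ sig.assoc then genCode G (encode (g, ws.flatMap (flat g)))
  else (table sig opQ (g, ws)).getD (genCode G (encode (g, ws)))

/-- The operations of the model. -/
noncomputable def op (g : F) (ms : List (Model G)) : Model G := val (opCode sig opQ g (ms.map nf))

variable {sig opQ}

theorem op_f (ms : List (Model G)) : op sig opQ sig.f ms = ms.prod := by
  rw [op, opCode, if_pos rfl, ← nf_prod, val_nf]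

theorem op_i (ms : List (Model G)) : op sig opQ sig.i ms = ms.prod⁻¹ := by
  rw [op, opCode, if_neg i_ne_f, if_pos rfl, ← nf_prod, ← nf_inv, val_nf]

theorem op_assoc {g : F} (hg : g ∈ sig.assoc) (hf : g ≠ sig.f) (ms : List (Model G)) :
    op sig opQ g ms = gen G (encode (g, (ms.map nf).flatMap (flat g))) := by
  have hi : g ≠ sig.i := fun h => sig.i_not_assoc (h ▸ hg)
  rw [op, opCode, if_neg hf, if_neg hi, if_pos hg, val_genCode]

theorem op_free {g : F} (hg : g ∉ sig.assoc) (hi : g ≠ sig.i) (ms : List (Model G)) :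
    op sig opQ g ms =
      val ((table sig opQ (g, ms.map nf)).getD (genCode G (encode (g, ms.map nf)))) := by
  have hf : g ≠ sig.f := fun h => hg (h ▸ sig.f_assoc)
  rw [op, opCode, if_neg hf, if_neg hi, if_neg hg]

theorem op_free_emb {g : F} (hg : g ∉ sig.assoc) (hi : g ≠ sig.i) {as : List G}
    (hl : as.length = sig.arity g) (h : opQ g (as.map Subtype.val) ∈ G) :
    op sig opQ g (as.map (emb G)) = emb G ⟨_, h⟩ := by
  rw [op_free hg hi, List.map_map]
  rw [show (as.map (nf ∘ emb G)) = as.map fun a => nf (emb G a) from rfl, table_emb hl h]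
  exact val_nf _

/-- `opCode` maps normal forms to normal forms, so the operations of the model can be carried out on
reduced words alone. -/
theorem nf_op (g : F) (ms : List (Model G)) :
    nf (op sig opQ g ms) = opCode sig opQ g (ms.map nf) := by
  by_cases hf : g = sig.f
  · subst hf
    rw [op_f, nf_prod, opCode, if_pos rfl]
  by_cases hi : g = sig.i
  · subst hi
    rw [op_i, nf_inv, nf_prod, opCode, if_neg i_ne_f, if_pos rfl]
  by_cases hg : g ∈ sig.assoc
  · rw [op_assoc hg hf, nf_gen, opCode, if_neg hf, if_neg hi, if_pos hg]
  · rw [op_free hg hi, opCode, if_neg hf, if_neg hi, if_neg hg]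
    rcases ht : table sig opQ (g, ms.map nf) with _ | w
    · rw [Option.getD_none, val_genCode, nf_gen]
    · obtain ⟨as, -, -, h, rfl⟩ := table_eq_some ht
      rw [Option.getD_some, val_nf]

/-- For an associative symbol other than `f`, an inner application is a generator whose number
records a list that is already flattened, and `flat` unfolds exactly this list in the outer
application. -/
theorem isGroupModel_op : IsGroupModel sig (op sig opQ (G := G)) where
  op_f ms _ := op_f ms
  op_i a := by rw [op_i, List.prod_singleton]
  assoc := by
    intro g hg x y z hy _
    by_cases hf : g = sig.f
    · subst hf
      simp only [op_f, List.prod_append, List.prod_cons]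
    · rw [op_assoc hg hf, op_assoc hg hf, op_assoc hg hf]
      have hlen : 2 ≤ ((y.map nf).flatMap (flat g)).length :=
        le_trans (by simpa using hy) (le_length_flatMap (flat_ne_nil g) _)
      simp only [List.map_append, List.map_cons, List.flatMap_append, List.flatMap_cons, nf_gen,
        flat_gen hlen]

end Operations

/-! #### The homomorphism to the given group -/

section Hom

variable (opQ : F → List Q → Q)

/-- The value of the `n`-th free generator, in terms of the values of the previous ones. -/
noncomputable def genStep (G : Subgroup Q) [Primcodable G] (n : ℕ) (r : ℕ → Q) : Q :=
  (decode (α := F × List (Code G)) n).elim 1 fun p =>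
    opQ p.1 (p.2.map fun w => liftGen G r (val w))

/-- The values of the free generators. -/
noncomputable def genVal (G : Subgroup Q) [Primcodable G] (n : ℕ) : Q :=
  genStep opQ G n fun m => if _ : m < n then genVal G m else 1
termination_by n

theorem encode_lt_of_mem {α : Type*} [Encodable α] {a : α} {l : List α} (h : a ∈ l) :
    encode a < encode l := by
  induction l with
  | nil => simp at h
  | cons b l ih =>
    rw [encode_list_cons]
    rcases List.mem_cons.1 h with rfl | h
    · exact Nat.lt_succ_of_le (Nat.left_le_pair _ _)
    · exact (ih h).trans (Nat.lt_succ_of_le (Nat.right_le_pair _ _))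

/-- A generator occurring in a member of `ls` has a number below `encode (g, ls)`, since encodings
grow with nesting. The cutoff in `genVal` therefore has no effect here. -/
theorem genVal_encode (g : F) (ls : List (Code G)) :
    genVal opQ G (encode (g, ls)) =
      opQ g (ls.map fun w => liftGen G (genVal opQ G) (val w)) := by
  rw [genVal, genStep, encodek, Option.elim_some]
  congr 1
  refine List.map_congr_left fun w hw => liftGen_congr fun p hp n hn => ?_
  have h₁ : encode w < encode ls := encode_lt_of_mem hw
  have h₂ := encode_lt_of_mem hp
  have h₃ : p.1 ≤ encode p := Nat.left_le_pair p.1 (encode p.2)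
  have h₄ : encode ls ≤ encode (g, ls) := Nat.right_le_pair _ _
  rw [dif_pos (by omega)]

/-- The homomorphism from the model. -/
noncomputable def hom (G : Subgroup Q) [Primcodable G] : Model G →* Q := liftGen G (genVal opQ G)

theorem hom_gen (g : F) (ls : List (Code G)) :
    hom opQ G (gen G (encode (g, ls))) = opQ g (ls.map fun w => hom opQ G (val w)) :=
  (liftGen_gen _ _).trans (genVal_encode opQ g ls)

variable {opQ}

/-- Flattening is invisible in `Q` because the operation there is associative. The list `x` holds
the arguments already passed. -/
theorem hom_flat (hQ : IsGroupModel sig opQ) {g : F} (hg : g ∈ sig.assoc) (ws : List (Code G)) :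
    ∀ x : List Q, 2 ≤ x.length + ws.length →
      opQ g (x ++ (ws.flatMap (flat g)).map fun w => hom opQ G (val w)) =
        opQ g (x ++ ws.map fun w => hom opQ G (val w)) := by
  induction ws with
  | nil => intro x _; rfl
  | cons w ws ih =>
    intro x hx
    rw [List.length_cons] at hx
    have ih' := ih (x ++ [hom opQ G (val w)]) (by
      rw [List.length_append, List.length_singleton]; omega)
    rcases flat_cases g w with h | ⟨ls, hl, rfl, h⟩
    · simpa [h] using ih'
    · rw [List.flatMap_cons, h, List.map_append, List.map_cons]
      simp only [List.append_assoc, List.singleton_append] at ih'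
      rw [← ih', val_genCode, hom_gen, hQ.assoc g hg _ _ _ (by simpa using hl)]
      have := le_length_flatMap (flat_ne_nil g) ws
      simp only [List.length_append, List.length_cons, List.length_map]
      omega

/-- Free generators were given the required values by `genVal`, and tabulated values are those of
`Q`, since the homomorphism restricts to the inclusion on `G`. -/
theorem hom_op (hQ : IsGroupModel sig opQ) {g : F} {ms : List (Model G)}
    (h : sig.IsArity g ms.length) :
    hom opQ G (op sig opQ g ms) = opQ g (ms.map (hom opQ G)) := by
  have hmap : ((ms.map nf).map fun w => hom opQ G (val w)) = ms.map (hom opQ G) := by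
    simp [Function.comp_def]
  by_cases hf : g = sig.f
  · subst hf
    rw [op_f, map_list_prod, hQ.op_f]
    simpa using h.1 sig.f_assoc
  by_cases hi : g = sig.i
  · subst hi
    obtain ⟨a, rfl⟩ := List.length_eq_one_iff.1 ((h.2 sig.i_not_assoc).trans sig.arity_i)
    rw [op_i, map_inv, List.prod_singleton, List.map_singleton, hQ.op_i]
  by_cases hg : g ∈ sig.assoc
  · rw [op_assoc hg hf, hom_gen]
    have := hom_flat hQ hg (ms.map nf) [] (by simpa using h.1 hg)
    rw [List.nil_append, List.nil_append] at this
    rw [this, hmap]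
  · rw [op_free hg hi]
    rcases ht : table sig opQ (g, ms.map nf) with _ | w
    · rw [Option.getD_none, val_genCode, hom_gen, hmap]
    · obtain ⟨as, has, -, h, rfl⟩ := table_eq_some ht
      rw [Option.getD_some, val_nf, hom, liftGen_emb]
      obtain rfl : as.map (emb G) = ms := by
        refine List.map_injective_iff.2 nf_injective ?_
        rw [← has, List.map_map]
        rfl
      rw [List.map_map]
      exact congrArg _ (List.map_congr_left fun a _ => (liftGen_emb _ a).symm)

theorem hom_eval {V : Type*} (hQ : IsGroupModel sig opQ) (φ : V → Model G) (t : Term sig V) :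
    hom opQ G (t.eval (op sig opQ) φ) = t.eval opQ (hom opQ G ∘ φ) := by
  induction t using Term.induction_list with
  | const c => rfl
  | app g l h ih =>
    rw [Term.eval_appList, Term.eval_appList, hom_op hQ (by simpa using h), List.map_map]
    congr 1
    exact List.map_congr_left ih

end Hom

end Model

end GroupSignature

/-! ### Deciding the word problem -/

namespace GroupSignature

open FreePower Encodable

variable {F K : Type*} {sig : GroupSignature F K} {Q : Type*} [Group Q] {G : Subgroup Q}

theorem Term.code_appList (g : F) (ts : List (Term sig K)) (h : sig.IsArity g ts.length) :
    (Term.appList g ts h).code = Sum.inl (g, ts.length) :: (ts.map Term.code).flatten := by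
  rw [Term.appList, Term.code]
  congr 2
  apply List.ext_getElem <;> simp

namespace Model

section Primrec

open Primrec

variable {opQ : F → List Q → Q} [Primcodable F] [Primcodable G]

theorem primrec_genCode : Primrec (genCode G) :=
  list_cons.comp (pair succ (const _)) (const [])

theorem primrec_flat : Primrec₂ (flat (F := F) (G := G)) := by
  classical
  have hdec : Primrec fun x : F × Code G =>
      x.2.head?.bind fun q => decode (α := F × List (Code G)) (q.1 - 1) :=
    option_bind (list_head?.comp snd)
      (Primrec.decode.comp (nat_sub.comp (fst.comp snd) (const 1))).to₂
  have hcond : PrimrecPred fun y : (F × Code G) × (F × List (Code G)) =>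
      y.1.2 = genCode G (encode y.2) ∧ y.2.1 = y.1.1 ∧ 2 ≤ y.2.2.length :=
    (Primrec.eq.comp (snd.comp fst) (primrec_genCode.comp (Primrec.encode.comp snd))).and
      ((Primrec.eq.comp (fst.comp snd) (fst.comp fst)).and
        (nat_le.comp (const 2) (list_length.comp (snd.comp snd))))
  exact (option_getD.comp (option_bind hdec
    (Primrec.ite hcond (option_some.comp (snd.comp snd)) (const none)).to₂)
    (list_cons.comp snd (const [])) :)

variable [Finite F] [Finite G]

/-- There are finitely many symbols, arities are bounded and `G` is finite, so the table has
finitely many entries. Nothing about the computability of `opQ` is needed. -/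
theorem primrec_table : Primrec (table sig opQ (G := G)) := by
  refine Primrec.of_finite_support none _ ?_
  obtain ⟨N, hN⟩ := (Set.finite_range sig.arity).bddAbove
  have hfin : {as : List G | as.length ≤ N}.Finite := List.finite_length_le _ N
  refine (((Set.finite_univ (α := F)).prod hfin).image
    fun p => (p.1, p.2.map fun a => nf (emb G a))).subset ?_
  rintro ⟨g, ws⟩ h
  obtain ⟨w, hw⟩ := Option.ne_none_iff_exists'.1 h
  obtain ⟨as, rfl, hl, -⟩ := table_eq_some hw
  exact ⟨(g, as), ⟨Set.mem_univ _, hl.trans_le (hN ⟨g, rfl⟩)⟩, rfl⟩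

theorem primrec_opCode : Primrec₂ (opCode sig opQ (G := G)) := by
  classical
  have hprod : Primrec fun x : F × List (Code G) => x.2.foldr mulWord [] :=
    (primrec_prodWord primrec_prod_mul).comp snd
  have hassoc : PrimrecPred fun g : F => g ∈ sig.assoc := (Primrec.dom_finite _).primrecPred
  have hgen : Primrec fun x : F × List (Code G) => genCode G (encode x) :=
    primrec_genCode.comp Primrec.encode
  refine Primrec.ite (Primrec.eq.comp fst (const _)) hprod
    (Primrec.ite (Primrec.eq.comp fst (const _))
      ((primrec_invWord primrec_prod_mul primrec_prod_inv).comp hprod)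
      (Primrec.ite (hassoc.comp fst) (hgen.comp (pair fst ?_))
        (option_getD.comp primrec_table hgen)))
  exact list_flatMap snd (primrec_flat.comp (fst.comp fst) snd).to₂

end Primrec

/-! ### A stack machine that evaluates prefix notation. -/

section Machine

variable (sig) (opQ : F → List Q → Q) [Primcodable F] [Primcodable G] (φ : K → Model G)

open Classical in
/-- Evaluation of a symbol on a stack of codes. -/
noncomputable def step (x : (F × ℕ) ⊕ K) (o : Option (List (Code G))) :
    Option (List (Code G)) :=
  o.bind fun st => Sum.casesOn x
    (fun p => if sig.IsArity p.1 p.2 ∧ p.2 ≤ st.length then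
      some (opCode sig opQ p.1 (st.take p.2) :: st.drop p.2) else none)
    fun c => some (nf (φ c) :: st)

/-- Evaluation of a string in prefix notation; the result is a stack of codes. -/
noncomputable def run (l : List ((F × ℕ) ⊕ K)) : Option (List (Code G)) :=
  l.foldr (step sig opQ φ) (some [])

theorem primrec_run [Finite F] [Finite G] [Finite K] [Primcodable K] :
    Primrec (run sig opQ φ) := by
  classical
  open Primrec in
  have harity : PrimrecPred fun p : F × ℕ => sig.IsArity p.1 p.2 := by
    have hassoc : PrimrecPred fun g : F => g ∈ sig.assoc := (Primrec.dom_finite _).primrecPred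
    refine (((hassoc.comp fst).and (nat_le.comp (const 2) snd)).or
      ((hassoc.comp fst).not.and
        (Primrec.eq.comp snd ((Primrec.dom_finite sig.arity).comp fst)))).of_eq fun p => ?_
    unfold IsArity
    tauto
  open Primrec in
  have hstep : Primrec₂ (step sig opQ φ) := by
    refine option_bind snd (sumCasesOn (fst.comp fst) ?_ ?_)
    · refine Primrec.ite ((harity.comp snd).and
        (nat_le.comp (snd.comp snd) (list_length.comp (snd.comp fst))))
        (option_some.comp (list_cons.comp (primrec_opCode.comp (fst.comp snd) ?_) ?_)) (const none)
      · exact list_take.comp (snd.comp snd) (snd.comp fst)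
      · exact list_drop.comp (snd.comp snd) (snd.comp fst)
    · exact option_some.comp
        (list_cons.comp ((Primrec.dom_finite fun c => nf (φ c)).comp snd) (snd.comp fst))
  exact Primrec.list_foldr .id (.const _)
    (hstep.comp (Primrec.fst.comp Primrec.snd) (Primrec.snd.comp Primrec.snd)).to₂

variable {sig opQ φ}

/-- The string is read from the right, so when a symbol is reached the values of its arguments are
on top of the stack in their order. -/
theorem foldr_step_code (t : Term sig K) : ∀ st : List (Code G),
    t.code.foldr (step sig opQ φ) (some st) = some (nf (t.eval (op sig opQ) φ) :: st) := by
  induction t using Term.induction_list with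
  | const c => intro st; rfl
  | app g ts h ih =>
    intro st
    have hargs : (ts.map Term.code).flatten.foldr (step sig opQ φ) (some st) =
        some (ts.map (fun t => nf (t.eval (op sig opQ) φ)) ++ st) := by
      clear h
      induction ts with
      | nil => rfl
      | cons t ts ih' =>
        rw [List.map_cons, List.flatten_cons, List.foldr_append, ih' fun s hs => ih s (by simp [hs]),
          ih t (by simp)]
        rfl
    rw [Term.code_appList, List.foldr_cons, hargs, Term.eval_appList, nf_op, List.map_map]
    simp [step, h, Function.comp_def]

/-- The machine is also a parser: since it checks arities and stack size, any successful run reads a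
concatenation of terms. Malformed strings are thereby rejected. -/
theorem exists_of_run_eq_some (l : List ((F × ℕ) ⊕ K)) : ∀ {ws : List (Code G)},
    run sig opQ φ l = some ws → ∃ ts : List (Term sig K), l = (ts.map Term.code).flatten ∧
      ws = ts.map fun t => nf (t.eval (op sig opQ) φ) := by
  induction l with
  | nil =>
    intro ws h
    obtain rfl : [] = ws := Option.some.inj h
    exact ⟨[], rfl, rfl⟩
  | cons x l ih =>
    intro ws h
    obtain ⟨st, hst, h⟩ := Option.bind_eq_some_iff.1 h
    obtain ⟨ts, rfl, rfl⟩ := ih hst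
    rcases x with ⟨g, n⟩ | c
    · dsimp only at h
      split_ifs at h with hn
      obtain ⟨hg, hn⟩ := hn
      rw [List.length_map] at hn
      obtain rfl := Option.some.inj h
      have hlen : (ts.take n).length = n := by simpa using hn
      refine ⟨Term.appList g (ts.take n) (by rwa [hlen]) :: ts.drop n, ?_, ?_⟩
      · rw [List.map_cons, List.flatten_cons, Term.code_appList, hlen, List.cons_append,
          ← List.flatten_append, ← List.map_append, List.take_append_drop]
      · rw [List.map_cons, Term.eval_appList, nf_op]
        simp only [List.map_take, List.map_drop, List.map_map, Function.comp_def]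
    · obtain rfl := Option.some.inj h
      exact ⟨.const c :: ts, rfl, rfl⟩

theorem run_eq_singleton {l : List ((F × ℕ) ⊕ K)} {w : Code G} :
    run sig opQ φ l = some [w] ↔
      ∃ t : Term sig K, t.code = l ∧ nf (t.eval (op sig opQ) φ) = w := by
  constructor
  · intro h
    obtain ⟨ts, rfl, hw⟩ := exists_of_run_eq_some l h
    obtain ⟨t, rfl⟩ : ∃ t, ts = [t] := List.length_eq_one_iff.1 (by
      simpa using (congrArg List.length hw).symm)
    exact ⟨t, by simp, by simpa using hw.symm⟩
  · rintro ⟨t, rfl, rfl⟩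
    exact foldr_step_code t []

theorem computablePred_of_eval_eq_iff [Finite F] [Finite G] [Finite K] [Primcodable K]
    {E : Set (Sym2 (Term sig K))}
    (h : ∀ s t, EqMod sig E s t ↔ s.eval (op sig opQ) φ = t.eval (op sig opQ) φ) :
    ComputablePred fun p : List ((F × ℕ) ⊕ K) × List ((F × ℕ) ⊕ K) =>
      ∃ s t : Term sig K, s.code = p.1 ∧ t.code = p.2 ∧ EqMod sig E s t := by
  classical
  have hrun := primrec_run sig opQ φ
  have hp : PrimrecPred fun p : List ((F × ℕ) ⊕ K) × List ((F × ℕ) ⊕ K) =>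
      run sig opQ φ p.1 = run sig opQ φ p.2 ∧
        (run sig opQ φ p.1).map List.length = some 1 :=
    (Primrec.eq.comp (hrun.comp .fst) (hrun.comp .snd)).and
      (Primrec.eq.comp (Primrec.option_map (hrun.comp .fst) (Primrec.list_length.comp .snd).to₂)
        (.const _))
  refine Computable.computablePred (Primrec.to_comp ?_)
  refine PrimrecPred.decide (hp.of_eq fun p => ?_)
  constructor
  · rintro ⟨h₁, h₂⟩
    obtain ⟨ws, hws, hlen⟩ := Option.map_eq_some_iff.1 h₂
    obtain ⟨w, rfl⟩ := List.length_eq_one_iff.1 hlen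
    obtain ⟨s, hs, hsw⟩ := run_eq_singleton.1 hws
    obtain ⟨t, ht, htw⟩ := run_eq_singleton.1 (h₁.symm.trans hws)
    exact ⟨s, t, hs, ht, (h s t).2 (nf_injective (hsw.trans htw.symm))⟩
  · rintro ⟨s, t, hs, ht, hst⟩
    have h₁ := (run_eq_singleton (opQ := opQ) (φ := φ)).2 ⟨s, hs, rfl⟩
    have h₂ := (run_eq_singleton (opQ := opQ) (φ := φ)).2 ⟨t, ht, rfl⟩
    rw [(h s t).1 hst] at h₁
    exact ⟨h₁.trans h₂.symm, by rw [h₁]; rfl⟩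

end Machine

end Model

end GroupSignature

/-! ### The main theorem -/

namespace GroupSignature

open FreePower Encodable

variable {F K : Type*} {sig : GroupSignature F K} {C : Set (Cst K)}

theorem Represents.eval {A : Type*} [Group A] {op : F → List A → A} (hop : IsGroupModel sig op)
    (φ : Cst K → A) {u : List (Cst K)} {t : FlatTerm sig} (h : Represents sig.f u t) :
    t.toTerm.eval op φ = (u.map φ).prod := by
  cases h with
  | constant c => simp
  | app w hw =>
    rw [FlatTerm.eval_toTerm_app, hop.op_f]
    simpa using hw.1 sig.f_assoc

theorem IsPhaseTwo.inl_mem {D : Finset ℕ} {E' SE : Set (Sym2 (FlatTerm sig))}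
    (h : IsPhaseTwo sig D E' C SE) (c : K) : Sum.inl c ∈ C := by
  obtain ⟨ν, E'', -, -, -, rfl, -⟩ := h
  exact .inl inl_mem_constants

/-- A system of flat equations that holds under a valuation in a subgroup holds in the model. -/
theorem Model.exists_flatSat {Q : Type*} [Group Q] {G : Subgroup Q} [Primcodable F] [Primcodable G]
    {opQ : F → List Q → Q} (hQ : IsGroupModel sig opQ) {φ : Cst K → Q} (hφ : ∀ c ∈ C, φ c ∈ G) :
    ∃ ψ : Cst K → Model G, (∀ c (hc : φ c ∈ G), ψ c = emb G ⟨φ c, hc⟩) ∧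
      ∀ e, ValidEqn sig C e → FlatSat opQ φ e → FlatSat (op sig opQ) ψ e := by
  classical
  -- The default `1` is irrelevant, because valid equations contain only constants of `C`, whose
  -- values lie in `G`.
  let ψ : Cst K → Model G := fun c => if hc : φ c ∈ G then emb G ⟨φ c, hc⟩ else 1
  have hψ : ∀ c (hc : φ c ∈ G), ψ c = emb G ⟨φ c, hc⟩ := fun c hc => dif_pos hc
  have hlist : ∀ w : List (Cst K), (∀ c ∈ w, c ∈ C) →
      ∃ as : List G, w.map φ = as.map Subtype.val ∧ w.map ψ = as.map (emb G) := by
    intro w hw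
    induction w with
    | nil => exact ⟨[], rfl, rfl⟩
    | cons c w ih =>
      obtain ⟨as, h₁, h₂⟩ := ih fun x hx => hw x (by simp [hx])
      exact ⟨⟨φ c, hφ c (hw c (by simp))⟩ :: as, by simp [h₁], by
        simp [h₂, hψ c (hφ c (hw c (by simp)))]⟩
  have hcoe : ∀ as : List G, (as.map Subtype.val).prod = (as.prod : Q) := fun as =>
    (map_list_prod G.subtype as).symm
  -- For an uninterpreted `g` the arguments and the value lie in `G`, so the table prescribes the
  -- same value in the model; for `i` it is the inverse in `G`.
  have key : ∀ g w (h : sig.IsArity g w.length) c, g ∉ sig.assoc → (∀ x ∈ w, x ∈ C) → c ∈ C →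
      (FlatTerm.app g w h).toTerm.eval opQ φ = φ c →
      (FlatTerm.app g w h).toTerm.eval (op sig opQ) ψ = ψ c := by
    intro g w h c hg hw hc he
    rw [FlatTerm.eval_toTerm_app] at he ⊢
    obtain ⟨as, h₁, h₂⟩ := hlist w hw
    have hlen : as.length = w.length := by simpa using (congrArg List.length h₁).symm
    rw [h₁] at he
    rw [h₂, hψ c (hφ c hc)]
    by_cases hi : g = sig.i
    · subst hi
      obtain ⟨a, rfl⟩ := List.length_eq_one_iff.1 (hlen.trans ((h.2 hg).trans sig.arity_i))
      rw [List.map_singleton, hQ.op_i] at he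
      rw [op_i, List.map_singleton, List.prod_singleton, ← map_inv]
      exact congrArg (emb G) (Subtype.ext he)
    · have hmem : opQ g (as.map Subtype.val) ∈ G := he ▸ hφ c hc
      rw [op_free_emb hg hi (hlen.trans (h.2 hg)) hmem]
      exact congrArg (emb G) (Subtype.ext he)
  refine ⟨ψ, hψ, fun e => ?_⟩
  induction e with
  | h l r =>
  intro hv he
  rw [flatSat_mk] at he ⊢
  obtain ⟨-, hl, hr⟩ := validEqn_mk.1 hv
  rcases hv.cases with ⟨u, v, hu, hv'⟩ | ⟨g, w, hw, c, hg, rfl, rfl⟩ | ⟨g, w, hw, c, hg, rfl, rfl⟩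
  · rw [hu.eval hQ, hv'.eval hQ] at he
    rw [hu.eval isGroupModel_op, hv'.eval isGroupModel_op]
    obtain ⟨as, h₁, h₂⟩ := hlist u (hu.admissible.1 hl)
    obtain ⟨bs, h₃, h₄⟩ := hlist v (hv'.admissible.1 hr)
    rw [h₁, h₃, hcoe, hcoe] at he
    rw [h₂, h₄, ← map_list_prod, ← map_list_prod, Subtype.ext he]
  · exact key g w hw c hg hl.2 hr he
  · exact (key g w hw c hg hr.2 hl he.symm).symm

/-- The model is sound because it satisfies the system of flat equations and hence `E`. It is
complete because the homomorphism to the term group sends the value of a term to its class. -/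
theorem wordProblemDecidable [Finite F] [Finite K] {E : Set (Sym2 (Term sig K))}
    (hE : ∀ e ∈ E, ∀ t ∈ e, ∀ g ∈ sig.assoc, t.Occurs g → g = sig.f)
    {SE : Set (Sym2 (FlatTerm sig))} (hSE : IsInitialSystem sig E C SE)
    [Finite (PresentationMonoid sig C SE)]
    (hunit : ∀ x : PresentationMonoid sig C SE, IsUnit x) : WordProblemDecidable sig E := by
  intro _ _
  obtain ⟨D, E', hP₁, hP₂⟩ := hSE
  have hvalid := hP₁.valid hE
  have hsys := hP₂.isGroupSystem hvalid
  have hQ : IsGroupModel sig (TermGroup.op E) := TermGroup.isGroupModel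
  obtain ⟨φ₁, hφ₁, hs₁⟩ := hP₁.exists_sat hQ hE (φ := fun c => TermGroup.mk E (.const c)) rfl
    TermGroup.sat
  obtain ⟨φ, hφ, hs⟩ := hP₂.exists_sat hQ hvalid (hφ₁ _) hs₁
  replace hφ : ∀ c, φ (Sum.inl c) = TermGroup.mk E (.const c) := fun c => (hφ c).trans (hφ₁ c)
  obtain ⟨Φ, hΦ⟩ := hsys.exists_hom φ (hφ _) (by
    intro l r hlr
    obtain ⟨hl, hr⟩ := (hsys.valid _ hlr.1.1).represents_of_headIn hlr.2
    have := hs _ hlr.1.1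
    rwa [flatSat_mk, hl.eval hQ, hr.eval hQ] at this)
  -- Invertibility in the presented monoid makes its image closed under inverses, hence a finite
  -- subgroup.
  let G : Subgroup (TermGroup sig E) :=
    { MonoidHom.mrange Φ with
      inv_mem' := by
        rintro _ ⟨x, rfl⟩
        obtain ⟨u, rfl⟩ := hunit x
        exact ⟨(u⁻¹ : (PresentationMonoid sig C SE)ˣ), by
          rw [eq_inv_iff_mul_eq_one, ← map_mul, Units.inv_mul, map_one]⟩ }
  have hG : ∀ c ∈ C, φ c ∈ G := hΦ
  have : Finite G := (Set.finite_range Φ).to_subtype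
  obtain ⟨n, ⟨e⟩⟩ := Finite.exists_equiv_fin G
  -- Any numbering will do, as every function on a finite type is primitive recursive.
  let _ : Primcodable G := Primcodable.ofEquiv _ e
  obtain ⟨ψ, hψ, hsat⟩ := Model.exists_flatSat (G := G) hQ hG
  have hM : IsGroupModel sig (Model.op sig (TermGroup.op E) (G := G)) := Model.isGroupModel_op
  have hone : ψ (Sum.inl sig.one) = 1 := by
    rw [hψ _ (hG _ hsys.one_mem), ← map_one (Model.emb G)]
    exact congrArg _ (Subtype.ext (hφ _))
  refine Model.computablePred_of_eval_eq_iff (opQ := TermGroup.op E) (φ := ψ ∘ Sum.inl)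
    fun s t => ⟨fun h => ?_, fun h => ?_⟩
  · exact hM.eval_eq_of_eqMod hone (hP₁.sat hM hone fun e he =>
      hsat e (hsys.valid e (hP₂.subset he)) (hs e (hP₂.subset he))) h
  · have := congrArg (Model.hom (TermGroup.op E) G) h
    have hhom : Model.hom (TermGroup.op E) G ∘ ψ ∘ Sum.inl =
        fun c => TermGroup.mk E (.const c) := by
      funext c
      have hc := hG _ (hP₂.inl_mem c)
      exact (congrArg _ (hψ _ hc)).trans ((Model.liftGen_emb _ _).trans (hφ c))
    rwa [Model.hom_eval hQ, Model.hom_eval hQ, hhom, TermGroup.eval_op, TermGroup.eval_op,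
      TermGroup.mk_eq] at this

end GroupSignature

open GroupSignature in
theorem proposition3p21 {F K : Type*} [Finite F] [Finite K] [LinearOrder K]
    (sig : GroupSignature F K) (hone : ∀ c : K, sig.one ≤ c)
    (E : Set (Sym2 (Term sig K))) (hfin : E.Finite)
    (hE : ∀ e ∈ E, ∀ t ∈ e, ∀ g ∈ sig.assoc, t.Occurs g → g = sig.f)
    (C : Set (Cst K)) (SE : Set (Sym2 (FlatTerm sig))) (hSE : IsInitialSystem sig E C SE)
    (hgroup : Finite (PresentationMonoid sig C SE) ∧
      ∀ x : PresentationMonoid sig C SE, IsUnit x) :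
    (∀ S : ℕ → Set (Sym2 (FlatTerm sig)), IsDerivation sig SE S → IsFair sig S →
      (persisting S).Finite ∧
      ∃ n, ∀ j ≥ n, persisting S ⊆ S j ∧
        ∀ s t : FlatTerm sig, s(s, t) ∈ S j →
          JoinableMod (orient (persisting S)) s.toTerm t.toTerm) ∧
    WordProblemDecidable sig E := by
  have := hgroup.1
  refine ⟨fun S hS hf => ?_, wordProblemDecidable hE hSE hgroup.2⟩
  obtain ⟨D, E', hP₁, hP₂⟩ := hSE
  exact hf.terminates (hP₂.isGroupSystem (hP₁.valid hE)) hS
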